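/- Let $n\ge 1$, $G_1=SU(n+1,1)$, $\mathfrak g_1=\mathfrak{su}(n+1,1)$, $G_2=Sp(n+1,\mathbb R)$, $\mathfrak g_2=\mathfrak{sp}(n+1,\mathbb R)$. For $i=1,2$ let $\widehat C_i=\mathrm{Ad}_{G_i}(e_+^2)\subset\mathfrak g_i$ be the root cone, i.e. the adjoint orbit of a maximal (long) root vector $e_+^2$, and let $C_i$ be its oriented projectivization, the set of rays $\mathbb R_{>0}X$ with $X\in\widehat C_i$; as a submanifold of the unit sphere of $\mathfrak g_i$, $C_1$ is diffeomorphic to $S^{2n+1}$ and $C_2$ to $\mathbb{RP}^{2n+1}$. For $a_i\in\mathfrak g_i$ the one-parameter group $T_{a_i}=\{\exp(ta_i)\}\subset G_i$ acts on $C_i$ through the adjoint action. We say that the actions of $T_{a_1}$ and $T_{a_2}$ are locally conjugate if there is a $C^\infty$ local diffeomorphism $\Phi:C_1\to C_2$ with $\Phi(\exp(ta_1)\cdot x)=\exp(ta_2)\cdot\Phi(x)$ for all $t\in\mathbb R$ and $x\in C_1$. Let $\mathfrak u(n+1)$ be the Lie algebra of skew-Hermitian matrices, with its standard embeddings $\iota_1(A)=\mathrm{diag}(A,-\mathrm{tr}A)\in\mathfrak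 g_1$ and $\iota_2(A)=\begin{pmatrix}\mathrm{Re}A&-\mathrm{Im}A\\ \mathrm{Im}A&\mathrm{Re}A\end{pmatrix}\in\mathfrak g_2$. Theorem. Let $a_1\in\mathfrak g_1$ and $a_2\in\mathfrak g_2$. (1) The actions of $T_{a_1}$ on $C_1$ and of $T_{a_2}$ on $C_2$ are locally conjugate if and only if both $a_i$ lie in $\mathfrak u(n+1)$ up to the adjoint action and act there by the same linear action; precisely, if and only if there are $A,B\in\mathfrak u(n+1)$ such that $a_1$ is $G_1$-conjugate to $\iota_1(A)$, $a_2$ is $G_2$-conjugate to $\iota_2(B)$, and the linear maps $A+\mathrm{tr}(A)I$ (which is how $\iota_1(A)$ acts on $C_1=S^{2n+1}\subset\mathbb C^{n+1}$) and $B$ of $\mathbb C^{n+1}$ are conjugate by an $\mathbb R$-linear automorphism of $\mathbb C^{n+1}$. (2) The action of $T_{a_1}$ on $C_1$ is locally conjugate to the action of $T_{b_2}$ on $C_2$ for some $b_2\in\mathfrak g_2$ if and only if $a_1$ is $G_1$-conjugate to an element of $\iota_1(\mathfrak u(n+1))$. (3) The action of $T_{a_2}$ on $C_2$ is locally conjugate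 to the action of $T_{b_1}$ on $C_1$ for some $b_1\in\mathfrak g_1$ if and only if $a_2$ is $G_2$-conjugate to an element of $\iota_2(\mathfrak u(n+1))$. -/

import Mathlib

open scoped Matrix ContDiff

noncomputable section

namespace RootCone

/-! ### Smooth maps and local diffeomorphisms between embedded submanifolds -/

/-- `f` restricts to a local diffeomorphism of class `C^∞` from `S` to `T`, where `S` and `T` are
subsets (in practice embedded submanifolds) of normed spaces `E` and `F`: `f` maps `S` to `T`, and
every point of `S` has a relatively open neighbourhood `S ∩ U` which `f` maps bijectively onto a
relatively open subset `T ∩ V` of `T`, such that `f` is smooth on `S ∩ U` and the inverse is smooth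
on `T ∩ V`. -/
def IsLocalDiffeoOn {E F : Type*} [NormedAddCommGroup E] [NormedSpace ℝ E]
    [NormedAddCommGroup F] [NormedSpace ℝ F] (f : E → F) (S : Set E) (T : Set F) : Prop :=
  Set.MapsTo f S T ∧
    ∀ x ∈ S, ∃ (U : Set E) (V : Set F) (g : F → E), IsOpen U ∧ IsOpen V ∧ x ∈ U ∧
      Set.MapsTo f (S ∩ U) (T ∩ V) ∧ Set.MapsTo g (T ∩ V) (S ∩ U) ∧
      Set.InvOn g f (S ∩ U) (T ∩ V) ∧
      ContDiffOn ℝ ∞ f (S ∩ U) ∧ ContDiffOn ℝ ∞ g (T ∩ V)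

/-! ### Adjoint orbits, oriented projectivizations and one-parameter groups, for matrices -/

section Generic

open scoped Matrix.Norms.Frobenius

variable {ι 𝕜 : Type*} [Fintype ι] [DecidableEq ι] [RCLike 𝕜]

/-- The orbit of the matrix `e` under conjugation by the elements of a matrix group `G`. -/
def adOrbit (G : Set (Matrix ι ι 𝕜)) (e : Matrix ι ι 𝕜) : Set (Matrix ι ι 𝕜) :=
  {X | ∃ g ∈ G, X = g * e * g⁻¹}

/-- Two matrices are conjugate under the matrix group `G`. -/
def AdConj (G : Set (Matrix ι ι 𝕜)) (a b : Matrix ι ι 𝕜) : Prop :=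
  ∃ g ∈ G, g * a * g⁻¹ = b

/-- The representative of Frobenius norm one of the ray (oriented line) `ℝ_{>0} X`. The space of
oriented lines of a space of matrices is identified in this way with its unit sphere. -/
def normalize (X : Matrix ι ι 𝕜) : Matrix ι ι 𝕜 :=
  ((‖X‖⁻¹ : ℝ) : 𝕜) • X

/-- The oriented projectivization of a cone of nonzero matrices: the set of its rays, each
represented by its element of norm one. -/
def orientedProj (C : Set (Matrix ι ι 𝕜)) : Set (Matrix ι ι 𝕜) :=
  normalize '' C

/-- The action of `exp (t a)` on rays induced by the adjoint action
`X ↦ exp (t a) X exp (- t a)`. -/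
def rayFlow (a : Matrix ι ι 𝕜) (t : ℝ) (X : Matrix ι ι 𝕜) : Matrix ι ι 𝕜 :=
  normalize (NormedSpace.exp (t • a) * X * NormedSpace.exp (-(t • a)))

end Generic

attribute [local instance 100] LieRing.ofAssociativeRing

/-! ### The group `SU(n+1,1)` and its Lie algebra -/

/-- The Gram matrix `diag(1, …, 1, -1)` of the standard Hermitian form of signature `(n+1,1)`. -/
def hermForm (n : ℕ) : Matrix (Fin (n + 1) ⊕ Unit) (Fin (n + 1) ⊕ Unit) ℂ :=
  Matrix.fromBlocks 1 0 0 (-1)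

/-- The group `SU(n+1,1)`. -/
def SU (n : ℕ) : Set (Matrix (Fin (n + 1) ⊕ Unit) (Fin (n + 1) ⊕ Unit) ℂ) :=
  {g | gᴴ * hermForm n * g = hermForm n ∧ g.det = 1}

/-- The real Lie algebra `su(n+1,1)`. -/
def su (n : ℕ) : LieSubalgebra ℝ (Matrix (Fin (n + 1) ⊕ Unit) (Fin (n + 1) ⊕ Unit) ℂ) where
  carrier := {a | aᴴ * hermForm n + hermForm n * a = 0 ∧ a.trace = 0}
  zero_mem' := by simp
  add_mem' := by
    rintro a b ⟨ha, ha'⟩ ⟨hb, hb'⟩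
    refine ⟨?_, by simp [ha', hb']⟩
    have h : (a + b)ᴴ * hermForm n + hermForm n * (a + b)
        = (aᴴ * hermForm n + hermForm n * a) + (bᴴ * hermForm n + hermForm n * b) := by
      rw [Matrix.conjTranspose_add, add_mul, mul_add]; abel
    rw [h, ha, hb, add_zero]
  smul_mem' := by
    rintro c a ⟨ha, ha'⟩
    refine ⟨?_, by simp [ha']⟩
    rw [Matrix.conjTranspose_smul, star_trivial, smul_mul_assoc, mul_smul_comm, ← smul_add, ha,
      smul_zero]
  lie_mem' := by
    rintro a b ⟨ha, -⟩ ⟨hb, -⟩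
    refine ⟨?_, by rw [Ring.lie_def, Matrix.trace_sub, Matrix.trace_mul_comm, sub_self]⟩
    have ha' : aᴴ * hermForm n = -(hermForm n * a) := eq_neg_of_add_eq_zero_left ha
    have hb' : bᴴ * hermForm n = -(hermForm n * b) := eq_neg_of_add_eq_zero_left hb
    rw [Ring.lie_def, Matrix.conjTranspose_sub, Matrix.conjTranspose_mul,
      Matrix.conjTranspose_mul, sub_mul, mul_assoc, mul_assoc, ha', hb', mul_neg, mul_neg,
      ← mul_assoc, ← mul_assoc, ha', hb']
    noncomm_ring

/-- The maximal root element `e₊²` of `su(n+1,1)`: the matrix with the lower right `2 × 2` block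
`(i, i; -i, -i)` and all other entries zero. -/
def suRoot (n : ℕ) : Matrix (Fin (n + 1) ⊕ Unit) (Fin (n + 1) ⊕ Unit) ℂ :=
  Matrix.single (Sum.inl (Fin.last n)) (Sum.inl (Fin.last n)) Complex.I
    + Matrix.single (Sum.inl (Fin.last n)) (Sum.inr ()) Complex.I
    - Matrix.single (Sum.inr ()) (Sum.inl (Fin.last n)) Complex.I
    - Matrix.single (Sum.inr ()) (Sum.inr ()) Complex.I

/-- The projectivized root cone of `su(n+1,1)`. -/
def suCone (n : ℕ) : Set (Matrix (Fin (n + 1) ⊕ Unit) (Fin (n + 1) ⊕ Unit) ℂ) :=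
  orientedProj (adOrbit (SU n) (suRoot n))

/-! ### The group `Sp(n+1,ℝ)` and its Lie algebra -/

/-- The group `Sp(n+1,ℝ)` of symplectic matrices of size `2n+2`. -/
def Sp (n : ℕ) : Set (Matrix (Fin (n + 1) ⊕ Fin (n + 1)) (Fin (n + 1) ⊕ Fin (n + 1)) ℝ) :=
  (Matrix.symplecticGroup (Fin (n + 1)) ℝ :
    Set (Matrix (Fin (n + 1) ⊕ Fin (n + 1)) (Fin (n + 1) ⊕ Fin (n + 1)) ℝ))

/-- The Lie algebra `sp(n+1,ℝ)`. -/
def sp (n : ℕ) :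
    LieSubalgebra ℝ (Matrix (Fin (n + 1) ⊕ Fin (n + 1)) (Fin (n + 1) ⊕ Fin (n + 1)) ℝ) :=
  LieAlgebra.Symplectic.sp (Fin (n + 1)) ℝ

/-- The long root element `e₊²` of `sp(n+1,ℝ)`: the endomorphism `z ↦ 2 ω(e, z) e`, where
`e` is the first vector of the standard symplectic basis and `ω` the standard symplectic form. -/
def spRoot (n : ℕ) : Matrix (Fin (n + 1) ⊕ Fin (n + 1)) (Fin (n + 1) ⊕ Fin (n + 1)) ℝ :=
  Matrix.single (Sum.inl 0) (Sum.inr 0) 2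

/-- The projectivized root cone of `sp(n+1,ℝ)`. -/
def spCone (n : ℕ) : Set (Matrix (Fin (n + 1) ⊕ Fin (n + 1)) (Fin (n + 1) ⊕ Fin (n + 1)) ℝ) :=
  orientedProj (adOrbit (Sp n) (spRoot n))

/-! ### The unitary Lie algebra `u(n+1)` and its standard embeddings -/

/-- `u(n+1)`: the skew-Hermitian complex matrices of size `n+1`. -/
def u (n : ℕ) : Set (Matrix (Fin (n + 1)) (Fin (n + 1)) ℂ) :=
  {A | Aᴴ = -A}

/-- The standard embedding of `u(n+1)` into `su(n+1,1)`, `A ↦ diag(A, -tr A)`. -/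
def toSU {n : ℕ} (A : Matrix (Fin (n + 1)) (Fin (n + 1)) ℂ) :
    Matrix (Fin (n + 1) ⊕ Unit) (Fin (n + 1) ⊕ Unit) ℂ :=
  Matrix.fromBlocks A 0 0 (Matrix.of fun _ _ => -A.trace)

/-- The standard embedding of `u(n+1)` into `sp(n+1,ℝ)`: the matrix of the real linear map
`z ↦ A z` of `ℂ^{n+1} = ℝ^{n+1} ⊕ i ℝ^{n+1}`. -/
def toSp {n : ℕ} (A : Matrix (Fin (n + 1)) (Fin (n + 1)) ℂ) :
    Matrix (Fin (n + 1) ⊕ Fin (n + 1)) (Fin (n + 1) ⊕ Fin (n + 1)) ℝ :=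
  Matrix.fromBlocks (A.map Complex.re) (-(A.map Complex.im)) (A.map Complex.im)
    (A.map Complex.re)

/-- The linear vector fields `z ↦ A z` and `z ↦ B z` on the real vector space `ℂ^{n+1}` are
conjugate by a real linear automorphism. -/
def RealConj {n : ℕ} (A B : Matrix (Fin (n + 1)) (Fin (n + 1)) ℂ) : Prop :=
  ∃ L : (Fin (n + 1) → ℂ) ≃ₗ[ℝ] (Fin (n + 1) → ℂ), ∀ z, L (A *ᵥ z) = B *ᵥ L z

/-! ### Local conjugacy of the two actions -/

open scoped Matrix.Norms.Frobenius in
/-- The actions of the one-parameter groups generated by `a₁` and `a₂` on the projectivized root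
cones are locally conjugate: there is a local diffeomorphism of the first cone to the second one
which intertwines them. -/
def LocallyConjugate {n : ℕ} (a₁ : Matrix (Fin (n + 1) ⊕ Unit) (Fin (n + 1) ⊕ Unit) ℂ)
    (a₂ : Matrix (Fin (n + 1) ⊕ Fin (n + 1)) (Fin (n + 1) ⊕ Fin (n + 1)) ℝ) : Prop :=
  ∃ f : Matrix (Fin (n + 1) ⊕ Unit) (Fin (n + 1) ⊕ Unit) ℂ →
      Matrix (Fin (n + 1) ⊕ Fin (n + 1)) (Fin (n + 1) ⊕ Fin (n + 1)) ℝ,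
    IsLocalDiffeoOn f (suCone n) (spCone n) ∧
      ∀ t : ℝ, ∀ X ∈ suCone n, f (rayFlow a₁ t X) = rayFlow a₂ t (f X)

end RootCone

end

open scoped Matrix ContDiff

noncomputable section

namespace RootCone

/-! ### Local diffeomorphisms between subsets of normed spaces -/

section LocalDiffeo

variable {E F W : Type*} [NormedAddCommGroup E] [NormedSpace ℝ E]
  [NormedAddCommGroup F] [NormedSpace ℝ F] [NormedAddCommGroup W] [NormedSpace ℝ W]

/-! Both cones are modelled on the sphere `S^{2n+1}`. Null vectors `z` of the Hermitian form give
the elements `rankOneElt z`, which depend on `z` only up to phase, so `suPoint` identifies the first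
cone with the sphere of null lines. Vectors `v` of `ℝ^{2n+2}` give the elements `spElt v`, which
depend on `v` up to sign, so `spPoint` is a double cover of the second cone. The adjoint flows
become the projective flow of `exp (t a₁)` on null lines (`suFlow`) and, upstairs, the linear flow
of `exp (t a₂)` on rays (`spFlow`).

If `a₁ = ι₁(A)`, its flow on the sphere is the linear flow of `A + tr A`. A real linear conjugacy to
`B`, normalised to unit length and followed by `spPoint`, is the required local diffeomorphism
(`locallyConjugate_of_realConj`).

Conversely, a local diffeomorphism from the compact sphere to the second cone is a covering, and so
is `spPoint`. As the sphere is simply connected, the two coverings are isomorphic: there is an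
equivariant homeomorphism `F` of spheres, differentiable in both directions after homogeneous
extension (`LocallyConjugate.exists_homeomorph`). It is exploited three times.

Ellipticity of `a₁` (`LocallyConjugate.exists_adConj_toSU`): the flow of `a₂` commutes with `-1`, so
the flow of `a₁` commutes with a fixed point free involution. A negative eigenvector of `a₁` gives
the claim at once. Otherwise there is a null eigenvector, a fixed point on the sphere, and the
involution produces a second one. Real parts of the eigenvalues would cause north-south dynamics,
which no such involution respects; without them the two null eigenvectors share an eigenvalue and
span a negative eigenvector.

Ellipticity of `a₂` (`exists_bound_exp`, `exists_adConj_toSp_diagI`): the flow of `a₁` is now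
isometric, so by compactness that of `a₂` is equicontinuous on the sphere of rays. For symplectic
matrices this bounds `exp (t a₂)`, whence `a₂` is semisimple with imaginary spectrum and has a
unitary symplectic normal form.

Equality of the frequencies (`LocallyConjugate.realConj_diagI`): `F` matches the fixed points at
each time `t`, which are unit spheres of linear subspaces, and a derivative of `F` compares their
dimensions. These dimensions determine the frequencies up to order and sign, hence the real linear
conjugacy class. -/

theorem IsLocalDiffeoOn.contDiffOn {f : E → F} {S : Set E} {T : Set F}
    (hf : IsLocalDiffeoOn f S T) : ContDiffOn ℝ ∞ f S := by
  intro x hx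
  obtain ⟨U, V, g, hU, -, hxU, -, -, -, h, -⟩ := hf.2 x hx
  exact (contDiffWithinAt_inter (hU.mem_nhds hxU)).1 (h x ⟨hx, hxU⟩)

theorem IsLocalDiffeoOn.of_inverse {f : E → F} {g : F → E} {S : Set E} {T : Set F}
    (hfm : Set.MapsTo f S T) (hgm : Set.MapsTo g T S) (h : Set.InvOn g f S T)
    (hf : ContDiffOn ℝ ∞ f S) (hg : ContDiffOn ℝ ∞ g T) : IsLocalDiffeoOn f S T :=
  ⟨hfm, fun x _ => ⟨Set.univ, Set.univ, g, isOpen_univ, isOpen_univ, trivial, by simpa using hfm,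
    by simpa using hgm, by simpa using h, by simpa using hf, by simpa using hg⟩⟩

theorem IsLocalDiffeoOn.comp {f : E → F} {g : F → W} {S : Set E} {T : Set F} {R : Set W}
    (hg : IsLocalDiffeoOn g T R) (hf : IsLocalDiffeoOn f S T) : IsLocalDiffeoOn (g ∘ f) S R := by
  refine ⟨hg.1.comp hf.1, fun x hx => ?_⟩
  obtain ⟨U, V, f', hU, hV, hxU, hfm, hfm', hfi, hfs, hfs'⟩ := hf.2 x hx
  obtain ⟨U₂, V₂, g', hU₂, hV₂, hxU₂, hgm, hgm', hgi, hgs, hgs'⟩ := hg.2 (f x) (hf.1 hx)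
  -- The preimages of `U₂` and `V` are open only relative to `S ∩ U` and `R ∩ V₂`; `O` and `O'` are
  -- open sets of the ambient spaces with the same traces.
  obtain ⟨O, hO, hOeq⟩ := continuousOn_iff'.1 hfs.continuousOn U₂ hU₂
  obtain ⟨O', hO', hOeq'⟩ := continuousOn_iff'.1 hgs'.continuousOn V hV
  have key : ∀ y ∈ S, y ∈ U → (y ∈ O ↔ f y ∈ U₂) := fun y hy hyU => by
    have := Set.ext_iff.1 hOeq y
    simp [hy, hyU] at this
    exact this.symm
  have key' : ∀ y ∈ R, y ∈ V₂ → (y ∈ O' ↔ g' y ∈ V) := fun y hy hyU => by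
    have := Set.ext_iff.1 hOeq' y
    simp [hy, hyU] at this
    exact this.symm
  have m1 : Set.MapsTo f (S ∩ (U ∩ O)) (T ∩ (V ∩ U₂)) := by
    rintro y ⟨hy, hyU, hyO⟩
    exact ⟨hf.1 hy, (hfm ⟨hy, hyU⟩).2, (key y hy hyU).1 hyO⟩
  have m2 : Set.MapsTo g (T ∩ (V ∩ U₂)) (R ∩ (V₂ ∩ O')) := by
    rintro y ⟨hy, hyV, hyU⟩
    have h1 := hgm ⟨hy, hyU⟩
    refine ⟨h1.1, h1.2, (key' _ h1.1 h1.2).2 ?_⟩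
    rw [hgi.1 ⟨hy, hyU⟩]; exact hyV
  have m3 : Set.MapsTo g' (R ∩ (V₂ ∩ O')) (T ∩ (V ∩ U₂)) := by
    rintro y ⟨hy, hyV, hyO⟩
    have h1 := hgm' ⟨hy, hyV⟩
    exact ⟨h1.1, (key' _ hy hyV).1 hyO, h1.2⟩
  have m4 : Set.MapsTo f' (T ∩ (V ∩ U₂)) (S ∩ (U ∩ O)) := by
    rintro y ⟨hy, hyV, hyU⟩
    have h1 := hfm' ⟨hy, hyV⟩
    refine ⟨h1.1, h1.2, (key _ h1.1 h1.2).2 ?_⟩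
    rw [hfi.2 ⟨hy, hyV⟩]; exact hyU
  refine ⟨U ∩ O, V₂ ∩ O', f' ∘ g', hU.inter hO, hV₂.inter hO',
    ⟨hxU, (key x hx hxU).2 hxU₂⟩, m2.comp m1, m4.comp m3, ⟨?_, ?_⟩, ?_, ?_⟩
  · intro y hy
    have := m1 hy
    simp only [Function.comp]
    rw [hgi.1 ⟨this.1, this.2.2⟩, hfi.1 ⟨hy.1, hy.2.1⟩]
  · intro y hy
    have := m3 hy
    simp only [Function.comp]
    rw [hfi.2 ⟨this.1, this.2.1⟩, hgi.2 ⟨hy.1, hy.2.1⟩]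
  · exact (hgs.mono fun y hy => ⟨hy.1, hy.2.2⟩).comp (hfs.mono fun y hy => ⟨hy.1, hy.2.1⟩) m1
  · exact (hfs'.mono fun y hy => ⟨hy.1, hy.2.1⟩).comp (hgs'.mono fun y hy => ⟨hy.1, hy.2.1⟩) m3

/-- Passes to the subtypes `S` and `T`, where covering space theory applies. -/
theorem IsLocalDiffeoOn.isLocalHomeomorph {f : E → F} {S : Set E} {T : Set F}
    (hf : IsLocalDiffeoOn f S T) : IsLocalHomeomorph (hf.1.restrict f S T) := by
  classical
  refine IsLocalHomeomorph.mk _ fun x => ?_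
  obtain ⟨U, V, g, hU, hV, hxU, hfm, hgm, hi, hs, hs'⟩ := hf.2 x x.2
  have hsub : ∀ y : T, (y : F) ∈ V → g y ∈ S := fun y hy => (hgm ⟨y.2, hy⟩).1
  refine ⟨{ toFun := hf.1.restrict f S T
            -- The value `x` off `V` is arbitrary; it only has to be a point of `S`.
            invFun := fun y => if h : (y : F) ∈ V then ⟨g y, hsub y h⟩ else x
            source := {y | (y : E) ∈ U}
            target := {y | (y : F) ∈ V}
            map_source' := fun y hy => (hfm ⟨y.2, hy⟩).2
            map_target' := fun y (hy : (y : F) ∈ V) => by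
              simpa [hy] using (hgm ⟨y.2, hy⟩).2
            left_inv' := fun y hy => by
              have h1 : f y ∈ V := (hfm ⟨y.2, hy⟩).2
              ext
              simpa [h1] using hi.1 ⟨y.2, hy⟩
            right_inv' := fun y (hy : (y : F) ∈ V) => by
              ext
              simpa [hy] using hi.2 ⟨y.2, hy⟩
            open_source := hU.preimage continuous_subtype_val
            open_target := hV.preimage continuous_subtype_val
            continuousOn_toFun := ?_
            continuousOn_invFun := ?_ }, hxU, fun y _ => rfl⟩
  · exact (hf.contDiffOn.continuousOn.mapsToRestrict hf.1).continuousOn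
  · rw [Topology.IsInducing.subtypeVal.continuousOn_iff]
    have : ContinuousOn (fun y : T => g y) {y : T | (y : F) ∈ V} :=
      hs'.continuousOn.comp continuous_subtype_val.continuousOn fun y hy => ⟨y.2, hy⟩
    refine this.congr fun y (hy : (y : F) ∈ V) => ?_
    simp [hy]

end LocalDiffeo

/-! ### Lifting maps from spheres of dimension at least two through coverings -/

section SphereLift
open Metric Module

variable {E : Type*} [NormedAddCommGroup E] [InnerProductSpace ℝ E]

open scoped InnerProductSpace in
theorem exists_unit_orthogonal [FiniteDimensional ℝ E] (hE : 2 ≤ finrank ℝ E) (x : E) :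
    ∃ v : E, ‖v‖ = 1 ∧ ⟪v, x⟫_ℝ = 0 := by
  have h : (ℝ ∙ x)ᗮ ≠ ⊥ := by
    intro h
    have h1 := Submodule.finrank_add_finrank_orthogonal (ℝ ∙ x)
    rw [h, finrank_bot] at h1
    have h2 := finrank_span_le_card (R := ℝ) ({x} : Set E)
    simp only [Set.toFinset_singleton, Finset.card_singleton] at h2
    omega
  obtain ⟨w, hw, hw0⟩ := Submodule.exists_mem_ne_zero_of_ne_bot h
  refine ⟨(‖w‖⁻¹ : ℝ) • w, by simp [norm_smul, hw0], ?_⟩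
  rw [Submodule.mem_orthogonal_singleton_iff_inner_left] at hw
  simp [inner_smul_left, hw]

/-- Stereographic projection from `v` sends `-v` to the origin, so the set is the image of a
punctured vector space of dimension at least two. -/
theorem isPreconnected_sphere_compl_pair [FiniteDimensional ℝ E] (hE : 3 ≤ finrank ℝ E)
    {v : E} (hv : ‖v‖ = 1) :
    IsPreconnected {x : sphere (0 : E) 1 | (x : E) ≠ v ∧ (x : E) ≠ -v} := by
  have hr : 1 < Module.rank ℝ (ℝ ∙ v)ᗮ := by
    rw [← Module.finrank_eq_rank]
    have h1 := Submodule.finrank_add_finrank_orthogonal (ℝ ∙ v)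
    have h2 := finrank_span_le_card (R := ℝ) ({v} : Set E)
    simp only [Set.toFinset_singleton, Finset.card_singleton] at h2
    exact_mod_cast (by omega : 1 < finrank ℝ (ℝ ∙ v)ᗮ)
  have hc := (isConnected_compl_singleton_of_one_lt_rank hr 0).isPreconnected
  have h0 : (stereoInvFun hv 0 : E) = -v := by
    rw [stereoInvFun_apply]; simp
  convert! hc.image (stereoInvFun hv) (continuous_stereoInvFun hv).continuousOn using 1
  ext x
  constructor
  · rintro ⟨h1, h2⟩
    refine ⟨stereoToFun v x, ?_, stereo_left_inv hv h1⟩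
    intro h3
    apply h2
    rw [← stereo_left_inv hv h1, show stereoToFun v (x : E) = 0 from h3, h0]
  · rintro ⟨w, hw, rfl⟩
    refine ⟨fun h => stereoInvFun_ne_north_pole hv w (Subtype.ext h), fun h => hw ?_⟩
    have h2 : stereoInvFun hv w = stereoInvFun hv 0 := Subtype.ext (h.trans h0.symm)
    rw [Set.mem_singleton_iff, ← stereo_right_inv hv w, h2, stereo_right_inv]

/-- The complement of a pole is homeomorphic to a vector space, so lifts exist on the two
stereographic charts from `v` and `-v`. The overlap of the charts is connected, so lifts with the
same value at `x₀` agree there and glue. -/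
theorem exists_lift_sphere [FiniteDimensional ℝ E] (hE : 3 ≤ finrank ℝ E)
    {Y X : Type*} [TopologicalSpace Y] [TopologicalSpace X] {p : Y → X} (hp : IsCoveringMap p)
    (f : C(sphere (0 : E) 1, X)) (x₀ : sphere (0 : E) 1) (y₀ : Y) (h₀ : p y₀ = f x₀) :
    ∃ F : C(sphere (0 : E) 1, Y), F x₀ = y₀ ∧ ∀ x, p (F x) = f x := by
  classical
  -- A pole orthogonal to `x₀` puts `x₀` in both charts.
  obtain ⟨v, hv, hvx⟩ := exists_unit_orthogonal (by omega) (x₀ : E)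
  have hxn : ‖(x₀ : E)‖ = 1 := by simp
  have hx1 : (x₀ : E) ≠ v := by
    rintro h; rw [h, real_inner_self_eq_norm_sq, hv] at hvx; norm_num at hvx
  have hx2 : (x₀ : E) ≠ -v := by
    rintro h; rw [h, inner_neg_right, real_inner_self_eq_norm_sq, hv] at hvx; norm_num at hvx
  have hv' : ‖-v‖ = 1 := by simpa using hv
  have lift : ∀ (w : E) (hw : ‖w‖ = 1), (x₀ : E) ≠ w → ∃ G : C((ℝ ∙ w)ᗮ, Y),
      G (stereoToFun w x₀) = y₀ ∧ ∀ z, p (G z) = f (stereoInvFun hw z) := by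
    intro w hw hx
    obtain ⟨G, ⟨hG, hG'⟩, -⟩ := hp.existsUnique_continuousMap_lifts
      (f.comp ⟨stereoInvFun hw, continuous_stereoInvFun hw⟩) (stereoToFun w x₀) y₀ (by
        simp only [ContinuousMap.comp_apply, ContinuousMap.coe_mk]
        rw [stereo_left_inv hw hx, h₀])
    exact ⟨G, hG, fun z => congrFun hG' z⟩
  obtain ⟨G, hG, hGp⟩ := lift v hv hx1
  obtain ⟨H, hH, hHp⟩ := lift (-v) hv' hx2
  have cont : ∀ (w : E), ‖w‖ = 1 → ∀ K : C((ℝ ∙ w)ᗮ, Y),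
      ContinuousOn (fun x : sphere (0 : E) 1 => K (stereoToFun w x)) {x | (x : E) ≠ w} := by
    intro w hw K
    refine K.continuous.comp_continuousOn
      (continuousOn_stereoToFun.comp continuous_subtype_val.continuousOn ?_)
    intro x hx h
    have hxx : ‖(x : E)‖ = 1 := by simp
    exact hx ((inner_eq_one_iff_of_norm_eq_one hw hxx).1 h).symm
  have hpG : ∀ x : sphere (0 : E) 1, (x : E) ≠ v → p (G (stereoToFun v x)) = f x := by
    intro x hx; rw [hGp, stereo_left_inv hv hx]
  have hpH : ∀ x : sphere (0 : E) 1, (x : E) ≠ -v → p (H (stereoToFun (-v) x)) = f x := by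
    intro x hx; rw [hHp, stereo_left_inv hv' hx]
  have hGH : Set.EqOn (fun x : sphere (0 : E) 1 => G (stereoToFun v x))
      (fun x : sphere (0 : E) 1 => H (stereoToFun (-v) x)) {x | (x : E) ≠ v ∧ (x : E) ≠ -v} := by
    refine hp.eqOn_of_comp_eqOn (isPreconnected_sphere_compl_pair hE hv)
      ((cont v hv G).mono fun x hx => hx.1) ((cont (-v) hv' H).mono fun x hx => hx.2) ?_
      (a := x₀) ⟨hx1, hx2⟩ (hG.trans hH.symm)
    intro x hx
    simp only [Function.comp]
    rw [hpG x hx.1, hpH x hx.2]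
  let F : sphere (0 : E) 1 → Y := fun x =>
    if (x : E) = v then H (stereoToFun (-v) x) else G (stereoToFun v x)
  have hop : ∀ w : E, IsOpen {x : sphere (0 : E) 1 | (x : E) ≠ w} := fun w =>
    isOpen_ne.preimage continuous_subtype_val
  have hvv : v ≠ -v := by
    intro h
    have h2 := congrArg (fun z => inner ℝ v z) h
    simp only [inner_neg_right, real_inner_self_eq_norm_sq, hv] at h2
    norm_num at h2
  have hF : Continuous F := by
    rw [continuous_iff_continuousAt]
    intro x
    by_cases hx : (x : E) = v
    · have h2 : (x : E) ≠ -v := hx ▸ hvv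
      refine ((cont (-v) hv' H).congr ?_).continuousAt ((hop (-v)).mem_nhds h2)
      intro y hy
      by_cases h3 : (y : E) = v
      · simp [F, h3]
      · simp only [F, h3, if_false]; exact hGH ⟨h3, hy⟩
    · refine ((cont v hv G).congr ?_).continuousAt ((hop v).mem_nhds hx)
      intro y (hy : (y : E) ≠ v)
      simp [F, hy]
  refine ⟨⟨F, hF⟩, ?_, fun x => ?_⟩
  · simp only [ContinuousMap.coe_mk, F, hx1, if_false, hG]
  · by_cases hx : (x : E) = v
    · simp only [ContinuousMap.coe_mk, F, hx, if_true]
      simpa [hx] using hpH x (hx ▸ hvv)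
    · simp only [ContinuousMap.coe_mk, F, hx, if_false]
      exact hpG x hx

instance preconnectedSpace_sphere' [FiniteDimensional ℝ E] [Fact (3 ≤ finrank ℝ E)] :
    PreconnectedSpace (sphere (0 : E) 1) := by
  refine isPreconnected_iff_preconnectedSpace.1 (isPreconnected_sphere ?_ 0 1)
  rw [← Module.finrank_eq_rank]
  have : 3 ≤ finrank ℝ E := Fact.out
  exact_mod_cast (by omega : 1 < finrank ℝ E)

variable {E' : Type*} [NormedAddCommGroup E'] [InnerProductSpace ℝ E']

/-- Two coverings of the same space by spheres of dimension at least two are isomorphic. -/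
theorem exists_homeomorph_of_covering [FiniteDimensional ℝ E] [FiniteDimensional ℝ E']
    (hE : 3 ≤ finrank ℝ E) (hE' : 3 ≤ finrank ℝ E') {X : Type*} [TopologicalSpace X]
    {p : sphere (0 : E) 1 → X} {q : sphere (0 : E') 1 → X} (hp : IsCoveringMap p)
    (hq : IsCoveringMap q) (x₀ : sphere (0 : E) 1) (y₀ : sphere (0 : E') 1) (h₀ : p x₀ = q y₀) :
    ∃ F : sphere (0 : E) 1 ≃ₜ sphere (0 : E') 1, ∀ x, q (F x) = p x := by
  have : Fact (3 ≤ finrank ℝ E) := ⟨hE⟩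
  have : Fact (3 ≤ finrank ℝ E') := ⟨hE'⟩
  obtain ⟨F, hF0, hF⟩ := exists_lift_sphere hE hq ⟨p, hp.continuous⟩ x₀ y₀ h₀.symm
  obtain ⟨G, hG0, hG⟩ := exists_lift_sphere hE' hp ⟨q, hq.continuous⟩ y₀ x₀ h₀
  simp only [ContinuousMap.coe_mk] at hF hG
  refine ⟨⟨⟨F, G, fun x => ?_, fun y => ?_⟩, F.continuous, G.continuous⟩, hF⟩
  -- `G ∘ F` and the identity are lifts of `p` through itself which agree at `x₀`.
  · refine congrFun (hp.eq_of_comp_eq (g₁ := G ∘ F) (g₂ := id) (G.continuous.comp F.continuous)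
      continuous_id ?_ x₀ (by simp [hF0, hG0])) x
    ext x; simp [hF, hG]
  · refine congrFun (hq.eq_of_comp_eq (g₁ := F ∘ G) (g₂ := id) (F.continuous.comp G.continuous)
      continuous_id ?_ y₀ (by simp [hF0, hG0])) y
    ext x; simp [hF, hG]

end SphereLift

/-! ### Homogeneous extensions and differentiability of the lift -/

section Radial
open Metric Module Topology

variable {E E' W : Type*} [NormedAddCommGroup E] [InnerProductSpace ℝ E]
  [NormedAddCommGroup E'] [InnerProductSpace ℝ E'] [NormedAddCommGroup W] [NormedSpace ℝ W]

/-- The point of the unit sphere on the ray through a nonzero vector. -/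
def unitVec (x : E) (hx : x ≠ 0) : sphere (0 : E) 1 :=
  ⟨‖x‖⁻¹ • x, by simp [norm_smul, hx]⟩

open Classical in
/-- The extension of a map between unit spheres which is homogeneous of degree one. -/
def radialExt (F : sphere (0 : E) 1 → sphere (0 : E') 1) (x : E) : E' :=
  if h : x = 0 then 0 else ‖x‖ • (F (unitVec x h) : E')

theorem radialExt_of_ne (F : sphere (0 : E) 1 → sphere (0 : E') 1) {x : E} (h : x ≠ 0) :
    radialExt F x = ‖x‖ • (F (unitVec x h) : E') := by
  simp [radialExt, h]

theorem radialExt_ne_zero (F : sphere (0 : E) 1 → sphere (0 : E') 1) {x : E} (h : x ≠ 0) :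
    radialExt F x ≠ 0 := by
  rw [radialExt_of_ne F h]
  have h1 : (F (unitVec x h) : E') ≠ 0 := by
    intro h2
    have : ‖(F (unitVec x h) : E')‖ = 1 := by simp
    rw [h2] at this; simp at this
  simp [h, h1]

theorem norm_radialExt (F : sphere (0 : E) 1 → sphere (0 : E') 1) (x : E) :
    ‖radialExt F x‖ = ‖x‖ := by
  by_cases h : x = 0
  · simp [radialExt, h]
  · simp [radialExt_of_ne F h, norm_smul]

theorem unitVec_radialExt (F : sphere (0 : E) 1 → sphere (0 : E') 1) {x : E} (h : x ≠ 0) :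
    unitVec (radialExt F x) (radialExt_ne_zero F h) = F (unitVec x h) := by
  ext
  have : ‖x‖ ≠ 0 := norm_ne_zero_iff.2 h
  simp only [unitVec, norm_radialExt]
  rw [radialExt_of_ne F h, smul_smul, inv_mul_cancel₀ this, one_smul]
  rfl

theorem radialExt_symm_apply (F : sphere (0 : E) 1 ≃ₜ sphere (0 : E') 1) (x : E) :
    radialExt F.symm (radialExt F x) = x := by
  by_cases h : x = 0
  · simp [radialExt, h]
  · have : ‖x‖ ≠ 0 := norm_ne_zero_iff.2 h
    rw [radialExt_of_ne _ (radialExt_ne_zero F h), unitVec_radialExt F h, norm_radialExt]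
    simp [unitVec, smul_smul, this]

/-- Locally `F` is a smooth inverse of `q` composed with `p`. The homogeneous extension turns this
into differentiability on the open set of nonzero vectors, so that ordinary derivatives can be used.
-/
theorem differentiableAt_radialExt {F : sphere (0 : E) 1 → sphere (0 : E') 1} (hF : Continuous F)
    {p : E → W} {q : E' → W} {T : Set W} (hp : ContDiffOn ℝ ∞ p (sphere 0 1))
    (hq : IsLocalDiffeoOn q (sphere 0 1) T) (hpq : ∀ x, q (F x) = p x) {x : E} (hx : x ≠ 0) :
    DifferentiableAt ℝ (radialExt F) x := by
  obtain ⟨U, V, g, hU, hV, hxU, hqm, hgm, hi, hqs, hgs⟩ := hq.2 _ (F (unitVec x hx)).2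
  let n : E → E := fun y => ‖y‖⁻¹ • y
  have hn : DifferentiableAt ℝ n x :=
    ((differentiableAt_id.norm ℝ hx).inv (norm_ne_zero_iff.2 hx)).smul differentiableAt_id
  have hns : ∀ y, y ≠ 0 → n y ∈ sphere (0 : E) 1 := fun y hy => (unitVec y hy).2
  let s : Set E := {y | ∃ h : y ≠ 0, (F (unitVec y h) : E') ∈ U}
  have hs : s ∈ 𝓝 x := by
    have h1 : IsOpen {y : sphere (0 : E) 1 | (F y : E') ∈ U} :=
      hU.preimage (continuous_subtype_val.comp hF)
    obtain ⟨O, hO, hOeq⟩ := isOpen_induced_iff.1 h1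
    have h2 : n x ∈ O := by
      have : unitVec x hx ∈ ((↑) : sphere (0 : E) 1 → E) ⁻¹' O := by rw [hOeq]; exact hxU
      exact this
    filter_upwards [hn.continuousAt (hO.mem_nhds h2), isOpen_ne.mem_nhds hx] with y hy hy0
    refine ⟨hy0, ?_⟩
    have : unitVec y hy0 ∈ ((↑) : sphere (0 : E) 1 → E) ⁻¹' O := hy
    rw [hOeq] at this; exact this
  have heq : ∀ y ∈ s, radialExt F y = ‖y‖ • g (p (n y)) := by
    rintro y ⟨hy, hyU⟩
    rw [radialExt_of_ne F hy]
    congr 1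
    have := hi.1 ⟨(F (unitVec y hy)).2, hyU⟩
    rw [hpq] at this
    exact this.symm
  -- The intersection with `n '' s` is needed because `p` is known to land in `V` only where `F`
  -- lands in `U`.
  have hsm : Set.MapsTo n s (sphere 0 1 ∩ n '' s) := fun y hy => ⟨hns y hy.1, y, hy, rfl⟩
  have hpm : Set.MapsTo p (sphere 0 1 ∩ n '' s) (T ∩ V) := by
    rintro _ ⟨-, y, ⟨hy, hyU⟩, rfl⟩
    have := hqm ⟨(F (unitVec y hy)).2, hyU⟩
    rw [hpq] at this
    exact this
  have hxs : x ∈ s := mem_of_mem_nhds hs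
  have h1 : DifferentiableWithinAt ℝ g (T ∩ V) (p (n x)) :=
    hgs.differentiableOn (by simp) _ (hpm (hsm hxs))
  have h2 : DifferentiableWithinAt ℝ p (sphere 0 1 ∩ n '' s) (n x) :=
    (hp.differentiableOn (by simp) _ (hns x hx)).mono Set.inter_subset_left
  have h3 : DifferentiableWithinAt ℝ (fun y => g (p (n y))) s x :=
    (h1.comp (n x) h2 hpm).comp x hn.differentiableWithinAt hsm
  have h4 : DifferentiableWithinAt ℝ (fun y => ‖y‖ • g (p (n y))) s x :=
    (differentiableAt_id.norm ℝ hx).differentiableWithinAt.smul h3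
  exact (h4.congr heq (heq x hxs)).differentiableAt hs

/-- A local homeomorphism from a compact space to a Hausdorff space is a covering map, so `p` and
`q` are two coverings of `T` by spheres. Differentiability of the inverse follows by exchanging
their roles. -/
theorem exists_homeomorph_of_localDiffeo [FiniteDimensional ℝ E] [FiniteDimensional ℝ E']
    (hE : 3 ≤ finrank ℝ E) (hE' : 3 ≤ finrank ℝ E') {p : E → W} {q : E' → W} {T : Set W}
    (hp : IsLocalDiffeoOn p (sphere 0 1) T) (hq : IsLocalDiffeoOn q (sphere 0 1) T)
    (hqT : Set.SurjOn q (sphere 0 1) T) :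
    ∃ F : sphere (0 : E) 1 ≃ₜ sphere (0 : E') 1, (∀ x, q (F x) = p x) ∧
      (∀ x ≠ 0, DifferentiableAt ℝ (radialExt F) x) ∧
      (∀ x ≠ 0, DifferentiableAt ℝ (radialExt F.symm) x) := by
  have hp' := isLocalHomeomorph_iff_isCoveringMap.1 hp.isLocalHomeomorph
  have hq' := isLocalHomeomorph_iff_isCoveringMap.1 hq.isLocalHomeomorph
  obtain ⟨v, hv, -⟩ := exists_unit_orthogonal (by omega) (0 : E)
  have hv' : v ∈ sphere (0 : E) 1 := by simp [hv]
  obtain ⟨y, hy, hyv⟩ := hqT (hp.1 hv')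
  obtain ⟨F, hF⟩ := exists_homeomorph_of_covering hE hE' hp' hq' ⟨v, hv'⟩ ⟨y, hy⟩
    (Subtype.ext hyv.symm)
  have hF' : ∀ x, q (F x) = p x := fun x => congrArg Subtype.val (hF x)
  refine ⟨F, hF', fun x hx => differentiableAt_radialExt F.continuous hp.contDiffOn hq hF' hx,
    fun x hx => differentiableAt_radialExt F.symm.continuous hq.contDiffOn hp (fun y => ?_) hx⟩
  rw [← hF']; simp

/-- Two curves with the same image under a local diffeomorphism of the sphere which agree at time
zero agree. -/
theorem IsLocalDiffeoOn.curve_eq {q : E' → W} [FiniteDimensional ℝ E'] {T : Set W}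
    (hq : IsLocalDiffeoOn q (sphere 0 1) T) {c₁ c₂ : ℝ → sphere (0 : E') 1} (h₁ : Continuous c₁)
    (h₂ : Continuous c₂) (h : ∀ t, q (c₁ t) = q (c₂ t)) (h0 : c₁ 0 = c₂ 0) (t : ℝ) :
    c₁ t = c₂ t := by
  have hq' := isLocalHomeomorph_iff_isCoveringMap.1 hq.isLocalHomeomorph
  exact congrFun (hq'.eq_of_comp_eq h₁ h₂ (by ext t; exact h t) 0 h0) t

/-- The kernel of a continuous linear map is preserved, with its dimension, by a homeomorphism of
spheres which maps its unit vectors to those of another kernel. -/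
theorem finrank_le_of_radialExt [FiniteDimensional ℝ E] [FiniteDimensional ℝ E']
    (F : sphere (0 : E) 1 ≃ₜ sphere (0 : E') 1)
    (hF : ∀ x ≠ 0, DifferentiableAt ℝ (radialExt F) x)
    (hF' : ∀ x ≠ 0, DifferentiableAt ℝ (radialExt F.symm) x)
    (K : Submodule ℝ E) (K' : Submodule ℝ E')
    (hK : ∀ x : sphere (0 : E) 1, (x : E) ∈ K → (F x : E') ∈ K') :
    finrank ℝ K ≤ finrank ℝ K' := by
  by_cases hbot : K = ⊥
  · rw [hbot, finrank_bot]; exact Nat.zero_le _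
  obtain ⟨x, hx, hx0⟩ := Submodule.exists_mem_ne_zero_of_ne_bot hbot
  have hmap : ∀ y ∈ K, radialExt F y ∈ K' := by
    intro y hy
    by_cases h : y = 0
    · simp [radialExt, h]
    · rw [radialExt_of_ne F h]
      exact K'.smul_mem _ (hK _ (K.smul_mem _ hy))
  -- The derivative at a single nonzero point of `K` suffices: it is injective, the extension of
  -- `F.symm` being inverse to that of `F`, and it maps `K` into `K'`.
  set D := fderiv ℝ (radialExt F) x with hD
  have hDx : HasFDerivAt (radialExt F) D x := (hF x hx0).hasFDerivAt
  have hDy := (hF' _ (radialExt_ne_zero F hx0)).hasFDerivAt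
  have hid : (fderiv ℝ (radialExt F.symm) (radialExt F x)).comp D = ContinuousLinearMap.id ℝ E := by
    have h1 := hDy.comp x hDx
    have h2 : (radialExt F.symm) ∘ (radialExt F) = id := by
      ext y; exact radialExt_symm_apply F y
    rw [h2] at h1
    exact h1.unique (hasFDerivAt_id x)
  have hinj : Function.Injective D := by
    intro y z hyz
    have h1 := congrArg (fun L => L y) hid
    have h2 := congrArg (fun L => L z) hid
    simp only [ContinuousLinearMap.comp_apply, ContinuousLinearMap.id_apply] at h1 h2
    rw [← h1, ← h2, hyz]
  have hDK : ∀ y ∈ K, D y ∈ K' := by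
    intro y hy
    have h1 : HasDerivAt (fun t : ℝ => x + t • y) y 0 := by
      simpa using ((hasDerivAt_id (0 : ℝ)).smul_const y).const_add x
    have h2 : HasDerivAt (fun t : ℝ => radialExt F (x + t • y)) (D y) 0 := by
      have h3 : HasFDerivAt (radialExt F) D (x + (0 : ℝ) • y) := by simpa using hDx
      exact h3.comp_hasDerivAt (0 : ℝ) h1
    -- The difference quotients in directions of `K` lie in `K'`, which is closed, so their limit
    -- does too.
    have hcl : IsClosed (K' : Set E') := K'.closed_of_finiteDimensional
    have h3 := hasDerivAt_iff_tendsto_slope_zero.1 h2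
    refine hcl.mem_of_tendsto h3 (Filter.Eventually.of_forall fun t => ?_)
    refine K'.smul_mem _ (K'.sub_mem (hmap _ ?_) (hmap _ ?_)) <;>
      exact K.add_mem hx (K.smul_mem _ hy)
  exact LinearMap.finrank_le_finrank_of_injective
    (f := (D : E →ₗ[ℝ] E').restrict hDK) fun y z h => by
      have := congrArg Subtype.val h
      exact Subtype.ext (hinj this)

end Radial

/-! ### Matrix exponentials acting on vectors, and normalisation of rays -/

section Exp
open scoped Matrix.Norms.Frobenius

variable {ι κ 𝕜 𝕜' : Type*} [Fintype ι] [DecidableEq ι] [Fintype κ] [DecidableEq κ]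
  [RCLike 𝕜] [RCLike 𝕜']

theorem hasDerivAt_exp_smul_mulVec (a : Matrix ι ι 𝕜) {w : ℝ → ι → 𝕜} {w' : ι → 𝕜} {t : ℝ}
    (hw : HasDerivAt w w' t) :
    HasDerivAt (fun s : ℝ => NormedSpace.exp (s • a) *ᵥ w s)
      (NormedSpace.exp (t • a) *ᵥ (a *ᵥ w t + w')) t := by
  have h1 : HasDerivAt (fun s : ℝ => NormedSpace.exp (s • a)) (NormedSpace.exp (t • a) * a) t :=
    hasDerivAt_exp_smul_const a t
  rw [hasDerivAt_pi]
  intro i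
  have h2 : ∀ j, HasDerivAt (fun s : ℝ => NormedSpace.exp (s • a) i j)
      ((NormedSpace.exp (t • a) * a) i j) t := fun j =>
    ((Matrix.entryLinearMap ℝ 𝕜 i j).toContinuousLinearMap).hasFDerivAt.comp_hasDerivAt t h1
  have h3 : HasDerivAt (fun s : ℝ => ∑ j, NormedSpace.exp (s • a) i j * w s j)
      (∑ j, ((NormedSpace.exp (t • a) * a) i j * w t j + NormedSpace.exp (t • a) i j * w' j)) t :=
    HasDerivAt.fun_sum fun j _ => (h2 j).mul (hasDerivAt_pi.1 hw j)
  rw [Matrix.mulVec_add, Matrix.mulVec_mulVec, Pi.add_apply]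
  simp only [Matrix.mulVec, dotProduct]
  rw [← Finset.sum_add_distrib]
  exact h3

theorem exp_smul_mul_exp_neg_smul (a : Matrix ι ι 𝕜) (t : ℝ) :
    NormedSpace.exp (t • a) * NormedSpace.exp (-(t • a)) = 1 := by
  have h : IsUnit (NormedSpace.exp (t • a)) := Matrix.isUnit_exp (t • a)
  rw [Matrix.exp_neg]
  exact Matrix.mul_nonsing_inv _ ((Matrix.isUnit_iff_isUnit_det _).1 h)

/-- A solution of `w' = a w` is given by the exponential. -/
theorem exp_mulVec_eq_of_hasDerivAt (a : Matrix ι ι 𝕜) {w : ℝ → ι → 𝕜}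
    (hw : ∀ t, HasDerivAt w (a *ᵥ w t) t) (t : ℝ) : NormedSpace.exp (t • a) *ᵥ w 0 = w t := by
  -- Uniqueness of solutions: `exp (-s a) w(s)` is constant.
  have h1 : ∀ t, HasDerivAt (fun s : ℝ => NormedSpace.exp (s • (-a)) *ᵥ w s) 0 t := by
    intro t
    convert hasDerivAt_exp_smul_mulVec (-a) (hw t) using 1
    rw [Matrix.neg_mulVec, neg_add_cancel, Matrix.mulVec_zero]
  have h2 := is_const_of_deriv_eq_zero (fun t => (h1 t).differentiableAt) (fun t => (h1 t).deriv)
    t 0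
  simp only [smul_neg, zero_smul, neg_zero, NormedSpace.exp_zero, Matrix.one_mulVec] at h2
  rw [← h2, Matrix.mulVec_mulVec, exp_smul_mul_exp_neg_smul, Matrix.one_mulVec]

theorem hasDerivAt_exp_mulVec (a : Matrix ι ι 𝕜) (v : ι → 𝕜) (t : ℝ) :
    HasDerivAt (fun s : ℝ => NormedSpace.exp (s • a) *ᵥ v)
      (a *ᵥ (NormedSpace.exp (t • a) *ᵥ v)) t := by
  convert hasDerivAt_exp_smul_mulVec a (hasDerivAt_const t v) using 1
  have h : Commute a (NormedSpace.exp (t • a)) :=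
    ((Commute.refl a).smul_right t).exp_right
  rw [add_zero, Matrix.mulVec_mulVec, Matrix.mulVec_mulVec, h.eq]

theorem continuous_exp_mulVec (a : Matrix ι ι 𝕜) (v : ι → 𝕜) :
    Continuous fun s : ℝ => NormedSpace.exp (s • a) *ᵥ v :=
  continuous_iff_continuousAt.2 fun t => (hasDerivAt_exp_mulVec a v t).continuousAt

/-- Both sides solve the same linear equation. Only real linearity of `T` is required and the two
scalar fields may differ, so this covers complexification, real coordinates and real conjugacies
alike. -/
theorem exp_intertwine {a : Matrix ι ι 𝕜} {b : Matrix κ κ 𝕜'} (T : (ι → 𝕜) →ₗ[ℝ] (κ → 𝕜'))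
    (h : ∀ v, T (a *ᵥ v) = b *ᵥ T v) (t : ℝ) (v : ι → 𝕜) :
    T (NormedSpace.exp (t • a) *ᵥ v) = NormedSpace.exp (t • b) *ᵥ T v := by
  have h1 : ∀ t, HasDerivAt (fun s : ℝ => T (NormedSpace.exp (s • a) *ᵥ v))
      (b *ᵥ T (NormedSpace.exp (t • a) *ᵥ v)) t := fun t => by
    rw [← h]
    exact T.toContinuousLinearMap.hasFDerivAt.comp_hasDerivAt t (hasDerivAt_exp_mulVec a v t)
  have := exp_mulVec_eq_of_hasDerivAt b h1 t
  simp only [zero_smul, NormedSpace.exp_zero, Matrix.one_mulVec] at this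
  exact this.symm

theorem exp_mulVec_eigenvector {a : Matrix ι ι ℂ} {v : ι → ℂ} {c : ℂ} (h : a *ᵥ v = c • v)
    (t : ℝ) : NormedSpace.exp (t • a) *ᵥ v = Complex.exp (t * c) • v := by
  have h1 : ∀ t : ℝ, HasDerivAt (fun s : ℝ => Complex.exp (s * c) • v)
      (a *ᵥ (Complex.exp (t * c) • v)) t := fun t => by
    rw [Matrix.mulVec_smul, h, smul_smul]
    refine HasDerivAt.smul_const ?_ v
    have h2 : HasDerivAt (fun s : ℝ => (s : ℂ) * c) c t := by
      simpa using (Complex.ofRealCLM.hasDerivAt (x := t)).mul_const c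
    exact h2.cexp
  have := exp_mulVec_eq_of_hasDerivAt a h1 t
  simpa using this

/-- The exponential of an element of the Lie algebra of a sesquilinear form preserves the form. -/
theorem exp_preserves_form {a M : Matrix ι ι 𝕜} (h : aᴴ * M + M * a = 0) (t : ℝ) :
    (NormedSpace.exp (t • a))ᴴ * M * NormedSpace.exp (t • a) = M := by
  have key : ∀ v : ι → 𝕜, ((NormedSpace.exp (t • a))ᴴ * M * NormedSpace.exp (t • a)) *ᵥ v
      = M *ᵥ v := by
    intro v
    -- The curve `M exp (s a) v` solves `w' = -aᴴ w`, hence equals `exp (-s aᴴ) M v`.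
    have h1 : ∀ t, HasDerivAt (fun s : ℝ => M *ᵥ (NormedSpace.exp (s • a) *ᵥ v))
        ((-aᴴ) *ᵥ (M *ᵥ (NormedSpace.exp (t • a) *ᵥ v))) t := fun t => by
      have h2 : (-aᴴ) * M = M * a := by
        rw [neg_mul]; exact neg_eq_of_add_eq_zero_right h
      rw [Matrix.mulVec_mulVec, h2, ← Matrix.mulVec_mulVec]
      exact ((M.mulVecLin.restrictScalars ℝ).toContinuousLinearMap).hasFDerivAt.comp_hasDerivAt t
        (hasDerivAt_exp_mulVec a v t)
    have h3 := exp_mulVec_eq_of_hasDerivAt (-aᴴ) h1 t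
    simp only [zero_smul, NormedSpace.exp_zero, Matrix.one_mulVec] at h3
    rw [← Matrix.mulVec_mulVec, ← Matrix.mulVec_mulVec, ← h3, Matrix.mulVec_mulVec,
      ← Matrix.exp_conjTranspose, Matrix.conjTranspose_smul, star_trivial, smul_neg,
      exp_smul_mul_exp_neg_smul, Matrix.one_mulVec]
  exact Matrix.mulVec_injective (funext key)

theorem normalize_smul (X : Matrix ι ι 𝕜) {r : ℝ} (hr : 0 < r) :
    normalize (r • X) = normalize X := by
  unfold normalize
  rw [RCLike.real_smul_eq_coe_smul (K := 𝕜) r X, norm_smul, smul_smul, RCLike.norm_ofReal,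
    abs_of_pos hr, ← RCLike.ofReal_mul, mul_inv, mul_comm r⁻¹, mul_assoc, inv_mul_cancel₀ hr.ne',
    mul_one]

theorem normalize_of_norm_one {X : Matrix ι ι 𝕜} (h : ‖X‖ = 1) : normalize X = X := by
  simp [normalize, h]

theorem frobenius_norm_vecMulVec (z w : ι → 𝕜) :
    ‖Matrix.vecMulVec z w‖ = Real.sqrt (∑ i, ‖z i‖ ^ 2) * Real.sqrt (∑ i, ‖w i‖ ^ 2) := by
  rw [Matrix.frobenius_norm_def, ← Real.sqrt_mul (Finset.sum_nonneg fun i _ => sq_nonneg _),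
    Real.sqrt_eq_rpow, Finset.sum_mul_sum]
  congr 1
  refine Finset.sum_congr rfl fun i _ => Finset.sum_congr rfl fun j _ => ?_
  rw [Matrix.vecMulVec_apply, norm_mul]
  norm_cast
  rw [mul_pow]

end Exp

/-! ### The cone of `su(n+1,1)` as the unit sphere of `ℂ^{n+1}` -/

section SUCone
open scoped Matrix.Norms.Frobenius
open Metric

variable {n : ℕ}

/-- The Hermitian form of signature `(n+1,1)`. -/
def hform (z w : Fin (n + 1) ⊕ Unit → ℂ) : ℂ := star z ⬝ᵥ (hermForm n *ᵥ w)

theorem hform_eq (z w : Fin (n + 1) ⊕ Unit → ℂ) :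
    hform z w = ∑ j, star (z (Sum.inl j)) * w (Sum.inl j)
      - star (z (Sum.inr ())) * w (Sum.inr ()) := by
  rw [hform, hermForm, Matrix.fromBlocks_mulVec]
  simp [dotProduct, Matrix.neg_mulVec, sub_eq_add_neg]

theorem hform_mulVec {g : Matrix (Fin (n + 1) ⊕ Unit) (Fin (n + 1) ⊕ Unit) ℂ}
    (hg : gᴴ * hermForm n * g = hermForm n) (z w : Fin (n + 1) ⊕ Unit → ℂ) :
    hform (g *ᵥ z) (g *ᵥ w) = hform z w := by
  rw [hform, hform, Matrix.star_mulVec, ← Matrix.dotProduct_mulVec, Matrix.mulVec_mulVec,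
    Matrix.mulVec_mulVec, hg]

theorem hform_self (z : Fin (n + 1) ⊕ Unit → ℂ) :
    hform z z = ((∑ j, ‖z (Sum.inl j)‖ ^ 2 - ‖z (Sum.inr ())‖ ^ 2 : ℝ) : ℂ) := by
  rw [hform_eq]
  push_cast
  congr 1
  · refine Finset.sum_congr rfl fun j _ => ?_
    rw [Complex.star_def, Complex.conj_mul']
  · rw [Complex.star_def, Complex.conj_mul']

theorem hermForm_mul_self : hermForm n * hermForm n = 1 := by
  simp [hermForm, Matrix.fromBlocks_multiply]

theorem inv_eq_of_preserves {g : Matrix (Fin (n + 1) ⊕ Unit) (Fin (n + 1) ⊕ Unit) ℂ}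
    (hg : gᴴ * hermForm n * g = hermForm n) : g⁻¹ = hermForm n * gᴴ * hermForm n := by
  refine Matrix.inv_eq_left_inv ?_
  rw [mul_assoc, mul_assoc, ← mul_assoc gᴴ, hg, hermForm_mul_self]

/-- The rank one element of `u(n+1,1)` attached to a vector. -/
def rankOneElt (z : Fin (n + 1) ⊕ Unit → ℂ) :
    Matrix (Fin (n + 1) ⊕ Unit) (Fin (n + 1) ⊕ Unit) ℂ :=
  Complex.I • (Matrix.vecMulVec z (star z) * hermForm n)

/-- Since `g⁻¹ = H gᴴ H` with `H` the Gram matrix, the adjoint action on rank one elements is the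
linear action on vectors. -/
theorem conj_rankOneElt {g : Matrix (Fin (n + 1) ⊕ Unit) (Fin (n + 1) ⊕ Unit) ℂ}
    (hg : gᴴ * hermForm n * g = hermForm n) (z : Fin (n + 1) ⊕ Unit → ℂ) :
    g * rankOneElt z * g⁻¹ = rankOneElt (g *ᵥ z) := by
  rw [inv_eq_of_preserves hg, rankOneElt, rankOneElt, Matrix.star_mulVec,
    Matrix.mul_smul, Matrix.smul_mul]
  congr 1
  calc g * (Matrix.vecMulVec z (star z) * hermForm n) * (hermForm n * gᴴ * hermForm n)
      = (g * Matrix.vecMulVec z (star z)) * (hermForm n * hermForm n) * gᴴ * hermForm n := by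
        simp only [mul_assoc]
    _ = _ := by
        rw [hermForm_mul_self, mul_one, Matrix.mul_vecMulVec, Matrix.vecMulVec_mul]

theorem rankOneElt_smul (c : ℂ) (z : Fin (n + 1) ⊕ Unit → ℂ) :
    rankOneElt (c • z) = (‖c‖ ^ 2) • rankOneElt z := by
  rw [rankOneElt, rankOneElt, star_smul, Matrix.vecMulVec_smul, Matrix.smul_vecMulVec,
    smul_smul, Matrix.smul_mul, smul_comm, Complex.star_def, Complex.conj_mul',
    RCLike.real_smul_eq_coe_smul (K := ℂ)]
  push_cast; rfl

theorem rankOneElt_apply_inr (z : Fin (n + 1) ⊕ Unit → ℂ) (i : Fin (n + 1) ⊕ Unit) :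
    rankOneElt z i (Sum.inr ()) = -(Complex.I * (z i * star (z (Sum.inr ())))) := by
  simp [rankOneElt, hermForm, Matrix.mul_apply, Matrix.vecMulVec_apply]

theorem rankOneElt_apply_inl (z : Fin (n + 1) ⊕ Unit → ℂ) (i : Fin (n + 1) ⊕ Unit)
    (j : Fin (n + 1)) :
    rankOneElt z i (Sum.inl j) = Complex.I * (z i * star (z (Sum.inl j))) := by
  simp [rankOneElt, hermForm, Matrix.mul_apply, Matrix.vecMulVec_apply, Matrix.one_apply]

theorem suRoot_eq : suRoot n = rankOneElt (Sum.elim (Pi.single (Fin.last n) 1) (-1)) := by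
  ext i j
  rcases j with j | j
  · rw [rankOneElt_apply_inl]
    rcases i with i | i <;>
      simp only [suRoot, Matrix.add_apply, Matrix.sub_apply, Matrix.single_apply, Sum.elim_inl,
        Sum.elim_inr, Pi.single_apply, Sum.inl.injEq, reduceCtorEq, false_and, and_false,
        if_false] <;> split_ifs <;> simp_all
  · rw [rankOneElt_apply_inr]
    rcases i with i | i <;>
      simp only [suRoot, Matrix.add_apply, Matrix.sub_apply, Matrix.single_apply, Sum.elim_inl,
        Sum.elim_inr, Pi.single_apply, Sum.inl.injEq, reduceCtorEq, false_and, and_false,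
        if_false] <;> split_ifs <;> simp_all

theorem norm_rankOneElt (z : Fin (n + 1) ⊕ Unit → ℂ) : ‖rankOneElt z‖ = ∑ i, ‖z i‖ ^ 2 := by
  have h : ∀ i, ‖(star z ᵥ* hermForm n) i‖ = ‖z i‖ := by
    intro i
    rw [hermForm, Matrix.vecMul_fromBlocks]
    rcases i with i | i <;> simp [Matrix.vecMul_neg]
  rw [rankOneElt, norm_smul, Complex.norm_I, one_mul, Matrix.vecMulVec_mul,
    frobenius_norm_vecMulVec]
  simp only [h]
  exact Real.mul_self_sqrt (Finset.sum_nonneg fun i _ => sq_nonneg _)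

/-- The affine coordinates of a point of `ℂ^{n+1}`. -/
def aff (x : Fin (n + 1) → ℂ) : Fin (n + 1) ⊕ Unit → ℂ := Sum.elim x 1

/-- The parametrization of the cone of `su(n+1,1)` by the unit sphere of `ℂ^{n+1}`. -/
def suPoint (x : EuclideanSpace ℂ (Fin (n + 1))) :
    Matrix (Fin (n + 1) ⊕ Unit) (Fin (n + 1) ⊕ Unit) ℂ :=
  (2⁻¹ : ℝ) • rankOneElt (aff x)

theorem sum_norm_sq_of_mem_sphere {x : EuclideanSpace ℂ (Fin (n + 1))} (hx : x ∈ sphere 0 1) :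
    ∑ i, ‖x i‖ ^ 2 = 1 := by
  rw [← EuclideanSpace.norm_sq_eq]
  simp at hx; simp [hx]

theorem hform_aff {x : EuclideanSpace ℂ (Fin (n + 1))} (hx : x ∈ sphere 0 1) :
    hform (aff x) (aff x) = 0 := by
  rw [hform_self]
  simp [aff, sum_norm_sq_of_mem_sphere hx]

theorem norm_suPoint {x : EuclideanSpace ℂ (Fin (n + 1))} (hx : x ∈ sphere 0 1) :
    ‖suPoint x‖ = 1 := by
  rw [suPoint, norm_smul, norm_rankOneElt, Fintype.sum_sum_type]
  simp [aff, sum_norm_sq_of_mem_sphere hx]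
  norm_num

theorem normalize_rankOneElt_smul_aff {x : EuclideanSpace ℂ (Fin (n + 1))} (hx : x ∈ sphere 0 1)
    {c : ℂ} (hc : c ≠ 0) : normalize (rankOneElt (c • aff x)) = suPoint x := by
  have h : rankOneElt (c • aff x) = (2 * ‖c‖ ^ 2) • suPoint x := by
    rw [rankOneElt_smul, suPoint, smul_smul]
    congr 1
    ring
  rw [h]
  have := norm_pos_iff.2 hc
  exact (normalize_smul _ (by positivity)).trans (normalize_of_norm_one (norm_suPoint hx))

/-- The form is positive definite on vectors with zero last coordinate, so a nonzero null vector can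
be scaled to have last coordinate `1`. -/
theorem exists_smul_aff {z : Fin (n + 1) ⊕ Unit → ℂ} (hz : z ≠ 0) (h : hform z z = 0) :
    z (Sum.inr ()) ≠ 0 ∧ ∃ x ∈ sphere (0 : EuclideanSpace ℂ (Fin (n + 1))) 1,
      z = z (Sum.inr ()) • aff x := by
  rw [hform_self, Complex.ofReal_eq_zero, sub_eq_zero] at h
  have h0 : z (Sum.inr ()) ≠ 0 := by
    intro h1
    rw [h1, norm_zero] at h
    apply hz
    have h2 := (Finset.sum_eq_zero_iff_of_nonneg fun i _ => sq_nonneg _).1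
      (h.trans (by norm_num))
    ext (i | i)
    · simpa using h2 i (Finset.mem_univ i)
    · simpa using h1
  have h3 : ‖z (Sum.inr ())‖ ≠ 0 := norm_ne_zero_iff.2 h0
  refine ⟨h0, WithLp.toLp 2 fun j => z (Sum.inl j) / z (Sum.inr ()), ?_, ?_⟩
  · rw [mem_sphere_zero_iff_norm, EuclideanSpace.norm_eq, Real.sqrt_eq_one]
    simp only [norm_div, div_pow]
    rw [← Finset.sum_div, h, div_self (pow_ne_zero 2 h3)]
  · ext (i | i)
    · simp [aff, mul_div_cancel₀ _ h0]
    · simp [aff]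

theorem exists_unitary_mulVec_single {m : Type*} [Fintype m] [DecidableEq m] (j : m)
    {x : EuclideanSpace ℂ m} (hx : ‖x‖ = 1) :
    ∃ U : Matrix m m ℂ, Uᴴ * U = 1 ∧ ∀ i, (U *ᵥ Pi.single j 1) i = x i := by
  have ho : Orthonormal ℂ (({j} : Set m).domRestrict fun _ => x) := by
    refine ⟨fun _ => hx, fun i k hik => ?_⟩
    exact absurd (Subtype.ext (i.2.trans k.2.symm)) hik
  obtain ⟨b, hb⟩ := ho.exists_orthonormalBasis_extension_of_card_eq (by simp)
  refine ⟨Matrix.of fun i k => b k i, ?_, fun i => ?_⟩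
  · ext i k
    have := orthonormal_iff_ite.1 b.orthonormal i k
    rw [EuclideanSpace.inner_eq_star_dotProduct] at this
    rw [Matrix.mul_apply, Matrix.one_apply, ← this, dotProduct]
    refine Finset.sum_congr rfl fun l _ => ?_
    simp [mul_comm]
  · simp [hb j rfl]

theorem exists_pow_eq_of_norm_eq_one {w : ℂ} (hw : ‖w‖ = 1) {k : ℕ} (hk : k ≠ 0) :
    ∃ c : ℂ, ‖c‖ = 1 ∧ c ^ k = w := by
  obtain ⟨c, hc⟩ := IsAlgClosed.exists_pow_nat_eq w (Nat.pos_of_ne_zero hk)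
  refine ⟨c, ?_, hc⟩
  have : ‖c‖ ^ k = 1 := by rw [← norm_pow, hc, hw]
  exact (pow_eq_one_iff_of_nonneg (norm_nonneg c) hk).1 this

theorem norm_det_of_unitary {m : Type*} [Fintype m] [DecidableEq m] {U : Matrix m m ℂ}
    (hU : Uᴴ * U = 1) : ‖U.det‖ = 1 := by
  have h := congrArg Matrix.det hU
  rw [Matrix.det_mul, Matrix.det_conjTranspose, Matrix.det_one, Complex.star_def,
    Complex.conj_mul'] at h
  have h2 : ‖U.det‖ ^ 2 = 1 := by exact_mod_cast h
  exact (pow_eq_one_iff_of_nonneg (norm_nonneg _) two_ne_zero).1 h2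

/-- Block diagonal unitary matrices of determinant one already act transitively on the sphere of
null lines. -/
theorem suPoint_mem {x : EuclideanSpace ℂ (Fin (n + 1))} (hx : x ∈ sphere 0 1) :
    suPoint x ∈ suCone n := by
  obtain ⟨U, hU, hUx⟩ := exists_unitary_mulVec_single (Fin.last n)
    (mem_sphere_zero_iff_norm.1 hx)
  -- The matrix will be `diag(c U, -c)`: the minus sign corrects the last coordinate `-1` of the
  -- root vector, and its determinant `-c^{n+2} det U` has to be `1`.
  obtain ⟨c, hc, hcw⟩ := exists_pow_eq_of_norm_eq_one (w := -star U.det) (k := n + 2)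
    (by simp [norm_det_of_unitary hU]) (by omega)
  have hcc : star c * c = 1 := by
    rw [Complex.star_def, Complex.conj_mul', hc]; norm_num
  have hdd : star U.det * U.det = 1 := by
    rw [Complex.star_def, Complex.conj_mul', norm_det_of_unitary hU]; norm_num
  let g : Matrix (Fin (n + 1) ⊕ Unit) (Fin (n + 1) ⊕ Unit) ℂ :=
    Matrix.fromBlocks (c • U) 0 0 (-(c • 1))
  have hg : gᴴ * hermForm n * g = hermForm n := by
    simp only [g, hermForm, Matrix.fromBlocks_conjTranspose, Matrix.fromBlocks_multiply]
    have hcc' : c * (starRingEnd ℂ) c = 1 := by rw [mul_comm]; exact hcc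
    congr 1 <;> simp [smul_smul, hU]
    all_goals rw [hcc', one_smul]
  have hdet : g.det = 1 := by
    simp only [g, Matrix.det_fromBlocks_zero₁₂, Matrix.det_smul, Fintype.card_fin]
    simp only [Matrix.det_unique, Matrix.neg_apply, Matrix.smul_apply, Matrix.one_apply_eq,
      smul_eq_mul, mul_one]
    calc c ^ (n + 1) * U.det * -c = -(c ^ (n + 2)) * U.det := by ring
      _ = 1 := by rw [hcw, neg_neg, hdd]
  refine ⟨_, ⟨g, ⟨hg, hdet⟩, rfl⟩, ?_⟩
  rw [suRoot_eq, conj_rankOneElt hg]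
  have h2 : g *ᵥ Sum.elim (Pi.single (Fin.last n) 1) (-1) = c • aff x := by
    simp only [g, Matrix.fromBlocks_mulVec]
    ext (i | i)
    · simp [Matrix.smul_mulVec, hUx, aff, -Matrix.mulVec_single]
    · simp [Matrix.neg_mulVec, Matrix.smul_mulVec, aff]
  rw [h2]
  refine normalize_rankOneElt_smul_aff hx ?_
  rintro rfl
  simp at hc

theorem suCone_eq : suCone n = suPoint '' sphere 0 1 := by
  ext X
  constructor
  · rintro ⟨_, ⟨g, ⟨hg, -⟩, rfl⟩, rfl⟩
    rw [suRoot_eq, conj_rankOneElt hg]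
    set w : Fin (n + 1) ⊕ Unit → ℂ := Sum.elim (Pi.single (Fin.last n) 1) (-1) with hw
    have h1 : hform (g *ᵥ w) (g *ᵥ w) = 0 := by
      rw [hform_mulVec hg, hform_eq]
      simp [w, Pi.single_apply]
    have h2 : g *ᵥ w ≠ 0 := by
      intro h
      have h3 : g⁻¹ *ᵥ (g *ᵥ w) = 0 := by rw [h, Matrix.mulVec_zero]
      rw [Matrix.mulVec_mulVec, inv_eq_of_preserves hg, mul_assoc, mul_assoc, ← mul_assoc gᴴ, hg,
        hermForm_mul_self, Matrix.one_mulVec] at h3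
      have := congrFun h3 (Sum.inr ())
      simp [w] at this
    obtain ⟨h0, x, hx, h⟩ := exists_smul_aff h2 h1
    exact ⟨x, hx, by rw [h, normalize_rankOneElt_smul_aff hx h0]⟩
  · rintro ⟨x, hx, rfl⟩
    exact suPoint_mem hx

/-- The inverse of the parametrization `suPoint`. -/
def suCoord (X : Matrix (Fin (n + 1) ⊕ Unit) (Fin (n + 1) ⊕ Unit) ℂ) :
    EuclideanSpace ℂ (Fin (n + 1)) :=
  WithLp.toLp 2 fun j => X (Sum.inl j) (Sum.inr ()) / X (Sum.inr ()) (Sum.inr ())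

theorem suCoord_suPoint (x : EuclideanSpace ℂ (Fin (n + 1))) : suCoord (suPoint x) = x := by
  ext j
  simp [suCoord, suPoint, rankOneElt_apply_inr, aff]
  field_simp

theorem contDiff_matrix_iff {ι κ F : Type*} [Fintype ι] [Fintype κ] [NormedAddCommGroup F]
    [NormedSpace ℝ F] {𝕜 : Type*} [RCLike 𝕜] {f : F → Matrix ι κ 𝕜} :
    ContDiff ℝ ∞ f ↔ ∀ i j, ContDiff ℝ ∞ fun x => f x i j := by
  constructor
  · intro h i j
    exact ((Matrix.entryLinearMap ℝ 𝕜 i j).toContinuousLinearMap.contDiff).comp h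
  · intro h
    have h1 : ContDiff ℝ ∞ fun x => (fun i j => f x i j : ι → κ → 𝕜) :=
      contDiff_pi.2 fun i => contDiff_pi.2 fun j => h i j
    exact ((Matrix.ofLinearEquiv (m := ι) (n := κ) (α := 𝕜) ℝ).toLinearMap.toContinuousLinearMap.contDiff).comp h1

theorem contDiff_toLp {ι 𝕜 : Type*} [Fintype ι] [RCLike 𝕜] :
    ContDiff ℝ ∞ (WithLp.toLp 2 : (ι → 𝕜) → EuclideanSpace 𝕜 ι) :=
  ((WithLp.linearEquiv 2 ℝ (ι → 𝕜)).symm.toLinearMap.toContinuousLinearMap).contDiff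

theorem contDiff_suPoint : ContDiff ℝ ∞ (suPoint (n := n)) := by
  have h1 : ∀ i, ContDiff ℝ ∞ fun x : EuclideanSpace ℂ (Fin (n + 1)) => aff x i := by
    rintro (i | i)
    · exact ((EuclideanSpace.proj (𝕜 := ℂ) i).restrictScalars ℝ).contDiff
    · simpa [aff] using contDiff_const
  have h2 : ∀ i, ContDiff ℝ ∞ fun x : EuclideanSpace ℂ (Fin (n + 1)) => star (aff x i) :=
    fun i => (Complex.conjCLE : ℂ →L[ℝ] ℂ).contDiff.comp (h1 i)
  rw [contDiff_matrix_iff]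
  rintro i (j | ⟨⟩)
  · simp only [suPoint, Matrix.smul_apply, rankOneElt_apply_inl]
    exact (contDiff_const.mul ((h1 i).mul (h2 _))).const_smul (2⁻¹ : ℝ)
  · change ContDiff ℝ ∞ fun x => suPoint x i (Sum.inr ())
    simp only [suPoint, Matrix.smul_apply, rankOneElt_apply_inr]
    exact (contDiff_const.mul ((h1 i).mul (h2 _))).neg.const_smul (2⁻¹ : ℝ)

theorem contDiffOn_suCoord : ContDiffOn ℝ ∞ (suCoord (n := n)) (suCone n) := by
  refine contDiff_toLp.comp_contDiffOn (contDiffOn_pi.2 fun j => ?_)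
  have h : ∀ i j, ContDiff ℝ ∞ fun X : Matrix (Fin (n + 1) ⊕ Unit) (Fin (n + 1) ⊕ Unit) ℂ =>
      X i j := fun i j => contDiff_matrix_iff.1 contDiff_id i j
  simp only [div_eq_mul_inv]
  refine (h _ _).contDiffOn.mul ((h _ _).contDiffOn.inv ?_)
  rw [suCone_eq]
  rintro _ ⟨x, -, rfl⟩
  simp [suPoint, rankOneElt_apply_inr, aff]

theorem isLocalDiffeoOn_suPoint : IsLocalDiffeoOn (suPoint (n := n)) (sphere 0 1) (suCone n) := by
  refine .of_inverse (g := suCoord) (fun x hx => suPoint_mem hx) ?_ ⟨fun x _ => suCoord_suPoint x, ?_⟩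
    contDiff_suPoint.contDiffOn contDiffOn_suCoord <;>
  · rw [suCone_eq]
    rintro _ ⟨x, hx, rfl⟩
    simp_all [suCoord_suPoint]

theorem isLocalDiffeoOn_suCoord : IsLocalDiffeoOn (suCoord (n := n)) (suCone n) (sphere 0 1) := by
  refine .of_inverse (g := suPoint) ?_ (fun x hx => suPoint_mem hx) ⟨?_, fun x _ => suCoord_suPoint x⟩
    contDiffOn_suCoord contDiff_suPoint.contDiffOn <;>
  · rw [suCone_eq]
    rintro _ ⟨x, hx, rfl⟩
    simp_all [suCoord_suPoint]

theorem rayFlow_suPoint {a : Matrix (Fin (n + 1) ⊕ Unit) (Fin (n + 1) ⊕ Unit) ℂ}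
    (ha : aᴴ * hermForm n + hermForm n * a = 0) {t : ℝ} {x y : EuclideanSpace ℂ (Fin (n + 1))}
    (hy : y ∈ sphere 0 1) {c : ℂ} (hc : c ≠ 0)
    (h : NormedSpace.exp (t • a) *ᵥ aff x = c • aff y) :
    rayFlow a t (suPoint x) = suPoint y := by
  have hg := exp_preserves_form ha t
  rw [rayFlow, Matrix.exp_neg, suPoint, Matrix.mul_smul, Matrix.smul_mul]
  have h2 := conj_rankOneElt hg (aff x)
  rw [h] at h2
  rw [h2]
  exact (normalize_smul _ (by norm_num)).trans (normalize_rankOneElt_smul_aff hy hc)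

theorem exists_flow_su {a : Matrix (Fin (n + 1) ⊕ Unit) (Fin (n + 1) ⊕ Unit) ℂ}
    (ha : aᴴ * hermForm n + hermForm n * a = 0) (t : ℝ) {x : EuclideanSpace ℂ (Fin (n + 1))}
    (hx : x ∈ sphere 0 1) :
    (NormedSpace.exp (t • a) *ᵥ aff x) (Sum.inr ()) ≠ 0 ∧
      ∃ y ∈ sphere (0 : EuclideanSpace ℂ (Fin (n + 1))) 1, NormedSpace.exp (t • a) *ᵥ aff x =
        (NormedSpace.exp (t • a) *ᵥ aff x) (Sum.inr ()) • aff y := by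
  refine exists_smul_aff ?_ ?_
  · intro h
    have h3 : NormedSpace.exp (-(t • a)) *ᵥ (NormedSpace.exp (t • a) *ᵥ aff x) = 0 := by
      rw [h, Matrix.mulVec_zero]
    have h4 := exp_smul_mul_exp_neg_smul a (-t)
    rw [neg_smul, neg_neg] at h4
    rw [Matrix.mulVec_mulVec, h4, Matrix.one_mulVec] at h3
    simpa [aff] using congrFun h3 (Sum.inr ())
  · rw [hform_mulVec (exp_preserves_form ha t), hform_aff hx]

end SUCone

/-! ### The double cover of the cone of `sp(n+1,ℝ)` by the unit sphere -/

section SpCone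
open scoped Matrix.Norms.Frobenius
open Metric

variable {n : ℕ}

theorem J_mul_J : Matrix.J (Fin (n + 1)) ℝ * Matrix.J (Fin (n + 1)) ℝ = -1 := Matrix.J_squared _ _

theorem mem_Sp_iff {g : Matrix (Fin (n + 1) ⊕ Fin (n + 1)) (Fin (n + 1) ⊕ Fin (n + 1)) ℝ} :
    g ∈ Sp n ↔ gᵀ * Matrix.J (Fin (n + 1)) ℝ * g = Matrix.J (Fin (n + 1)) ℝ :=
  SymplecticGroup.mem_iff'

theorem mem_sp_iff {a : Matrix (Fin (n + 1) ⊕ Fin (n + 1)) (Fin (n + 1) ⊕ Fin (n + 1)) ℝ} :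
    a ∈ sp n ↔ aᴴ * Matrix.J (Fin (n + 1)) ℝ + Matrix.J (Fin (n + 1)) ℝ * a = 0 := by
  rw [sp, LieAlgebra.Symplectic.sp, mem_skewAdjointMatricesLieSubalgebra,
    mem_skewAdjointMatricesSubmodule, Matrix.IsSkewAdjoint, Matrix.IsAdjointPair,
    Matrix.conjTranspose_eq_transpose_of_trivial, mul_neg, add_eq_zero_iff_eq_neg]

theorem Sp_inv_eq {g : Matrix (Fin (n + 1) ⊕ Fin (n + 1)) (Fin (n + 1) ⊕ Fin (n + 1)) ℝ}
    (hg : g ∈ Sp n) : g⁻¹ = -(Matrix.J (Fin (n + 1)) ℝ * gᵀ * Matrix.J (Fin (n + 1)) ℝ) := by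
  rw [mem_Sp_iff] at hg
  refine Matrix.inv_eq_left_inv ?_
  rw [neg_mul, mul_assoc, mul_assoc, ← mul_assoc gᵀ, hg, J_mul_J, neg_neg]

theorem Sp_inv_mul {g : Matrix (Fin (n + 1) ⊕ Fin (n + 1)) (Fin (n + 1) ⊕ Fin (n + 1)) ℝ}
    (hg : g ∈ Sp n) : g⁻¹ * g = 1 := by
  rw [Sp_inv_eq hg]
  rw [mem_Sp_iff] at hg
  rw [neg_mul, mul_assoc, mul_assoc, ← mul_assoc gᵀ, hg, J_mul_J, neg_neg]

theorem exp_mem_Sp {a : Matrix (Fin (n + 1) ⊕ Fin (n + 1)) (Fin (n + 1) ⊕ Fin (n + 1)) ℝ}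
    (ha : a ∈ sp n) (t : ℝ) : NormedSpace.exp (t • a) ∈ Sp n := by
  have := exp_preserves_form (mem_sp_iff.1 ha) t
  rwa [Matrix.conjTranspose_eq_transpose_of_trivial, ← mem_Sp_iff] at this

/-- The rank one element of `sp(n+1,ℝ)` attached to a vector. -/
def spElt (v : Fin (n + 1) ⊕ Fin (n + 1) → ℝ) :
    Matrix (Fin (n + 1) ⊕ Fin (n + 1)) (Fin (n + 1) ⊕ Fin (n + 1)) ℝ :=
  Matrix.vecMulVec v v * -Matrix.J (Fin (n + 1)) ℝ

theorem spElt_mul_J (v : Fin (n + 1) ⊕ Fin (n + 1) → ℝ) :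
    spElt v * Matrix.J (Fin (n + 1)) ℝ = Matrix.vecMulVec v v := by
  rw [spElt, mul_assoc, neg_mul, J_mul_J, neg_neg, mul_one]

theorem spElt_smul (c : ℝ) (v : Fin (n + 1) ⊕ Fin (n + 1) → ℝ) :
    spElt (c • v) = (c ^ 2) • spElt v := by
  rw [spElt, spElt, Matrix.vecMulVec_smul, Matrix.smul_vecMulVec, smul_smul, Matrix.smul_mul,
    sq]

theorem conj_spElt {g : Matrix (Fin (n + 1) ⊕ Fin (n + 1)) (Fin (n + 1) ⊕ Fin (n + 1)) ℝ}
    (hg : g ∈ Sp n) (v : Fin (n + 1) ⊕ Fin (n + 1) → ℝ) :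
    g * spElt v * g⁻¹ = spElt (g *ᵥ v) := by
  rw [Sp_inv_eq hg, spElt, spElt]
  calc g * (Matrix.vecMulVec v v * -Matrix.J _ ℝ) * -(Matrix.J _ ℝ * gᵀ * Matrix.J _ ℝ)
      = g * Matrix.vecMulVec v v * -(Matrix.J _ ℝ * Matrix.J _ ℝ) * gᵀ * -Matrix.J _ ℝ := by
        noncomm_ring
    _ = _ := by
        rw [J_mul_J, neg_neg, mul_one, Matrix.mul_vecMulVec, Matrix.vecMulVec_mul,
          Matrix.vecMul_transpose]

theorem spRoot_eq : spRoot n = (2 : ℝ) • spElt (Pi.single (Sum.inl 0) 1) := by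
  ext i j
  rw [spElt, Matrix.smul_apply, Matrix.mul_apply]
  simp only [Matrix.vecMulVec_apply, Pi.single_apply, Fintype.sum_sum_type]
  rcases i with i | i <;> rcases j with j | j <;>
    by_cases hi : i = 0 <;> by_cases hj : j = 0 <;>
    simp_all [spRoot, Matrix.J, Matrix.one_apply, eq_comm]

theorem norm_spElt (v : Fin (n + 1) ⊕ Fin (n + 1) → ℝ) : ‖spElt v‖ = ∑ i, ‖v i‖ ^ 2 := by
  have h : ∑ i, ‖(v ᵥ* -Matrix.J (Fin (n + 1)) ℝ) i‖ ^ 2 = ∑ i, ‖v i‖ ^ 2 := by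
    rw [Matrix.vecMul_neg, Matrix.J, Matrix.vecMul_fromBlocks, Fintype.sum_sum_type,
      Fintype.sum_sum_type]
    simp [Matrix.vecMul_neg, add_comm]
  rw [spElt, Matrix.vecMulVec_mul, frobenius_norm_vecMulVec, h]
  exact Real.mul_self_sqrt (Finset.sum_nonneg fun i _ => sq_nonneg _)

/-- The two-to-one parametrization of the cone of `sp(n+1,ℝ)` by the unit sphere. -/
def spPoint (v : EuclideanSpace ℝ (Fin (n + 1) ⊕ Fin (n + 1))) :
    Matrix (Fin (n + 1) ⊕ Fin (n + 1)) (Fin (n + 1) ⊕ Fin (n + 1)) ℝ := spElt v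

theorem normalize_spElt_smul {v : EuclideanSpace ℝ (Fin (n + 1) ⊕ Fin (n + 1))}
    (hv : v ∈ sphere 0 1) {c : ℝ} (hc : c ≠ 0) : normalize (spElt (c • (v : _ → ℝ))) = spPoint v := by
  rw [spElt_smul]
  refine (normalize_smul _ (by positivity)).trans (normalize_of_norm_one ?_)
  rw [norm_spElt, ← EuclideanSpace.norm_sq_eq, mem_sphere_zero_iff_norm.1 hv, one_pow]

theorem exists_smul_unit {w : Fin (n + 1) ⊕ Fin (n + 1) → ℝ} (hw : w ≠ 0) :
    ∃ c : ℝ, 0 < c ∧ ∃ v ∈ sphere (0 : EuclideanSpace ℝ (Fin (n + 1) ⊕ Fin (n + 1))) 1,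
      w = c • (v : _ → ℝ) := by
  have h : WithLp.toLp 2 w ≠ 0 := fun h => hw (by simpa using congrArg WithLp.ofLp h)
  refine ⟨‖WithLp.toLp 2 w‖, norm_pos_iff.2 h, unitVec _ h, (unitVec _ h).2, ?_⟩
  have := norm_ne_zero_iff.2 h
  simp [unitVec, smul_smul, this]

/-- The real coordinates of a complex vector. -/
def realify (n : ℕ) : (Fin (n + 1) → ℂ) ≃ₗ[ℝ] (Fin (n + 1) ⊕ Fin (n + 1) → ℝ) where
  toFun z := Sum.elim (fun j => (z j).re) (fun j => (z j).im)
  invFun v j := ⟨v (Sum.inl j), v (Sum.inr j)⟩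
  map_add' z w := by ext (j | j) <;> simp
  map_smul' c z := by ext (j | j) <;> simp
  left_inv z := by ext j <;> simp
  right_inv v := by ext (j | j) <;> simp

theorem toSp_mulVec (A : Matrix (Fin (n + 1)) (Fin (n + 1)) ℂ) (z : Fin (n + 1) → ℂ) :
    toSp A *ᵥ realify n z = realify n (A *ᵥ z) := by
  rw [toSp, realify, LinearEquiv.coe_mk, LinearMap.coe_mk, AddHom.coe_mk,
    Matrix.fromBlocks_mulVec]
  ext (j | j)
  · simp [Matrix.mulVec, dotProduct, Finset.sum_add_distrib, sub_eq_add_neg]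
  · simp [Matrix.mulVec, dotProduct, Finset.sum_add_distrib, add_comm]

theorem toSp_mul (A B : Matrix (Fin (n + 1)) (Fin (n + 1)) ℂ) :
    toSp (A * B) = toSp A * toSp B := by
  refine Matrix.mulVec_injective (funext fun v => ?_)
  obtain ⟨z, rfl⟩ := (realify n).surjective v
  rw [← Matrix.mulVec_mulVec]
  simp only [toSp_mulVec, Matrix.mulVec_mulVec]

theorem toSp_conjTranspose (A : Matrix (Fin (n + 1)) (Fin (n + 1)) ℂ) :
    toSp Aᴴ = (toSp A)ᵀ := by
  rw [toSp, toSp, Matrix.fromBlocks_transpose]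
  congr 1 <;> ext <;> simp

theorem toSp_I : toSp (Complex.I • (1 : Matrix (Fin (n + 1)) (Fin (n + 1)) ℂ))
    = Matrix.J (Fin (n + 1)) ℝ := by
  rw [toSp, Matrix.J]
  congr 1 <;> ext i j <;> by_cases h : i = j <;> simp [Matrix.one_apply, h]

/-- In real coordinates `J` is multiplication by `i`, which commutes with `U`. -/
theorem toSp_mem_Sp {U : Matrix (Fin (n + 1)) (Fin (n + 1)) ℂ} (hU : Uᴴ * U = 1) :
    toSp U ∈ Sp n := by
  rw [mem_Sp_iff, ← toSp_conjTranspose, ← toSp_I, ← toSp_mul, ← toSp_mul]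
  congr 1
  rw [mul_smul_comm, mul_one, smul_mul_assoc, hU]

/-- The unitary group, as a subgroup of the symplectic group, is already transitive on the unit
sphere. -/
theorem spPoint_mem {v : EuclideanSpace ℝ (Fin (n + 1) ⊕ Fin (n + 1))} (hv : v ∈ sphere 0 1) :
    spPoint v ∈ spCone n := by
  have hx : ‖(WithLp.toLp 2 ((realify n).symm v) : EuclideanSpace ℂ (Fin (n + 1)))‖ = 1 := by
    rw [mem_sphere_zero_iff_norm, EuclideanSpace.norm_eq, Fintype.sum_sum_type] at hv
    rw [EuclideanSpace.norm_eq, ← hv]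
    congr 1
    rw [← Finset.sum_add_distrib]
    refine Finset.sum_congr rfl fun j _ => ?_
    rw [Complex.sq_norm, Complex.normSq_apply]
    simp [realify, ← sq]
  obtain ⟨U, hU, hUx⟩ := exists_unitary_mulVec_single 0 hx
  refine ⟨_, ⟨toSp U, toSp_mem_Sp hU, rfl⟩, ?_⟩
  have h1 : (Pi.single (Sum.inl 0) 1 : Fin (n + 1) ⊕ Fin (n + 1) → ℝ)
      = realify n (Pi.single 0 1) := by
    ext (j | j) <;> by_cases h : j = 0 <;> simp [realify, h, Pi.single_apply]
  have h2 : toSp U *ᵥ Pi.single (Sum.inl 0) 1 = (1 : ℝ) • (v : _ → ℝ) := by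
    rw [h1, toSp_mulVec, one_smul, (funext hUx : U *ᵥ Pi.single 0 1 = _)]
    exact (realify n).apply_symm_apply _
  rw [spRoot_eq, Matrix.mul_smul, Matrix.smul_mul, conj_spElt (toSp_mem_Sp hU), h2]
  exact (normalize_smul _ two_pos).trans (normalize_spElt_smul hv one_ne_zero)

theorem spCone_eq : spCone n = spPoint '' sphere 0 1 := by
  ext X
  constructor
  · rintro ⟨_, ⟨g, hg, rfl⟩, rfl⟩
    have h2 : g *ᵥ Pi.single (Sum.inl 0) 1 ≠ 0 := by
      intro h
      have h3 := congrArg (fun w => g⁻¹ *ᵥ w) h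
      simp only [Matrix.mulVec_mulVec, Sp_inv_mul hg, Matrix.one_mulVec, Matrix.mulVec_zero] at h3
      simpa using congrFun h3 (Sum.inl 0)
    obtain ⟨c, hc, v, hv, h⟩ := exists_smul_unit h2
    refine ⟨v, hv, ?_⟩
    rw [spRoot_eq, Matrix.mul_smul, Matrix.smul_mul, conj_spElt hg, h]
    exact ((normalize_smul _ two_pos).trans (normalize_spElt_smul hv hc.ne')).symm
  · rintro ⟨v, hv, rfl⟩
    exact spPoint_mem hv

theorem spPoint_neg (v : EuclideanSpace ℝ (Fin (n + 1) ⊕ Fin (n + 1))) :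
    spPoint (-v) = spPoint v := by
  have := spElt_smul (-1) (v : _ → ℝ)
  simpa [spPoint] using this

theorem contDiff_spPoint : ContDiff ℝ ∞ (spPoint (n := n)) := by
  have h1 : ∀ i, ContDiff ℝ ∞ fun v : EuclideanSpace ℝ (Fin (n + 1) ⊕ Fin (n + 1)) => v i :=
    fun i => (EuclideanSpace.proj (𝕜 := ℝ) i).contDiff
  rw [contDiff_matrix_iff]
  intro i j
  simp only [spPoint, spElt, Matrix.mul_apply, Matrix.vecMulVec_apply]
  exact ContDiff.sum fun k _ => ((h1 i).mul (h1 k)).mul contDiff_const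

/-- Near `v₀` the vector `v` is recovered from `v vᵀ`: applying it to `v₀` gives `⟨v, v₀⟩ v`,
pairing again with `v₀` gives `⟨v, v₀⟩²`, and dividing by the positive root of the latter returns
`v` on the open hemisphere around `v₀`. -/
theorem isLocalDiffeoOn_spPoint : IsLocalDiffeoOn (spPoint (n := n)) (sphere 0 1) (spCone n) := by
  refine ⟨fun v hv => spPoint_mem hv, fun v₀ hv₀ => ?_⟩
  let L : Matrix (Fin (n + 1) ⊕ Fin (n + 1)) (Fin (n + 1) ⊕ Fin (n + 1)) ℝ →
      (Fin (n + 1) ⊕ Fin (n + 1) → ℝ) := fun X => (X * Matrix.J (Fin (n + 1)) ℝ) *ᵥ v₀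
  let N : Matrix (Fin (n + 1) ⊕ Fin (n + 1)) (Fin (n + 1) ⊕ Fin (n + 1)) ℝ → ℝ :=
    fun X => (v₀ : _ → ℝ) ⬝ᵥ L X
  let d : EuclideanSpace ℝ (Fin (n + 1) ⊕ Fin (n + 1)) → ℝ := fun v => (v : _ → ℝ) ⬝ᵥ v₀
  have hLp : ∀ v : EuclideanSpace ℝ (Fin (n + 1) ⊕ Fin (n + 1)), L (spPoint v) = d v • v := by
    intro v
    simp only [L, spPoint, spElt_mul_J, Matrix.vecMulVec_mulVec, d]
    ext i; simp [mul_comm]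
  have hNp : ∀ v : EuclideanSpace ℝ (Fin (n + 1) ⊕ Fin (n + 1)), N (spPoint v) = d v ^ 2 := by
    intro v
    simp only [N, hLp, dotProduct_smul, smul_eq_mul, sq]
    rw [dotProduct_comm]
  have hent : ∀ i j, ContDiff ℝ ∞ fun X : Matrix (Fin (n + 1) ⊕ Fin (n + 1))
      (Fin (n + 1) ⊕ Fin (n + 1)) ℝ => X i j := fun i j => contDiff_matrix_iff.1 contDiff_id i j
  have hLs : ∀ i, ContDiff ℝ ∞ fun X => L X i := by
    intro i
    simp only [L, Matrix.mulVec, dotProduct, Matrix.mul_apply]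
    exact ContDiff.sum fun k _ => (ContDiff.sum fun l _ => (hent i l).mul contDiff_const).mul
      contDiff_const
  have hNs : ContDiff ℝ ∞ N := ContDiff.sum fun k _ => contDiff_const.mul (hLs k)
  have hds : Continuous d := by
    refine continuous_finsetSum _ fun i _ => ?_
    exact ((EuclideanSpace.proj (𝕜 := ℝ) i).continuous).mul continuous_const
  have hd0 : d v₀ = 1 := by
    have h := EuclideanSpace.norm_sq_eq v₀
    rw [mem_sphere_zero_iff_norm.1 hv₀] at h
    simp only [d, dotProduct]
    rw [one_pow] at h
    exact h ▸ Finset.sum_congr rfl fun i _ => by rw [Real.norm_eq_abs, sq_abs, sq]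
  let g : Matrix (Fin (n + 1) ⊕ Fin (n + 1)) (Fin (n + 1) ⊕ Fin (n + 1)) ℝ →
      EuclideanSpace ℝ (Fin (n + 1) ⊕ Fin (n + 1)) :=
    fun X => WithLp.toLp 2 fun i => (Real.sqrt (N X))⁻¹ * L X i
  have hg : ∀ v : EuclideanSpace ℝ (Fin (n + 1) ⊕ Fin (n + 1)), g (spPoint v)
      = (|d v|⁻¹ * d v) • v := by
    intro v
    ext i
    simp only [g, hNp, Real.sqrt_sq_eq_abs]
    rw [hLp]
    simp [mul_assoc]
  have hgpos : ∀ v, 0 < d v → g (spPoint v) = v := by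
    intro v hv
    rw [hg, abs_of_pos hv, inv_mul_cancel₀ hv.ne', one_smul]
  have hdneg : ∀ v, d (-v) = -d v := fun v => by simp [d]
  have hcases : ∀ X ∈ spCone n, 0 < N X → ∃ v ∈ sphere 0 1, X = spPoint v ∧ 0 < d v := by
    intro X hX hNX
    rw [spCone_eq] at hX
    obtain ⟨v, hv, rfl⟩ := hX
    rw [hNp] at hNX
    rcases lt_or_gt_of_ne (pow_ne_zero_iff two_ne_zero |>.1 hNX.ne') with h | h
    · exact ⟨-v, by simpa using hv, (spPoint_neg v).symm, by rw [hdneg]; linarith⟩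
    · exact ⟨v, hv, rfl, h⟩
  refine ⟨{v | 0 < d v}, {X | 0 < N X}, g, isOpen_lt continuous_const hds,
    isOpen_lt continuous_const hNs.continuous, by simp [hd0], ?_, ?_, ⟨?_, ?_⟩,
    contDiff_spPoint.contDiffOn, ?_⟩
  · rintro v ⟨hv, hdv⟩
    refine ⟨spPoint_mem hv, ?_⟩
    simp only [Set.mem_ofPred_eq, hNp] at hdv ⊢
    positivity
  · rintro X ⟨hX, hNX⟩
    obtain ⟨v, hv, rfl, hdv⟩ := hcases X hX hNX
    rw [hgpos v hdv]
    exact ⟨hv, hdv⟩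
  · rintro v ⟨hv, hdv⟩
    exact hgpos v hdv
  · rintro X ⟨hX, hNX⟩
    obtain ⟨v, hv, rfl, hdv⟩ := hcases X hX hNX
    rw [hgpos v hdv]
  · refine contDiff_toLp.comp_contDiffOn (contDiffOn_pi.2 fun i => ?_)
    refine ContDiffOn.mul (ContDiffOn.inv (hNs.contDiffOn.sqrt ?_) ?_) (hLs i).contDiffOn
    · rintro X ⟨-, hX⟩; exact (show 0 < N X from hX).ne'
    · rintro X ⟨-, hX⟩; exact (Real.sqrt_pos.2 hX).ne'

theorem rayFlow_spPoint {a : Matrix (Fin (n + 1) ⊕ Fin (n + 1)) (Fin (n + 1) ⊕ Fin (n + 1)) ℝ}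
    (ha : a ∈ sp n) {t : ℝ} {v w : EuclideanSpace ℝ (Fin (n + 1) ⊕ Fin (n + 1))}
    (hw : w ∈ sphere 0 1) {c : ℝ} (hc : c ≠ 0)
    (h : NormedSpace.exp (t • a) *ᵥ v = c • (w : _ → ℝ)) :
    rayFlow a t (spPoint v) = spPoint w := by
  have hg := conj_spElt (exp_mem_Sp ha t) (v : _ → ℝ)
  rw [h] at hg
  rw [rayFlow, Matrix.exp_neg, spPoint, hg, normalize_spElt_smul hw hc]

theorem exp_mulVec_ne_zero {ι 𝕜 : Type*} [Fintype ι] [DecidableEq ι] [RCLike 𝕜]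
    (a : Matrix ι ι 𝕜) (t : ℝ) {v : ι → 𝕜} (hv : v ≠ 0) :
    NormedSpace.exp (t • a) *ᵥ v ≠ 0 := by
  intro h
  have h3 : NormedSpace.exp (-(t • a)) *ᵥ (NormedSpace.exp (t • a) *ᵥ v) = 0 := by
    rw [h, Matrix.mulVec_zero]
  have h4 := exp_smul_mul_exp_neg_smul a (-t)
  rw [neg_smul, neg_neg] at h4
  rw [Matrix.mulVec_mulVec, h4, Matrix.one_mulVec] at h3
  exact hv h3

end SpCone

/-! ### The adjoint action on rays -/

section AdRay
open scoped Matrix.Norms.Frobenius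

variable {ι 𝕜 : Type*} [Fintype ι] [DecidableEq ι] [RCLike 𝕜]

/-- The action of a matrix on rays of matrices by conjugation. -/
def adRay (g X : Matrix ι ι 𝕜) : Matrix ι ι 𝕜 := normalize (g * X * g⁻¹)

theorem normalize_conj_normalize (g h Y : Matrix ι ι 𝕜) :
    normalize (g * normalize Y * h) = normalize (g * Y * h) := by
  by_cases hY : Y = 0
  · simp [hY, normalize]
  · have h1 : normalize Y = (‖Y‖⁻¹ : ℝ) • Y := by
      rw [normalize, RCLike.real_smul_eq_coe_smul (K := 𝕜)]
    rw [h1, Matrix.mul_smul, Matrix.smul_mul]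
    exact normalize_smul _ (inv_pos.2 (norm_pos_iff.2 hY))

theorem adRay_adRay (g h X : Matrix ι ι 𝕜) : adRay g (adRay h X) = adRay (g * h) X := by
  rw [adRay, adRay, normalize_conj_normalize, adRay, Matrix.mul_inv_rev]
  simp only [mul_assoc]

theorem rayFlow_eq_adRay (a : Matrix ι ι 𝕜) (t : ℝ) (X : Matrix ι ι 𝕜) :
    rayFlow a t X = adRay (NormedSpace.exp (t • a)) X := by
  rw [rayFlow, adRay, Matrix.exp_neg]

theorem adRay_rayFlow {g : Matrix ι ι 𝕜} (hg : g⁻¹ * g = 1) (a : Matrix ι ι 𝕜) (t : ℝ)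
    (X : Matrix ι ι 𝕜) : adRay g (rayFlow a t X) = rayFlow (g * a * g⁻¹) t (adRay g X) := by
  have hu : IsUnit g := ⟨⟨g, g⁻¹, mul_eq_one_comm.1 hg, hg⟩, rfl⟩
  have h : NormedSpace.exp (t • (g * a * g⁻¹)) = g * NormedSpace.exp (t • a) * g⁻¹ := by
    rw [← Matrix.smul_mul, ← Matrix.mul_smul, Matrix.exp_conj g (t • a) hu]
  rw [rayFlow_eq_adRay, rayFlow_eq_adRay, adRay_adRay, adRay_adRay, h]
  congr 1
  rw [mul_assoc _ g⁻¹, hg, mul_one]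

theorem norm_normalize {X : Matrix ι ι 𝕜} (hX : X ≠ 0) : ‖normalize X‖ = 1 := by
  rw [normalize, norm_smul, RCLike.norm_ofReal, abs_of_nonneg (inv_nonneg.2 (norm_nonneg _)),
    inv_mul_cancel₀ (norm_ne_zero_iff.2 hX)]

/-- The squared Frobenius norm is a polynomial in the real and imaginary parts of the entries, and
the square root is smooth away from zero. -/
theorem contDiffOn_normalize : ContDiffOn ℝ ∞ (normalize (ι := ι) (𝕜 := 𝕜)) {X | X ≠ 0} := by
  have hsq : ∀ X : Matrix ι ι 𝕜, ∑ i, ∑ j, (RCLike.re (X i j) * RCLike.re (X i j)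
      + RCLike.im (X i j) * RCLike.im (X i j)) = ‖X‖ ^ 2 := by
    intro X
    rw [Matrix.frobenius_norm_def, ← Real.sqrt_eq_rpow, Real.sq_sqrt]
    · simp only [← RCLike.norm_sq_eq_def]
      norm_cast
    · positivity
  have hent : ∀ i j, ContDiff ℝ ∞ fun X : Matrix ι ι 𝕜 => X i j := fun i j =>
    contDiff_matrix_iff.1 contDiff_id i j
  have h1 : ContDiff ℝ ∞ fun X : Matrix ι ι 𝕜 => ‖X‖ ^ 2 := by
    simp only [← hsq]
    refine ContDiff.sum fun i _ => ContDiff.sum fun j _ => ?_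
    have hre : ContDiff ℝ ∞ fun X : Matrix ι ι 𝕜 => RCLike.re (X i j) :=
      (RCLike.reCLM (K := 𝕜)).contDiff.comp (hent i j)
    have him : ContDiff ℝ ∞ fun X : Matrix ι ι 𝕜 => RCLike.im (X i j) :=
      (RCLike.imCLM (K := 𝕜)).contDiff.comp (hent i j)
    exact (hre.mul hre).add (him.mul him)
  have h2 : ContDiffOn ℝ ∞ (fun X : Matrix ι ι 𝕜 => ‖X‖) {X | X ≠ 0} := by
    have : (fun X : Matrix ι ι 𝕜 => ‖X‖) = fun X => Real.sqrt (‖X‖ ^ 2) := by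
      ext X; rw [Real.sqrt_sq (norm_nonneg _)]
    rw [this]
    exact h1.contDiffOn.sqrt fun X hX => pow_ne_zero 2 (norm_ne_zero_iff.2 hX)
  have h3 : normalize (ι := ι) (𝕜 := 𝕜) = fun X => ‖X‖⁻¹ • X := by
    ext1 X; rw [normalize, RCLike.real_smul_eq_coe_smul (K := 𝕜)]
  rw [h3]
  exact (h2.inv fun X hX => norm_ne_zero_iff.2 hX).smul contDiffOn_id

theorem conj_ne_zero {g X : Matrix ι ι 𝕜} (hg : g⁻¹ * g = 1) (hX : X ≠ 0) :
    g * X * g⁻¹ ≠ 0 := by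
  intro h
  apply hX
  have h1 : g⁻¹ * (g * X * g⁻¹) * g = X := by
    rw [mul_assoc, mul_assoc, hg, mul_one, ← mul_assoc, hg, one_mul]
  rw [← h1, h, mul_zero, zero_mul]

theorem contDiffOn_adRay {g : Matrix ι ι 𝕜} (hg : g⁻¹ * g = 1) :
    ContDiffOn ℝ ∞ (adRay g) {X | X ≠ 0} := by
  refine contDiffOn_normalize.comp (t := {X | X ≠ 0}) ?_ fun X hX => conj_ne_zero hg hX
  refine ContDiff.contDiffOn (contDiff_matrix_iff.2 fun i j => ?_)
  have hent : ∀ i j, ContDiff ℝ ∞ fun X : Matrix ι ι 𝕜 => X i j := fun i j =>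
    contDiff_matrix_iff.1 contDiff_id i j
  simp only [Matrix.mul_apply]
  exact ContDiff.sum fun k _ => (ContDiff.sum fun l _ => contDiff_const.mul (hent l k)).mul
    contDiff_const

theorem isLocalDiffeoOn_adRay {G : Set (Matrix ι ι 𝕜)} {e : Matrix ι ι 𝕜} (he : e ≠ 0)
    (hmul : ∀ g ∈ G, ∀ h ∈ G, g * h ∈ G) (hinv : ∀ g ∈ G, g⁻¹ ∈ G) (hu : ∀ g ∈ G, g⁻¹ * g = 1)
    {g : Matrix ι ι 𝕜} (hg : g ∈ G) :
    IsLocalDiffeoOn (adRay g) (orientedProj (adOrbit G e)) (orientedProj (adOrbit G e)) := by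
  have hne : orientedProj (adOrbit G e) ⊆ {X | X ≠ 0} := by
    rintro _ ⟨_, ⟨h, hh, rfl⟩, rfl⟩ h0
    have := norm_normalize (conj_ne_zero (hu h hh) he)
    rw [h0, norm_zero] at this
    exact zero_ne_one this
  have hmap : ∀ g ∈ G, Set.MapsTo (adRay g) (orientedProj (adOrbit G e))
      (orientedProj (adOrbit G e)) := by
    rintro g hg _ ⟨_, ⟨h, hh, rfl⟩, rfl⟩
    refine ⟨_, ⟨g * h, hmul g hg h hh, rfl⟩, ?_⟩
    exact (adRay_adRay g h e).symm
  have hone : ∀ X ∈ orientedProj (adOrbit G e), adRay 1 X = X := by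
    rintro _ ⟨Y, -, rfl⟩
    rw [adRay, normalize_conj_normalize, inv_one, one_mul, mul_one]
  have h2 : g * g⁻¹ = 1 := mul_eq_one_comm.1 (hu g hg)
  refine .of_inverse (g := adRay g⁻¹) (hmap g hg) (hmap _ (hinv g hg)) ⟨fun X hX => ?_, fun X hX => ?_⟩
    ((contDiffOn_adRay (hu g hg)).mono hne) ((contDiffOn_adRay (hu _ (hinv g hg))).mono hne)
  · rw [adRay_adRay, hu g hg, hone X hX]
  · rw [adRay_adRay, h2, hone X hX]

end AdRay

/-! ### Invariance of local conjugacy under the adjoint actions -/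

section Groups
open scoped Matrix.Norms.Frobenius

variable {n : ℕ}

theorem SU_mul {g h : Matrix (Fin (n + 1) ⊕ Unit) (Fin (n + 1) ⊕ Unit) ℂ} (hg : g ∈ SU n)
    (hh : h ∈ SU n) : g * h ∈ SU n := by
  refine ⟨?_, by rw [Matrix.det_mul, hg.2, hh.2, mul_one]⟩
  calc (g * h)ᴴ * hermForm n * (g * h) = hᴴ * (gᴴ * hermForm n * g) * h := by
        rw [Matrix.conjTranspose_mul]; simp only [mul_assoc]
    _ = hermForm n := by rw [hg.1, hh.1]

theorem SU_inv_mul {g : Matrix (Fin (n + 1) ⊕ Unit) (Fin (n + 1) ⊕ Unit) ℂ} (hg : g ∈ SU n) :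
    g⁻¹ * g = 1 := Matrix.nonsing_inv_mul _ (by rw [hg.2]; exact isUnit_one)

theorem SU_inv {g : Matrix (Fin (n + 1) ⊕ Unit) (Fin (n + 1) ⊕ Unit) ℂ} (hg : g ∈ SU n) :
    g⁻¹ ∈ SU n := by
  have h1 : g * g⁻¹ = 1 := mul_eq_one_comm.1 (SU_inv_mul hg)
  refine ⟨?_, by rw [Matrix.det_nonsing_inv, hg.2, Ring.inverse_one]⟩
  calc (g⁻¹)ᴴ * hermForm n * g⁻¹ = (g * g⁻¹)ᴴ * hermForm n * (g * g⁻¹) := by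
        nth_rw 1 [← hg.1]
        rw [Matrix.conjTranspose_mul]; simp only [mul_assoc]
    _ = hermForm n := by rw [h1]; simp

theorem Sp_inv {g : Matrix (Fin (n + 1) ⊕ Fin (n + 1)) (Fin (n + 1) ⊕ Fin (n + 1)) ℝ}
    (hg : g ∈ Sp n) : g⁻¹ ∈ Sp n := by
  have h1 : g * g⁻¹ = 1 := mul_eq_one_comm.1 (Sp_inv_mul hg)
  rw [mem_Sp_iff] at hg ⊢
  calc (g⁻¹)ᵀ * Matrix.J _ ℝ * g⁻¹ = (g * g⁻¹)ᵀ * Matrix.J _ ℝ * (g * g⁻¹) := by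
        nth_rw 1 [← hg]
        rw [Matrix.transpose_mul]; simp only [mul_assoc]
    _ = Matrix.J _ ℝ := by rw [h1]; simp

theorem Sp_mul {g h : Matrix (Fin (n + 1) ⊕ Fin (n + 1)) (Fin (n + 1) ⊕ Fin (n + 1)) ℝ}
    (hg : g ∈ Sp n) (hh : h ∈ Sp n) : g * h ∈ Sp n :=
  (Matrix.symplecticGroup (Fin (n + 1)) ℝ).mul_mem hg hh

theorem suRoot_ne_zero : suRoot n ≠ 0 := by
  intro h
  have := congrFun (congrFun h (Sum.inr ())) (Sum.inr ())
  rw [suRoot_eq, rankOneElt_apply_inr] at this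
  simp at this

theorem spRoot_ne_zero : spRoot n ≠ 0 := by
  intro h
  have := congrFun (congrFun h (Sum.inl 0)) (Sum.inr 0)
  simp [spRoot] at this

/-- Conjugating `a₁` by `g` amounts to precomposing the conjugacy with the diffeomorphism `adRay
g⁻¹` of the cone. -/
theorem LocallyConjugate.conj_left {a₁ : Matrix (Fin (n + 1) ⊕ Unit) (Fin (n + 1) ⊕ Unit) ℂ}
    {a₂ : Matrix (Fin (n + 1) ⊕ Fin (n + 1)) (Fin (n + 1) ⊕ Fin (n + 1)) ℝ}
    (h : LocallyConjugate a₁ a₂) {b : Matrix (Fin (n + 1) ⊕ Unit) (Fin (n + 1) ⊕ Unit) ℂ}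
    (hb : AdConj (SU n) a₁ b) : LocallyConjugate b a₂ := by
  obtain ⟨f, hf, hft⟩ := h
  obtain ⟨g, hg, rfl⟩ := hb
  have hd := isLocalDiffeoOn_adRay (G := SU n) suRoot_ne_zero (fun _ h₁ _ h₂ => SU_mul h₁ h₂)
    (fun _ => SU_inv) (fun _ => SU_inv_mul) (SU_inv hg)
  refine ⟨f ∘ adRay g⁻¹, hf.comp hd, fun t X hX => ?_⟩
  have h1 : g⁻¹ * (g * a₁ * g⁻¹) * g⁻¹⁻¹ = a₁ := by
    have h2 : g⁻¹ * g⁻¹⁻¹ = 1 := mul_eq_one_comm.1 (SU_inv_mul (SU_inv hg))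
    rw [mul_assoc, mul_assoc, h2, mul_one, ← mul_assoc, SU_inv_mul hg, one_mul]
  simp only [Function.comp]
  rw [adRay_rayFlow (SU_inv_mul (SU_inv hg)), h1]
  exact hft t _ (hd.1 hX)

theorem LocallyConjugate.conj_right {a₁ : Matrix (Fin (n + 1) ⊕ Unit) (Fin (n + 1) ⊕ Unit) ℂ}
    {a₂ : Matrix (Fin (n + 1) ⊕ Fin (n + 1)) (Fin (n + 1) ⊕ Fin (n + 1)) ℝ}
    (h : LocallyConjugate a₁ a₂)
    {b : Matrix (Fin (n + 1) ⊕ Fin (n + 1)) (Fin (n + 1) ⊕ Fin (n + 1)) ℝ}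
    (hb : AdConj (Sp n) a₂ b) : LocallyConjugate a₁ b := by
  obtain ⟨f, hf, hft⟩ := h
  obtain ⟨g, hg, rfl⟩ := hb
  have hd := isLocalDiffeoOn_adRay (G := Sp n) spRoot_ne_zero (fun _ h₁ _ h₂ => Sp_mul h₁ h₂)
    (fun _ => Sp_inv) (fun _ => Sp_inv_mul) hg
  refine ⟨adRay g ∘ f, hd.comp hf, fun t X hX => ?_⟩
  simp only [Function.comp]
  rw [hft t X hX, adRay_rayFlow (Sp_inv_mul hg)]

theorem AdConj.symm_SU {a b : Matrix (Fin (n + 1) ⊕ Unit) (Fin (n + 1) ⊕ Unit) ℂ}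
    (h : AdConj (SU n) a b) : AdConj (SU n) b a := by
  obtain ⟨g, hg, rfl⟩ := h
  refine ⟨g⁻¹, SU_inv hg, ?_⟩
  have h2 : g⁻¹ * g⁻¹⁻¹ = 1 := mul_eq_one_comm.1 (SU_inv_mul (SU_inv hg))
  rw [mul_assoc, mul_assoc, h2, mul_one, ← mul_assoc, SU_inv_mul hg, one_mul]

theorem AdConj.symm_Sp {a b : Matrix (Fin (n + 1) ⊕ Fin (n + 1)) (Fin (n + 1) ⊕ Fin (n + 1)) ℝ}
    (h : AdConj (Sp n) a b) : AdConj (Sp n) b a := by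
  obtain ⟨g, hg, rfl⟩ := h
  refine ⟨g⁻¹, Sp_inv hg, ?_⟩
  have h2 : g⁻¹ * g⁻¹⁻¹ = 1 := mul_eq_one_comm.1 (Sp_inv_mul (Sp_inv hg))
  rw [mul_assoc, mul_assoc, h2, mul_one, ← mul_assoc, Sp_inv_mul hg, one_mul]

theorem AdConj.trans_SU {a b c : Matrix (Fin (n + 1) ⊕ Unit) (Fin (n + 1) ⊕ Unit) ℂ}
    (h : AdConj (SU n) a b) (h' : AdConj (SU n) b c) : AdConj (SU n) a c := by
  obtain ⟨g, hg, rfl⟩ := h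
  obtain ⟨k, hk, rfl⟩ := h'
  refine ⟨k * g, SU_mul hk hg, ?_⟩
  rw [Matrix.mul_inv_rev]; simp only [mul_assoc]

end Groups

/-! ### Real linear conjugacies induce local conjugacies -/

section Linear
open scoped Matrix.Norms.Frobenius
open Metric

variable {n : ℕ}

/-- Linear maps commute with positive scaling, so the normalisation of `T.symm` inverts that of `T`.
-/
theorem isLocalDiffeoOn_linear {E E' : Type*} [NormedAddCommGroup E] [InnerProductSpace ℝ E]
    [NormedAddCommGroup E'] [InnerProductSpace ℝ E'] (T : E ≃L[ℝ] E') :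
    IsLocalDiffeoOn (fun x => ‖T x‖⁻¹ • T x) (sphere 0 1) (sphere 0 1) := by
  have hne : ∀ {F : Type _} [NormedAddCommGroup F] (x : F), x ∈ sphere (0 : F) 1 → x ≠ 0 := by
    rintro F _ x hx rfl
    simp at hx
  refine .of_inverse (g := fun x => ‖T.symm x‖⁻¹ • T.symm x) ?_ ?_ ⟨?_, ?_⟩ ?_ ?_
  · intro x hx
    have : T x ≠ 0 := by simpa using hne x hx
    simp [norm_smul, this]
  · intro x hx
    have : T.symm x ≠ 0 := by
      intro h; exact ne_zero_of_mem_unit_sphere ⟨x, hx⟩ (by simpa using congrArg T h)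
    simp [norm_smul, this]
  · intro x hx
    have h0 : ‖T x‖ ≠ 0 := by simpa using hne x hx
    have : ‖x‖ = 1 := by simpa using hx
    simp [norm_smul, this, smul_smul, h0]
  · intro x hx
    have h0 : ‖T.symm x‖ ≠ 0 := by
      rw [norm_ne_zero_iff]
      intro h; exact ne_zero_of_mem_unit_sphere ⟨x, hx⟩ (by simpa using congrArg T h)
    have : ‖x‖ = 1 := by simpa using hx
    simp [norm_smul, this, smul_smul, h0]
  · have h0 : ∀ x ∈ sphere (0 : E) 1, T x ≠ 0 := fun x hx => by simpa using hne x hx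
    exact ((T.contDiff.contDiffOn.norm ℝ h0).inv fun x hx => norm_ne_zero_iff.2 (h0 x hx)).smul
      T.contDiff.contDiffOn
  · have h0 : ∀ x ∈ sphere (0 : E') 1, T.symm x ≠ 0 := fun x hx h =>
      ne_zero_of_mem_unit_sphere ⟨x, hx⟩ (by simpa using congrArg T h)
    exact ((T.symm.contDiff.contDiffOn.norm ℝ h0).inv
      fun x hx => norm_ne_zero_iff.2 (h0 x hx)).smul T.symm.contDiff.contDiffOn

theorem toSU_mem {A : Matrix (Fin (n + 1)) (Fin (n + 1)) ℂ} (hA : A ∈ u n) : toSU A ∈ su n := by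
  have hA' : Aᴴ = -A := hA
  refine ⟨?_, ?_⟩
  · have htr : star A.trace = -A.trace := by
      rw [← Matrix.trace_conjTranspose, hA', Matrix.trace_neg]
    have htr' : (starRingEnd ℂ) A.trace = -A.trace := htr
    rw [toSU, hermForm, Matrix.fromBlocks_conjTranspose, Matrix.fromBlocks_multiply,
      Matrix.fromBlocks_multiply, Matrix.fromBlocks_add, ← Matrix.fromBlocks_zero]
    congr 1
    · simp [hA']
    · simp
    · simp
    · ext i j; simp [htr']
  · simp [toSU, Matrix.trace, Fintype.sum_sum_type]

theorem toSp_mem {B : Matrix (Fin (n + 1)) (Fin (n + 1)) ℂ} (hB : B ∈ u n) : toSp B ∈ sp n := by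
  have hB' : Bᴴ = -B := hB
  have hneg : toSp (-B) = -toSp B := by
    simp only [toSp, Matrix.fromBlocks_neg]; congr 1
  rw [mem_sp_iff, Matrix.conjTranspose_eq_transpose_of_trivial, ← toSp_conjTranspose, hB', hneg,
    neg_mul, ← toSp_I, ← toSp_mul, ← toSp_mul, mul_smul_comm, smul_mul_assoc, mul_one, one_mul,
    neg_add_cancel]

/-- This is the origin of the shift by the trace: the last coordinate is multiplied by `e^{-t tr
A}`, and dividing by it multiplies the others by `e^{t tr A}`. -/
theorem exp_toSU_mulVec_aff (A : Matrix (Fin (n + 1)) (Fin (n + 1)) ℂ) (t : ℝ)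
    (x : Fin (n + 1) → ℂ) : NormedSpace.exp (t • toSU A) *ᵥ aff x =
      Complex.exp (-(t * A.trace)) •
        aff (NormedSpace.exp (t • (A + A.trace • (1 : Matrix (Fin (n + 1)) (Fin (n + 1)) ℂ))) *ᵥ x) := by
  let T : (Fin (n + 1) → ℂ) →ₗ[ℝ] (Fin (n + 1) ⊕ Unit → ℂ) :=
    { toFun := fun v => Sum.elim v 0
      map_add' := fun v w => by ext (j | j) <;> simp
      map_smul' := fun c v => by ext (j | j) <;> simp }
  have h1 := exp_intertwine (a := A) (b := toSU A) T (fun v => by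
    simp only [T, LinearMap.coe_mk, AddHom.coe_mk, toSU, Matrix.fromBlocks_mulVec]
    ext (j | j) <;> simp) t x
  have h2 := exp_mulVec_eigenvector (a := toSU A) (v := Sum.elim 0 1) (c := -A.trace) (by
    simp only [toSU, Matrix.fromBlocks_mulVec]
    ext (j | j) <;> simp [Matrix.mulVec, dotProduct]) t
  have h3 : ∀ t : ℝ, HasDerivAt (fun s : ℝ => Complex.exp (s * A.trace) •
      (NormedSpace.exp (s • A) *ᵥ x))
      ((A + A.trace • (1 : Matrix (Fin (n + 1)) (Fin (n + 1)) ℂ)) *ᵥ (Complex.exp (t * A.trace) •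
      (NormedSpace.exp (t • A) *ᵥ x))) t := by
    intro t
    have h4 : HasDerivAt (fun s : ℝ => (s : ℂ) * A.trace) A.trace t := by
      simpa using (Complex.ofRealCLM.hasDerivAt (x := t)).mul_const A.trace
    have h5 := h4.cexp.smul (hasDerivAt_exp_mulVec A x t)
    refine h5.congr_deriv ?_
    rw [Matrix.add_mulVec, Matrix.smul_mulVec, Matrix.one_mulVec, Matrix.mulVec_smul, smul_smul,
      mul_comm A.trace]
  have h4 := exp_mulVec_eq_of_hasDerivAt _ h3 t
  simp only [zero_smul, NormedSpace.exp_zero, Matrix.one_mulVec, Complex.ofReal_zero, zero_mul,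
    Complex.exp_zero, one_smul] at h4
  have h5 : aff x = T x + (Sum.elim 0 1 : Fin (n + 1) ⊕ Unit → ℂ) := by ext (j | j) <;> simp [aff, T]
  rw [h4, h5, Matrix.mulVec_add, ← h1, h2]
  ext (j | j)
  · simp only [T, aff, LinearMap.coe_mk, AddHom.coe_mk, Pi.add_apply, Pi.smul_apply, Sum.elim_inl,
      smul_eq_mul, ← mul_assoc, ← Complex.exp_add]
    simp
  · simp [T, aff]

theorem norm_exp_mulVec {A : Matrix (Fin (n + 1)) (Fin (n + 1)) ℂ} (hA : Aᴴ = -A) (t : ℝ)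
    (x : EuclideanSpace ℂ (Fin (n + 1))) :
    ‖(WithLp.toLp 2 (NormedSpace.exp (t • A) *ᵥ x) : EuclideanSpace ℂ (Fin (n + 1)))‖ = ‖x‖ := by
  have h := exp_preserves_form (a := A) (M := 1) (by rw [hA]; simp) t
  rw [mul_one] at h
  have key : ∀ y : EuclideanSpace ℂ (Fin (n + 1)), ((‖y‖ ^ 2 : ℝ) : ℂ) = star (y : _ → ℂ) ⬝ᵥ y := by
    intro y
    rw [EuclideanSpace.norm_sq_eq]
    push_cast
    refine Finset.sum_congr rfl fun i _ => ?_
    rw [Pi.star_apply, Complex.star_def, Complex.conj_mul']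
  have h2 : ‖(WithLp.toLp 2 (NormedSpace.exp (t • A) *ᵥ x) : EuclideanSpace ℂ (Fin (n + 1)))‖ ^ 2
      = ‖x‖ ^ 2 := by
    have : ((‖(WithLp.toLp 2 (NormedSpace.exp (t • A) *ᵥ x) :
        EuclideanSpace ℂ (Fin (n + 1)))‖ ^ 2 : ℝ) : ℂ) = ((‖x‖ ^ 2 : ℝ) : ℂ) := by
      rw [key, key, Matrix.star_mulVec, ← Matrix.dotProduct_mulVec, Matrix.mulVec_mulVec, h,
        Matrix.one_mulVec]
    exact_mod_cast this
  exact (pow_left_inj₀ (norm_nonneg _) (norm_nonneg _) two_ne_zero).1 h2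

theorem add_trace_skew {A : Matrix (Fin (n + 1)) (Fin (n + 1)) ℂ} (hA : A ∈ u n) :
    (A + A.trace • (1 : Matrix (Fin (n + 1)) (Fin (n + 1)) ℂ))ᴴ
      = -(A + A.trace • (1 : Matrix (Fin (n + 1)) (Fin (n + 1)) ℂ)) := by
  have hA' : Aᴴ = -A := hA
  have htr : star A.trace = -A.trace := by
    rw [← Matrix.trace_conjTranspose, hA', Matrix.trace_neg]
  rw [Matrix.conjTranspose_add, Matrix.conjTranspose_smul, hA', htr, Matrix.conjTranspose_one]
  simp [add_comm]

theorem rayFlow_toSU {A : Matrix (Fin (n + 1)) (Fin (n + 1)) ℂ} (hA : A ∈ u n) (t : ℝ)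
    {x : EuclideanSpace ℂ (Fin (n + 1))} (hx : x ∈ sphere 0 1) :
    rayFlow (toSU A) t (suPoint x) = suPoint (WithLp.toLp 2 (NormedSpace.exp
      (t • (A + A.trace • (1 : Matrix (Fin (n + 1)) (Fin (n + 1)) ℂ))) *ᵥ x)) := by
  refine rayFlow_suPoint (toSU_mem hA).1 ?_ (Complex.exp_ne_zero _) (exp_toSU_mulVec_aff A t x)
  rw [mem_sphere_zero_iff_norm, norm_exp_mulVec (add_trace_skew hA)]
  simpa using hx

theorem locallyConjugate_of_realConj {A B : Matrix (Fin (n + 1)) (Fin (n + 1)) ℂ} (hA : A ∈ u n)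
    (hB : B ∈ u n)
    (h : RealConj (A + A.trace • (1 : Matrix (Fin (n + 1)) (Fin (n + 1)) ℂ)) B) :
    LocallyConjugate (toSU A) (toSp B) := by
  obtain ⟨L, hL⟩ := h
  let T : EuclideanSpace ℂ (Fin (n + 1)) ≃L[ℝ] EuclideanSpace ℝ (Fin (n + 1) ⊕ Fin (n + 1)) :=
    ((WithLp.linearEquiv 2 ℝ (Fin (n + 1) → ℂ)).trans ((L.trans (realify n)).trans
      (WithLp.linearEquiv 2 ℝ (Fin (n + 1) ⊕ Fin (n + 1) → ℝ)).symm)).toContinuousLinearEquiv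
  have hT : ∀ x, (T x : _ → ℝ) = realify n (L x) := fun x => rfl
  refine ⟨spPoint ∘ (fun x => ‖T x‖⁻¹ • T x) ∘ suCoord,
    isLocalDiffeoOn_spPoint.comp ((isLocalDiffeoOn_linear T).comp isLocalDiffeoOn_suCoord), ?_⟩
  intro t X hX
  rw [suCone_eq] at hX
  obtain ⟨x, hx, rfl⟩ := hX
  rw [rayFlow_toSU hA t hx]
  simp only [Function.comp, suCoord_suPoint]
  set y : EuclideanSpace ℂ (Fin (n + 1)) := WithLp.toLp 2 (NormedSpace.exp
      (t • (A + A.trace • (1 : Matrix (Fin (n + 1)) (Fin (n + 1)) ℂ))) *ᵥ x) with hy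
  have hys : y ∈ sphere 0 1 := by
    rw [mem_sphere_zero_iff_norm, hy, norm_exp_mulVec (add_trace_skew hA)]
    simpa using hx
  have hint := exp_intertwine (a := A + A.trace • (1 : Matrix (Fin (n + 1)) (Fin (n + 1)) ℂ))
    (b := toSp B) (L.trans (realify n)).toLinearMap (fun v => by
      simp only [LinearEquiv.coe_coe, LinearEquiv.trans_apply]
      rw [hL, toSp_mulVec]) t x
  have hTy : (T y : _ → ℝ) = NormedSpace.exp (t • toSp B) *ᵥ (T x : _ → ℝ) := hint
  have hne : ∀ z ∈ sphere (0 : EuclideanSpace ℂ (Fin (n + 1))) 1, ‖T z‖ ≠ 0 := by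
    intro z hz
    have : z ≠ 0 := ne_zero_of_mem_unit_sphere ⟨z, hz⟩
    simpa using this
  symm
  -- The factor `c` compares the norms of `T x` and `T y`, which may differ since `L` need not be
  -- isometric.
  refine rayFlow_spPoint (toSp_mem hB) ((isLocalDiffeoOn_linear T).1 hys)
    (c := ‖T x‖⁻¹ * ‖T y‖) (mul_ne_zero (inv_ne_zero (hne x hx)) (hne y hys)) ?_
  have h6 : ((‖T x‖⁻¹ • T x : EuclideanSpace ℝ (Fin (n + 1) ⊕ Fin (n + 1))) : _ → ℝ)
    = ‖T x‖⁻¹ • (T x : _ → ℝ) := rfl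
  have h7 : ((‖T y‖⁻¹ • T y : EuclideanSpace ℝ (Fin (n + 1) ⊕ Fin (n + 1))) : _ → ℝ)
    = ‖T y‖⁻¹ • (T y : _ → ℝ) := rfl
  rw [h6, h7, Matrix.mulVec_smul, ← hTy, smul_smul, mul_assoc, mul_inv_cancel₀ (hne y hys), mul_one]

end Linear

/-! ### The equivariant homeomorphism of spheres -/

section Equivariant
open scoped Matrix.Norms.Frobenius
open Metric Module

variable {n : ℕ}

theorem ne_zero_of_mem_sphere' {ι 𝕜 : Type*} [Fintype ι] [RCLike 𝕜] {x : EuclideanSpace 𝕜 ι}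
    (hx : x ∈ sphere 0 1) : (x : ι → 𝕜) ≠ 0 := by
  intro h
  have : x = 0 := by ext i; simpa using congrFun h i
  rw [this] at hx
  simp at hx

/-- The flow of `exp (t a)` on the sphere parametrizing the cone of `su(n+1,1)`. -/
def suFlow {a : Matrix (Fin (n + 1) ⊕ Unit) (Fin (n + 1) ⊕ Unit) ℂ}
    (ha : aᴴ * hermForm n + hermForm n * a = 0) (t : ℝ)
    (x : sphere (0 : EuclideanSpace ℂ (Fin (n + 1))) 1) :
    sphere (0 : EuclideanSpace ℂ (Fin (n + 1))) 1 :=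
  ⟨WithLp.toLp 2 fun j => (NormedSpace.exp (t • a) *ᵥ aff x.1) (Sum.inl j) /
    (NormedSpace.exp (t • a) *ᵥ aff x.1) (Sum.inr ()), by
      obtain ⟨h0, y, hy, h⟩ := exists_flow_su ha t x.2
      convert hy using 1
      ext j
      have hj := congrFun h (Sum.inl j)
      rw [Pi.smul_apply, smul_eq_mul] at hj
      simp only
      rw [hj, mul_div_cancel_left₀ _ h0]
      rfl⟩

theorem suFlow_spec {a : Matrix (Fin (n + 1) ⊕ Unit) (Fin (n + 1) ⊕ Unit) ℂ}
    (ha : aᴴ * hermForm n + hermForm n * a = 0) (t : ℝ)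
    (x : sphere (0 : EuclideanSpace ℂ (Fin (n + 1))) 1) :
    (NormedSpace.exp (t • a) *ᵥ aff x.1) (Sum.inr ()) ≠ 0 ∧
    NormedSpace.exp (t • a) *ᵥ aff x.1 =
      (NormedSpace.exp (t • a) *ᵥ aff x.1) (Sum.inr ()) • aff (suFlow ha t x).1 := by
  obtain ⟨h0, -⟩ := exists_flow_su ha t x.2
  refine ⟨h0, ?_⟩
  ext (j | j)
  · simp [suFlow, aff]
    exact (mul_div_cancel₀ _ h0).symm
  · simp [aff]

theorem continuous_suFlow {a : Matrix (Fin (n + 1) ⊕ Unit) (Fin (n + 1) ⊕ Unit) ℂ}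
    (ha : aᴴ * hermForm n + hermForm n * a = 0)
    (x : sphere (0 : EuclideanSpace ℂ (Fin (n + 1))) 1) : Continuous fun t => suFlow ha t x := by
  refine Continuous.subtype_mk ((contDiff_toLp (𝕜 := ℂ)).continuous.comp
    (continuous_pi fun j => ?_)) _
  have h := continuous_pi_iff.1 (continuous_exp_mulVec a (aff x.1))
  exact (h _).div (h _) fun t => (exists_flow_su ha t x.2).1

theorem suFlow_eq {a : Matrix (Fin (n + 1) ⊕ Unit) (Fin (n + 1) ⊕ Unit) ℂ}
    (ha : aᴴ * hermForm n + hermForm n * a = 0) {t : ℝ}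
    {x y : sphere (0 : EuclideanSpace ℂ (Fin (n + 1))) 1} {c : ℂ}
    (h : NormedSpace.exp (t • a) *ᵥ aff x.1 = c • aff y.1) : suFlow ha t x = y := by
  have hc : c ≠ 0 := by
    rintro rfl
    apply (exists_flow_su ha t x.2).1
    rw [h]; simp
  ext j
  simp only [suFlow]
  rw [h]
  simp [aff, hc]

/-- The flow of `exp (t a)` on the sphere which covers the cone of `sp(n+1,ℝ)`. -/
def spFlow (a : Matrix (Fin (n + 1) ⊕ Fin (n + 1)) (Fin (n + 1) ⊕ Fin (n + 1)) ℝ) (t : ℝ)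
    (v : sphere (0 : EuclideanSpace ℝ (Fin (n + 1) ⊕ Fin (n + 1))) 1) :
    sphere (0 : EuclideanSpace ℝ (Fin (n + 1) ⊕ Fin (n + 1))) 1 :=
  unitVec (WithLp.toLp 2 (NormedSpace.exp (t • a) *ᵥ v.1)) fun h =>
    exp_mulVec_ne_zero a t (ne_zero_of_mem_sphere' v.2) (congrArg WithLp.ofLp h)

theorem spFlow_spec (a : Matrix (Fin (n + 1) ⊕ Fin (n + 1)) (Fin (n + 1) ⊕ Fin (n + 1)) ℝ) (t : ℝ)
    (v : sphere (0 : EuclideanSpace ℝ (Fin (n + 1) ⊕ Fin (n + 1))) 1) :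
    ∃ c : ℝ, 0 < c ∧ NormedSpace.exp (t • a) *ᵥ v.1 = c • ((spFlow a t v).1 : _ → ℝ) := by
  have h : (WithLp.toLp 2 (NormedSpace.exp (t • a) *ᵥ v.1) : EuclideanSpace ℝ _) ≠ 0 := fun h =>
    exp_mulVec_ne_zero a t (ne_zero_of_mem_sphere' v.2) (congrArg WithLp.ofLp h)
  refine ⟨_, norm_pos_iff.2 h, ?_⟩
  have h1 := norm_ne_zero_iff.2 h
  simp [spFlow, unitVec, smul_smul, h1]

theorem spFlow_neg (a : Matrix (Fin (n + 1) ⊕ Fin (n + 1)) (Fin (n + 1) ⊕ Fin (n + 1)) ℝ) (t : ℝ)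
    (v : sphere (0 : EuclideanSpace ℝ (Fin (n + 1) ⊕ Fin (n + 1))) 1) :
    spFlow a t (-v) = -spFlow a t v := by
  ext i
  simp [spFlow, unitVec, Matrix.mulVec_neg]

theorem continuous_spFlow (a : Matrix (Fin (n + 1) ⊕ Fin (n + 1)) (Fin (n + 1) ⊕ Fin (n + 1)) ℝ)
    (v : sphere (0 : EuclideanSpace ℝ (Fin (n + 1) ⊕ Fin (n + 1))) 1) :
    Continuous fun t => spFlow a t v := by
  have h : ∀ t : ℝ, (WithLp.toLp 2 (NormedSpace.exp (t • a) *ᵥ v.1) : EuclideanSpace ℝ _) ≠ 0 :=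
    fun t h => exp_mulVec_ne_zero a t (ne_zero_of_mem_sphere' v.2) (congrArg WithLp.ofLp h)
  have h1 : Continuous fun t : ℝ =>
      (WithLp.toLp 2 (NormedSpace.exp (t • a) *ᵥ v.1) : EuclideanSpace ℝ _) :=
    (contDiff_toLp (𝕜 := ℝ)).continuous.comp (continuous_exp_mulVec a v.1)
  exact Continuous.subtype_mk ((h1.norm.inv₀ fun t => norm_ne_zero_iff.2 (h t)).smul h1) _

/-- The hypothesis `1 ≤ n` enters here: the spheres must have dimension at least two to be simply
connected. Equivariance of `F` follows from unique lifting, since the image of an orbit and the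
orbit of the image lie over the same curve in the cone and start at the same point. -/
theorem LocallyConjugate.exists_homeomorph (hn : 1 ≤ n)
    {a₁ : Matrix (Fin (n + 1) ⊕ Unit) (Fin (n + 1) ⊕ Unit) ℂ}
    {a₂ : Matrix (Fin (n + 1) ⊕ Fin (n + 1)) (Fin (n + 1) ⊕ Fin (n + 1)) ℝ}
    (h : LocallyConjugate a₁ a₂) (ha₁ : a₁ᴴ * hermForm n + hermForm n * a₁ = 0)
    (ha₂ : a₂ ∈ sp n) :
    ∃ F : sphere (0 : EuclideanSpace ℂ (Fin (n + 1))) 1 ≃ₜ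
        sphere (0 : EuclideanSpace ℝ (Fin (n + 1) ⊕ Fin (n + 1))) 1,
      (∀ t x, F (suFlow ha₁ t x) = spFlow a₂ t (F x)) ∧
      (∀ x ≠ 0, DifferentiableAt ℝ (radialExt F) x) ∧
      (∀ x ≠ 0, DifferentiableAt ℝ (radialExt F.symm) x) := by
  obtain ⟨f, hf, hft⟩ := h
  have hE : 3 ≤ finrank ℝ (EuclideanSpace ℂ (Fin (n + 1))) := by
    rw [finrank_real_of_complex, finrank_euclideanSpace_fin]; omega
  have hE' : 3 ≤ finrank ℝ (EuclideanSpace ℝ (Fin (n + 1) ⊕ Fin (n + 1))) := by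
    rw [finrank_euclideanSpace]; simp; omega
  obtain ⟨F, hF, hd, hd'⟩ := exists_homeomorph_of_localDiffeo hE hE'
    (hf.comp isLocalDiffeoOn_suPoint) isLocalDiffeoOn_spPoint
    (by rw [spCone_eq]; exact Set.surjOn_image _ _)
  refine ⟨F, fun t x => ?_, hd, hd'⟩
  refine isLocalDiffeoOn_spPoint.curve_eq (F.continuous.comp (continuous_suFlow ha₁ x))
    (continuous_spFlow a₂ (F x)) (fun t => ?_) ?_ t
  · obtain ⟨c, hc, h⟩ := spFlow_spec a₂ t (F x)
    rw [← rayFlow_spPoint ha₂ (spFlow a₂ t (F x)).2 hc.ne' h]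
    simp only [Function.comp] at hF ⊢
    rw [hF, hF, ← hft t _ (suPoint_mem x.2)]
    obtain ⟨h0, h1⟩ := suFlow_spec ha₁ t x
    rw [rayFlow_suPoint ha₁ (suFlow ha₁ t x).2 h0 h1]
  · have h1 : suFlow ha₁ 0 x = x := suFlow_eq ha₁ (c := 1) (by simp)
    simp only [Function.comp, h1]
    ext i
    have h2 : ‖(F x).1‖ = 1 := by simp
    simp [spFlow, unitVec]

end Equivariant

/-! ### Ellipticity of `a₁` -/

section Elliptic
open scoped Matrix.Norms.Frobenius
open Metric Module Filter Topology

variable {n : ℕ}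

theorem hform_add_right (z w w' : Fin (n + 1) ⊕ Unit → ℂ) :
    hform z (w + w') = hform z w + hform z w' := by
  rw [hform, Matrix.mulVec_add, dotProduct_add]; rfl

theorem hform_smul_right (c : ℂ) (z w : Fin (n + 1) ⊕ Unit → ℂ) :
    hform z (c • w) = c * hform z w := by
  rw [hform, Matrix.mulVec_smul, dotProduct_smul]; rfl

theorem star_hform (z w : Fin (n + 1) ⊕ Unit → ℂ) : star (hform z w) = hform w z := by
  rw [hform_eq, hform_eq, star_sub, star_sum]
  simp only [star_mul', star_star]
  congr 1
  · exact Finset.sum_congr rfl fun i _ => mul_comm _ _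
  · exact mul_comm _ _

theorem hform_add_left (z z' w : Fin (n + 1) ⊕ Unit → ℂ) :
    hform (z + z') w = hform z w + hform z' w := by
  rw [← star_hform, hform_add_right, star_add, star_hform, star_hform]

theorem hform_smul_left (c : ℂ) (z w : Fin (n + 1) ⊕ Unit → ℂ) :
    hform (c • z) w = star c * hform z w := by
  rw [← star_hform, hform_smul_right, star_mul', star_hform]

theorem hform_mulVec_left {a : Matrix (Fin (n + 1) ⊕ Unit) (Fin (n + 1) ⊕ Unit) ℂ}
    (ha : aᴴ * hermForm n + hermForm n * a = 0) (z w : Fin (n + 1) ⊕ Unit → ℂ) :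
    hform (a *ᵥ z) w = -hform z (a *ᵥ w) := by
  rw [hform, hform, Matrix.star_mulVec, ← Matrix.dotProduct_mulVec, Matrix.mulVec_mulVec,
    Matrix.mulVec_mulVec, eq_neg_of_add_eq_zero_left ha, Matrix.neg_mulVec, dotProduct_neg]

/-- Induction over invariant subspaces containing a nonzero vector `v` of nonpositive form. If an
eigenvector `z` found in `W` is positive, its orthogonal complement in `W` is invariant and strictly
smaller, and it still contains such a vector: removing the component of `v` along `z` only lowers
the form. -/
theorem exists_nonpos_eigenvector_of_submodule
    {a : Matrix (Fin (n + 1) ⊕ Unit) (Fin (n + 1) ⊕ Unit) ℂ}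
    (ha : aᴴ * hermForm n + hermForm n * a = 0) (d : ℕ) :
    ∀ W : Submodule ℂ (Fin (n + 1) ⊕ Unit → ℂ), finrank ℂ W ≤ d → (∀ w ∈ W, a *ᵥ w ∈ W) →
      (∃ v ∈ W, v ≠ 0 ∧ (hform v v).re ≤ 0) →
      ∃ z, z ≠ 0 ∧ (hform z z).re ≤ 0 ∧ ∃ c : ℂ, a *ᵥ z = c • z := by
  induction d with
  | zero =>
    rintro W hd - ⟨v, hv, hv0, -⟩
    rw [Submodule.finrank_eq_zero.1 (Nat.le_zero.1 hd)] at hv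
    exact absurd hv hv0
  | succ d ih =>
    rintro W hd hW ⟨v, hv, hv0, hvv⟩
    have : Nontrivial W := ⟨⟨⟨v, hv⟩, 0, fun h => hv0 (congrArg Subtype.val h)⟩⟩
    obtain ⟨c, hc⟩ := Module.End.exists_eigenvalue
      (a.mulVecLin.restrict (p := W) (q := W) hW)
    obtain ⟨⟨z, hzW⟩, hz⟩ := hc.exists_hasEigenvector
    have hz0 : z ≠ 0 := fun h => hz.2 (Subtype.ext h)
    have hza : a *ᵥ z = c • z := congrArg Subtype.val hz.apply_eq_smul
    by_cases hzz : (hform z z).re ≤ 0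
    · exact ⟨z, hz0, hzz, c, hza⟩
    push Not at hzz
    have hzz0 : hform z z ≠ 0 := fun h => by rw [h] at hzz; simp at hzz
    let φ : (Fin (n + 1) ⊕ Unit → ℂ) →ₗ[ℂ] ℂ :=
      { toFun := hform z
        map_add' := hform_add_right z
        map_smul' := fun c w => hform_smul_right c z w }
    let W' : Submodule ℂ (Fin (n + 1) ⊕ Unit → ℂ) := W ⊓ LinearMap.ker φ
    have hlt : W' < W := by
      refine lt_of_le_of_ne inf_le_left fun h => hzz0 ?_
      have : z ∈ W' := h ▸ hzW
      exact this.2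
    refine ih W' (by have := Submodule.finrank_lt_finrank_of_lt hlt; omega) ?_ ?_
    · rintro w ⟨hw, hw'⟩
      refine ⟨hW w hw, ?_⟩
      have h1 : hform z w = 0 := hw'
      have h2 := hform_mulVec_left ha z w
      rw [hza, hform_smul_left, h1, mul_zero] at h2
      exact neg_eq_zero.1 h2.symm
    · set k := hform z v / hform z z with hk
      have h1 : hform z (v + (-k) • z) = 0 := by
        rw [hform_add_right, hform_smul_right, hk]; field_simp; ring
      have h2 : hform (v + (-k) • z) (v + (-k) • z) = hform v v - star k * k * hform z z := by
        have h3 : hform z v = k * hform z z := by rw [hk]; field_simp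
        have h4 : hform v (v + (-k) • z) = hform v v - star k * k * hform z z := by
          rw [hform_add_right, hform_smul_right, ← star_hform z v, h3, star_mul', star_hform]
          ring
        rw [hform_add_left, hform_smul_left, h1, mul_zero, add_zero, h4]
      have h3 : star k * k * hform z z = ((‖k‖ ^ 2 * (hform z z).re : ℝ) : ℂ) := by
        rw [Complex.star_def, Complex.conj_mul', hform_self, Complex.ofReal_re]
        push_cast; rfl
      refine ⟨v + (-k) • z, ⟨W.add_mem hv (W.smul_mem _ hzW), h1⟩, fun h => ?_, ?_⟩
      -- If the projection vanished, `v` would be a nonzero multiple of the positive vector `z`.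
      · have h4 : v = k • z := by rw [neg_smul, ← sub_eq_add_neg, sub_eq_zero] at h; exact h
        have hk0 : k ≠ 0 := by rintro h5; rw [h5, zero_smul] at h4; exact hv0 h4
        have h5 : hform v v = star k * k * hform z z := by
          conv_lhs => rw [h4]
          rw [hform_smul_left, hform_smul_right, mul_assoc]
        rw [h5, h3, Complex.ofReal_re] at hvv
        have := norm_pos_iff.2 hk0
        have : 0 < ‖k‖ ^ 2 * (hform z z).re := by positivity
        linarith
      · rw [h2, h3, Complex.sub_re, Complex.ofReal_re]
        have : 0 ≤ ‖k‖ ^ 2 * (hform z z).re := by positivity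
        linarith

theorem exists_nonpos_eigenvector {a : Matrix (Fin (n + 1) ⊕ Unit) (Fin (n + 1) ⊕ Unit) ℂ}
    (ha : aᴴ * hermForm n + hermForm n * a = 0) :
    ∃ z, z ≠ 0 ∧ (hform z z).re ≤ 0 ∧ ∃ c : ℂ, a *ᵥ z = c • z := by
  refine exists_nonpos_eigenvector_of_submodule ha _ ⊤ le_rfl (fun _ _ => trivial)
    ⟨Sum.elim 0 1, trivial, fun h => by simpa using congrFun h (Sum.inr ()), ?_⟩
  rw [hform_self]; simp

/-- A matrix preserving the Hermitian form is a scalar multiple of one of determinant one. -/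
theorem exists_smul_mem_SU {g : Matrix (Fin (n + 1) ⊕ Unit) (Fin (n + 1) ⊕ Unit) ℂ}
    (hg : gᴴ * hermForm n * g = hermForm n) : ∃ c : ℂ, c ≠ 0 ∧ c • g ∈ SU n := by
  have hH : (hermForm n).det ≠ 0 := by
    intro h
    have := congrArg Matrix.det (hermForm_mul_self (n := n))
    rw [Matrix.det_mul, h, zero_mul, Matrix.det_one] at this
    exact zero_ne_one this
  have hd : star g.det * g.det = 1 := by
    have := congrArg Matrix.det hg
    rw [Matrix.det_mul, Matrix.det_mul, Matrix.det_conjTranspose, mul_right_comm] at this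
    exact mul_right_cancel₀ hH (this.trans (one_mul _).symm)
  have hn : ‖g.det‖ = 1 := by
    rw [Complex.star_def, Complex.conj_mul'] at hd
    have h2 : ‖g.det‖ ^ 2 = 1 := by exact_mod_cast hd
    exact (pow_eq_one_iff_of_nonneg (norm_nonneg _) two_ne_zero).1 h2
  obtain ⟨c, hc, hcw⟩ := exists_pow_eq_of_norm_eq_one (w := star g.det) (k := n + 1 + 1)
    (by simp [hn]) (by omega)
  refine ⟨c, fun h => by simp [h] at hc, ?_, ?_⟩
  · rw [Matrix.conjTranspose_smul, Matrix.smul_mul, Matrix.smul_mul, Matrix.mul_smul, hg, smul_smul,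
      Complex.star_def, Complex.conj_mul', hc]
    simp
  · rw [Matrix.det_smul, Fintype.card_sum, Fintype.card_fin, Fintype.card_unit, hcw, hd]

/-- The pure boost, with blocks `1 + k x xᴴ`, `x`, `xᴴ`, `s`. It shows that vectors of form `-1`
with positive last coordinate are images of the last basis vector. -/
theorem exists_boost {x : Fin (n + 1) → ℂ} {s : ℝ} (hs : 0 < s) (hx : s ^ 2 = 1 + ∑ i, ‖x i‖ ^ 2) :
    ∃ g : Matrix (Fin (n + 1) ⊕ Unit) (Fin (n + 1) ⊕ Unit) ℂ,
      gᴴ * hermForm n * g = hermForm n ∧ g *ᵥ Sum.elim 0 1 = Sum.elim x (fun _ => (s : ℂ)) := by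
  have hxx : star x ⬝ᵥ x = (s : ℂ) ^ 2 - 1 := by
    rw [eq_sub_iff_add_eq, add_comm]
    have : ((s ^ 2 : ℝ) : ℂ) = ((1 + ∑ i, ‖x i‖ ^ 2 : ℝ) : ℂ) := by rw [hx]
    push_cast at this
    rw [this, dotProduct]
    congr 1
    exact Finset.sum_congr rfl fun i _ => by
      rw [Pi.star_apply, Complex.star_def, Complex.conj_mul']
  have hs1 : (1 + s : ℂ) ≠ 0 := by
    have : (1 + s : ℝ) ≠ 0 := by positivity
    exact_mod_cast this
  -- With this `k` the upper left block squares to `1 + x xᴴ`, because `xᴴ x = s² - 1`.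
  let k : ℂ := (1 + s : ℂ)⁻¹
  let V : Matrix (Fin (n + 1)) (Fin (n + 1)) ℂ := Matrix.vecMulVec x (star x)
  let C : Matrix (Fin (n + 1)) Unit ℂ := Matrix.replicateCol Unit x
  let R : Matrix Unit (Fin (n + 1)) ℂ := Matrix.replicateRow Unit (star x)
  have hkstar : star k = k := by simp [k]
  have hV : Vᴴ = V := by ext i j; simp [V, Matrix.vecMulVec_apply, mul_comm]
  have hC : Cᴴ = R := by ext i j; simp [C, R]
  have hR : Rᴴ = C := by ext i j; simp [C, R]
  have hVV : V * V = ((s : ℂ) ^ 2 - 1) • V := by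
    rw [← hxx]
    simp only [V]
    rw [Matrix.vecMulVec_mul_vecMulVec]
    ext i j
    simp [Matrix.vecMulVec_apply, mul_left_comm]
  have hCR : C * R = V := by ext i j; simp [C, R, V, Matrix.mul_apply, Matrix.vecMulVec_apply]
  have hRC : R * C = (((s : ℂ) ^ 2 - 1)) • 1 := by
    rw [← hxx]
    ext i j; simp [C, R, Matrix.mul_apply, dotProduct]
  have hVC : V * C = ((s : ℂ) ^ 2 - 1) • C := by
    rw [← hCR, Matrix.mul_assoc, hRC, Matrix.mul_smul, Matrix.mul_one]
  have hRV : R * V = ((s : ℂ) ^ 2 - 1) • R := by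
    rw [← hCR, ← Matrix.mul_assoc, hRC, Matrix.smul_mul, Matrix.one_mul]
  have hk : k * (1 + s) = 1 := inv_mul_cancel₀ hs1
  refine ⟨Matrix.fromBlocks (1 + k • V) C R ((s : ℂ) • 1), ?_, ?_⟩
  · have hst : star (s : ℂ) = s := Complex.conj_ofReal s
    rw [Matrix.fromBlocks_conjTranspose, hermForm, Matrix.fromBlocks_multiply,
      Matrix.fromBlocks_multiply, hR, hC, Matrix.conjTranspose_add, Matrix.conjTranspose_smul,
      Matrix.conjTranspose_smul, hV, hkstar, hst, Matrix.conjTranspose_one, Matrix.conjTranspose_one]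
    congr 1
    · simp only [Matrix.mul_one, Matrix.mul_zero, add_zero, zero_add, Matrix.mul_neg, Matrix.neg_mul,
        Matrix.add_mul, Matrix.mul_add, Matrix.one_mul, Matrix.smul_mul, Matrix.mul_smul, smul_smul, hCR, hVV]
      have : k + k + k * k * (s ^ 2 - 1) - 1 = 0 := by
        linear_combination (k * (s - 1) + 1) * hk
      have h2 : (k + k + k * k * ((s : ℂ) ^ 2 - 1) - 1) • V = 0 := by rw [this, zero_smul]
      rw [sub_smul, add_smul, add_smul, one_smul] at h2
      have h3 : (1 : Matrix (Fin (n + 1)) (Fin (n + 1)) ℂ) + k • V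
          + (k • V + (k * (k * ((s : ℂ) ^ 2 - 1))) • V) + -V
          = 1 + (k • V + k • V + (k * k * ((s : ℂ) ^ 2 - 1)) • V - V) := by
        rw [mul_assoc]; abel
      rw [smul_add, smul_smul, h3, h2, add_zero]
    · simp only [Matrix.mul_one, Matrix.mul_zero, add_zero, zero_add, Matrix.mul_neg,
        Matrix.add_mul, Matrix.one_mul, Matrix.smul_mul, Matrix.mul_smul, smul_smul, hVC]
      have : 1 + k * ((s : ℂ) ^ 2 - 1) - s = 0 := by linear_combination (s - 1 : ℂ) * hk
      have h2 : (1 + k * ((s : ℂ) ^ 2 - 1) - s) • C = 0 := by rw [this, zero_smul]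
      rw [sub_smul, add_smul, one_smul] at h2
      rw [smul_neg, ← sub_eq_add_neg]; exact h2
    · simp only [Matrix.mul_one, Matrix.mul_zero, add_zero, zero_add, Matrix.mul_neg, Matrix.neg_mul,
        Matrix.mul_add, Matrix.one_mul, Matrix.smul_mul, Matrix.mul_smul, smul_smul, hRV]
      have : 1 + k * ((s : ℂ) ^ 2 - 1) - s = 0 := by linear_combination (s - 1 : ℂ) * hk
      have h2 : (1 + k * ((s : ℂ) ^ 2 - 1) - s) • R = 0 := by rw [this, zero_smul]
      rw [sub_smul, add_smul, one_smul] at h2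
      rw [← sub_eq_add_neg]; exact h2
    · simp only [Matrix.mul_one, Matrix.mul_zero, add_zero, zero_add, Matrix.mul_neg,
        Matrix.mul_smul, smul_smul, hRC, smul_neg]
      rw [← sub_eq_add_neg, ← sub_smul, sq, sub_sub_cancel_left, neg_smul, one_smul]
  · rw [Matrix.fromBlocks_mulVec]
    ext (i | i) <;> simp [C, Matrix.mulVec, dotProduct]

theorem conj_mem_su {a : Matrix (Fin (n + 1) ⊕ Unit) (Fin (n + 1) ⊕ Unit) ℂ} (ha : a ∈ su n)
    {g : Matrix (Fin (n + 1) ⊕ Unit) (Fin (n + 1) ⊕ Unit) ℂ} (hg : g ∈ SU n) :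
    g * a * g⁻¹ ∈ su n := by
  have hi := (SU_inv hg).1
  have hgg := SU_inv_mul hg
  have h1 : g * g⁻¹ = 1 := mul_eq_one_comm.1 hgg
  have h2 : hermForm n * g = (g⁻¹)ᴴ * hermForm n := by
    conv_lhs => rw [← hi]
    rw [mul_assoc, hgg, mul_one]
  have h3 : gᴴ * hermForm n = hermForm n * g⁻¹ := by
    have := congrArg Matrix.conjTranspose h2
    have hH : (hermForm n)ᴴ = hermForm n := by simp [hermForm, Matrix.fromBlocks_conjTranspose]
    simpa [Matrix.conjTranspose_mul, hH] using this
  refine ⟨?_, ?_⟩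
  · calc (g * a * g⁻¹)ᴴ * hermForm n + hermForm n * (g * a * g⁻¹)
        = (g⁻¹)ᴴ * aᴴ * (gᴴ * hermForm n) + hermForm n * g * a * g⁻¹ := by
          rw [Matrix.conjTranspose_mul, Matrix.conjTranspose_mul]; simp only [mul_assoc]
      _ = (g⁻¹)ᴴ * (aᴴ * hermForm n + hermForm n * a) * g⁻¹ := by
          rw [h2, h3]; noncomm_ring
      _ = 0 := by rw [ha.1]; simp
  · rw [Matrix.trace_mul_comm, ← mul_assoc, hgg, one_mul]; exact ha.2

/-- The eigenvector equation kills the upper right block, skewness the lower left one, and the trace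
condition determines the corner. -/
theorem exists_toSU_of_eigenvector {b : Matrix (Fin (n + 1) ⊕ Unit) (Fin (n + 1) ⊕ Unit) ℂ}
    (hb : b ∈ su n) {c : ℂ} (h : b *ᵥ Sum.elim 0 1 = c • (Sum.elim 0 1 : Fin (n + 1) ⊕ Unit → ℂ)) :
    ∃ A ∈ u n, b = toSU A := by
  obtain ⟨A, B, C, D, rfl⟩ : ∃ A B C D, b = Matrix.fromBlocks A B C D :=
    ⟨_, _, _, _, (Matrix.fromBlocks_toBlocks b).symm⟩
  have hB : B = 0 := by
    ext i j
    have := congrFun h (Sum.inl i)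
    rw [Matrix.fromBlocks_mulVec] at this
    simpa [Matrix.mulVec, dotProduct] using this
  obtain ⟨h1, h2⟩ := hb
  rw [hermForm, Matrix.fromBlocks_conjTranspose, Matrix.fromBlocks_multiply,
    Matrix.fromBlocks_multiply, Matrix.fromBlocks_add, ← Matrix.fromBlocks_zero,
    Matrix.fromBlocks_inj] at h1
  obtain ⟨h11, h12, h21, h22⟩ := h1
  refine ⟨A, ?_, ?_⟩
  · have : Aᴴ + A = 0 := by simpa using h11
    exact eq_neg_of_add_eq_zero_left this
  · have hC : C = 0 := by simpa [hB] using h21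
    rw [toSU, hB, hC]
    congr 1
    ext i j
    have : A.trace + D () () = 0 := by
      simpa [Matrix.trace, Fintype.sum_sum_type] using h2
    simpa using eq_neg_of_add_eq_zero_right this

/-- A boost moves the negative eigenline to the last coordinate axis, and elements of `su(n+1,1)`
preserving that axis are block diagonal. -/
theorem adConj_toSU_of_negative_eigenvector
    {a : Matrix (Fin (n + 1) ⊕ Unit) (Fin (n + 1) ⊕ Unit) ℂ} (ha : a ∈ su n)
    {z : Fin (n + 1) ⊕ Unit → ℂ} (hz : (hform z z).re < 0) {c : ℂ} (h : a *ᵥ z = c • z) :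
    ∃ A ∈ u n, AdConj (SU n) a (toSU A) := by
  rw [hform_self, Complex.ofReal_re] at hz
  set r : ℝ := ‖z (Sum.inr ())‖ ^ 2 - ∑ j, ‖z (Sum.inl j)‖ ^ 2 with hr
  have hr0 : 0 < r := by linarith
  have hsum : 0 ≤ ∑ j, ‖z (Sum.inl j)‖ ^ 2 := Finset.sum_nonneg fun _ _ => sq_nonneg _
  have hz0 : z (Sum.inr ()) ≠ 0 := by
    intro h0; rw [h0, norm_zero] at hr; nlinarith
  have hzn : 0 < ‖z (Sum.inr ())‖ := norm_pos_iff.2 hz0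
  have hsq : Real.sqrt r ^ 2 = r := Real.sq_sqrt hr0.le
  have hsr : 0 < Real.sqrt r := Real.sqrt_pos.2 hr0
  -- The multiple `k • z` has form `-1` and positive last coordinate `s`.
  let s : ℝ := ‖z (Sum.inr ())‖ / Real.sqrt r
  let k : ℂ := (s : ℂ) / z (Sum.inr ())
  have hkn : ‖k‖ ^ 2 = r⁻¹ := by
    have hs0 : 0 ≤ s := by positivity
    simp only [k, norm_div, Complex.norm_real, Real.norm_eq_abs, abs_of_nonneg hs0]
    simp only [s]
    rw [div_div, mul_comm, ← div_div, div_self hzn.ne', div_pow, hsq, one_pow, one_div]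
  obtain ⟨g, hg, hge⟩ := exists_boost (x := fun j => k * z (Sum.inl j)) (s := s) (by positivity) (by
    simp only [norm_mul, mul_pow, hkn]
    rw [← Finset.mul_sum]
    simp only [s, div_pow, hsq]
    field_simp
    rw [hr]; ring)
  have hgz : g *ᵥ Sum.elim 0 1 = k • z := by
    rw [hge]
    ext (j | j)
    · simp
    · simp [k, hz0]
  obtain ⟨ζ, hζ, hgS⟩ := exists_smul_mem_SU hg
  have hi := SU_inv hgS
  have hgg := SU_inv_mul hgS
  have h1 : (ζ • g)⁻¹⁻¹ = ζ • g := Matrix.nonsing_inv_nonsing_inv _ (by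
    rw [hgS.2]; exact isUnit_one)
  obtain ⟨A, hA, hb⟩ := exists_toSU_of_eigenvector (conj_mem_su ha hi) (c := c) (by
    have h2 : a *ᵥ ((ζ • g) *ᵥ Sum.elim 0 1) = c • ((ζ • g) *ᵥ Sum.elim 0 1) := by
      rw [Matrix.smul_mulVec, hgz, Matrix.mulVec_smul, Matrix.mulVec_smul, h, smul_comm k c,
        smul_comm ζ c]
    rw [h1, ← Matrix.mulVec_mulVec, ← Matrix.mulVec_mulVec, h2, Matrix.mulVec_smul,
      Matrix.mulVec_mulVec, hgg, Matrix.one_mulVec])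
  exact ⟨A, hA, (ζ • g)⁻¹, hi, hb⟩

theorem inner_eq_hform_aff (x y : EuclideanSpace ℂ (Fin (n + 1))) :
    hform (aff x) (aff y) = inner ℂ x y - 1 := by
  rw [hform_eq, EuclideanSpace.inner_eq_star_dotProduct, dotProduct_comm]
  simp [aff, dotProduct]

/-- The form is the inner product minus one, and unit vectors with inner product one coincide. -/
theorem hform_aff_ne_zero {x y : sphere (0 : EuclideanSpace ℂ (Fin (n + 1))) 1} (h : x ≠ y) :
    hform (aff x.1) (aff y.1) ≠ 0 := by
  rw [inner_eq_hform_aff, sub_ne_zero]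
  intro h1
  exact h (Subtype.ext ((inner_eq_one_iff_of_norm_eq_one (by simp) (by simp)).1 h1))

/-- Distinct null lines span a hyperbolic plane, which here consists of eigenvectors and contains a
negative one; with the coefficient `-star k` the form takes the value `-2 ‖k‖²`. -/
theorem adConj_toSU_of_two_null_eigenvectors
    {a : Matrix (Fin (n + 1) ⊕ Unit) (Fin (n + 1) ⊕ Unit) ℂ} (ha : a ∈ su n)
    {p q : sphere (0 : EuclideanSpace ℂ (Fin (n + 1))) 1} (hpq : p ≠ q) {c : ℂ}
    (hp : a *ᵥ aff p.1 = c • aff p.1) (hq : a *ᵥ aff q.1 = c • aff q.1) :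
    ∃ A ∈ u n, AdConj (SU n) a (toSU A) := by
  have h0 := hform_aff_ne_zero hpq
  set k := hform (aff p.1) (aff q.1) with hk
  refine adConj_toSU_of_negative_eigenvector ha (z := aff p.1 + (-star k) • aff q.1) ?_ (c := c) ?_
  · have h1 : hform (aff p.1 + (-star k) • aff q.1) (aff p.1 + (-star k) • aff q.1)
        = ((-(2 * ‖k‖ ^ 2) : ℝ) : ℂ) := by
      have hkk : star k * k = ((‖k‖ ^ 2 : ℝ) : ℂ) := by
        rw [Complex.star_def, Complex.conj_mul']; push_cast; rfl
      rw [hform_add_right, hform_add_left, hform_smul_right, hform_add_left, hform_smul_left,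
        hform_smul_left, hform_aff p.2, hform_aff q.2, ← hk, ← star_hform (aff p.1), ← hk, star_neg,
        star_star]
      push_cast at hkk ⊢
      linear_combination (-2) * hkk
    rw [h1, Complex.ofReal_re]
    have := norm_pos_iff.2 h0
    have : 0 < ‖k‖ ^ 2 := by positivity
    linarith
  · rw [Matrix.mulVec_add, Matrix.mulVec_smul, hp, hq, smul_add, smul_comm]

theorem eigenvalue_of_two_null_eigenvectors
    {a : Matrix (Fin (n + 1) ⊕ Unit) (Fin (n + 1) ⊕ Unit) ℂ}
    (ha : aᴴ * hermForm n + hermForm n * a = 0)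
    {p q : sphere (0 : EuclideanSpace ℂ (Fin (n + 1))) 1} (hpq : p ≠ q) {c d : ℂ}
    (hp : a *ᵥ aff p.1 = c • aff p.1) (hq : a *ᵥ aff q.1 = d • aff q.1) : d = -star c := by
  have h := hform_mulVec_left ha (aff p.1) (aff q.1)
  rw [hp, hq, hform_smul_left, hform_smul_right, ← neg_mul] at h
  rw [mul_right_cancel₀ (hform_aff_ne_zero hpq) h, neg_neg]

/-- North-south dynamics. Invariance of the form makes its values at (`p`, moving point) and (`q`,
moving point) have a ratio decaying like `exp (-t (c.re - d.re))`. The second value is at most `2`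
in norm, so the first tends to zero, and the squared distance to `p` is `-2` times its real part. -/
theorem tendsto_suFlow {a : Matrix (Fin (n + 1) ⊕ Unit) (Fin (n + 1) ⊕ Unit) ℂ}
    (ha : aᴴ * hermForm n + hermForm n * a = 0)
    {p q x : sphere (0 : EuclideanSpace ℂ (Fin (n + 1))) 1} (hxq : x ≠ q) {c d : ℂ}
    (hp : a *ᵥ aff p.1 = c • aff p.1) (hq : a *ᵥ aff q.1 = d • aff q.1) (hcd : d.re < c.re) :
    Tendsto (fun t => suFlow ha t x) atTop (𝓝 p) := by
  have key : ∀ (y : sphere (0 : EuclideanSpace ℂ (Fin (n + 1))) 1) (e : ℂ),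
      a *ᵥ aff y.1 = e • aff y.1 → ∀ t : ℝ, Real.exp (t * e.re) *
        ‖(NormedSpace.exp (t • a) *ᵥ aff x.1) (Sum.inr ())‖ *
          ‖hform (aff y.1) (aff (suFlow ha t x).1)‖ = ‖hform (aff y.1) (aff x.1)‖ := by
    intro y e hy t
    have h1 := hform_mulVec (exp_preserves_form ha t) (aff y.1) (aff x.1)
    rw [exp_mulVec_eigenvector hy, (suFlow_spec ha t x).2, hform_smul_left, hform_smul_right] at h1
    rw [← h1, norm_mul, norm_mul, norm_star, Complex.norm_exp, mul_assoc]
    simp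
  have hqx : 0 < ‖hform (aff q.1) (aff x.1)‖ := norm_pos_iff.2 (hform_aff_ne_zero hxq.symm)
  have hbd : ∀ t, ‖hform (aff q.1) (aff (suFlow ha t x).1)‖ ≤ 2 := by
    intro t
    rw [inner_eq_hform_aff]
    refine (norm_sub_le _ _).trans ?_
    have := norm_inner_le_norm (𝕜 := ℂ) q.1 (suFlow ha t x).1
    simp at this ⊢
    linarith
  set K := ‖hform (aff p.1) (aff x.1)‖ * 2 / ‖hform (aff q.1) (aff x.1)‖ with hK
  have hle : ∀ t, ‖hform (aff p.1) (aff (suFlow ha t x).1)‖ ≤ K * Real.exp (-(t * (c.re - d.re))) := by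
    intro t
    have h1 := key p c hp t
    have h2 := key q d hq t
    set s := ‖(NormedSpace.exp (t • a) *ᵥ aff x.1) (Sum.inr ())‖ with hs
    have hs0 : 0 < s := norm_pos_iff.2 (suFlow_spec ha t x).1
    set P := ‖hform (aff p.1) (aff (suFlow ha t x).1)‖
    set Q := ‖hform (aff q.1) (aff (suFlow ha t x).1)‖
    have hexp : Real.exp (-(t * (c.re - d.re))) = Real.exp (t * d.re) / Real.exp (t * c.re) := by
      rw [← Real.exp_sub]; congr 1; ring
    rw [hK, hexp, ← h1, ← h2]
    have e1 := Real.exp_pos (t * c.re)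
    have e2 := Real.exp_pos (t * d.re)
    have hQ : 0 < Q := by
      rw [← h2] at hqx
      exact pos_of_mul_pos_right hqx (by positivity)
    have hP : 0 ≤ P := norm_nonneg _
    have : Real.exp (t * c.re) * s * P * 2 / (Real.exp (t * d.re) * s * Q) *
        (Real.exp (t * d.re) / Real.exp (t * c.re)) = P * (2 / Q) := by
      field_simp
    rw [this]
    exact le_mul_of_one_le_right hP ((one_le_div hQ).2 (hbd t))
  have hlim : Tendsto (fun t : ℝ => K * Real.exp (-(t * (c.re - d.re)))) atTop (𝓝 0) := by
    rw [← mul_zero K]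
    refine Tendsto.const_mul K (Real.tendsto_exp_neg_atTop_nhds_zero.comp ?_)
    exact tendsto_id.atTop_mul_const (sub_pos.2 hcd)
  have h0 : Tendsto (fun t => hform (aff p.1) (aff (suFlow ha t x).1)) atTop (𝓝 0) :=
    squeeze_zero_norm hle hlim
  rw [tendsto_subtype_rng, tendsto_iff_norm_sub_tendsto_zero]
  have h1 : ∀ t, ‖(suFlow ha t x).1 - p.1‖ =
      Real.sqrt (-2 * (hform (aff p.1) (aff (suFlow ha t x).1)).re) := by
    intro t
    rw [← Real.sqrt_sq (norm_nonneg ((suFlow ha t x).1 - p.1))]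
    congr 1
    rw [norm_sub_rev, @norm_sub_sq ℂ, inner_eq_hform_aff]
    simp
    ring
  simp only [h1]
  have h2 : Tendsto (fun t => Real.sqrt (-2 * (hform (aff p.1) (aff (suFlow ha t x).1)).re)) atTop
      (𝓝 (Real.sqrt (-2 * (0 : ℂ).re))) :=
    (Real.continuous_sqrt.tendsto _).comp
      (Tendsto.const_mul _ ((Complex.continuous_re.tendsto _).comp h0))
  simpa using h2

/-- The curve `exp (s a) (aff q)` stays on the complex line of `aff q`, and so does its derivative
at zero. -/
theorem eigenvector_of_fixed {a : Matrix (Fin (n + 1) ⊕ Unit) (Fin (n + 1) ⊕ Unit) ℂ}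
    (ha : aᴴ * hermForm n + hermForm n * a = 0)
    {q : sphere (0 : EuclideanSpace ℂ (Fin (n + 1))) 1} (h : ∀ t, suFlow ha t q = q) :
    ∃ c : ℂ, a *ᵥ aff q.1 = c • aff q.1 := by
  have h1 := hasDerivAt_exp_mulVec a (aff q.1) 0
  simp only [zero_smul, NormedSpace.exp_zero, Matrix.one_mulVec] at h1
  have h2 := (hasDerivAt_pi.1 h1 (Sum.inr ())).smul_const (aff q.1)
  have h3 : (fun s : ℝ => NormedSpace.exp (s • a) *ᵥ aff q.1) = fun s : ℝ =>
      (NormedSpace.exp (s • a) *ᵥ aff q.1) (Sum.inr ()) • aff q.1 := by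
    ext1 s
    conv_lhs => rw [(suFlow_spec ha s q).2, h s]
  rw [h3] at h1
  exact ⟨_, h1.unique h2⟩

theorem fixed_of_eigenvector {a : Matrix (Fin (n + 1) ⊕ Unit) (Fin (n + 1) ⊕ Unit) ℂ}
    (ha : aᴴ * hermForm n + hermForm n * a = 0)
    {q : sphere (0 : EuclideanSpace ℂ (Fin (n + 1))) 1} {c : ℂ} (h : a *ᵥ aff q.1 = c • aff q.1)
    (t : ℝ) : suFlow ha t q = q :=
  suFlow_eq ha (exp_mulVec_eigenvector h t)

theorem sphere_ne_neg {E : Type*} [NormedAddCommGroup E] [NormedSpace ℝ E]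
    (v : sphere (0 : E) 1) : -v ≠ v := by
  intro h
  exact ne_neg_of_mem_unit_sphere ℝ v h.symm

/-- The antipodal map transported by `F` commutes with the flow. A third point `x` and its partner
both flow to `p`, so `F p` would be its own antipode. -/
theorem false_of_hyperbolic {a : Matrix (Fin (n + 1) ⊕ Unit) (Fin (n + 1) ⊕ Unit) ℂ}
    (ha : aᴴ * hermForm n + hermForm n * a = 0)
    {a₂ : Matrix (Fin (n + 1) ⊕ Fin (n + 1)) (Fin (n + 1) ⊕ Fin (n + 1)) ℝ}
    {F : sphere (0 : EuclideanSpace ℂ (Fin (n + 1))) 1 ≃ₜ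
        sphere (0 : EuclideanSpace ℝ (Fin (n + 1) ⊕ Fin (n + 1))) 1}
    (hF : ∀ t x, F (suFlow ha t x) = spFlow a₂ t (F x))
    {p q : sphere (0 : EuclideanSpace ℂ (Fin (n + 1))) 1} (hpq : F q = -F p) {c d : ℂ}
    (hp : a *ᵥ aff p.1 = c • aff p.1) (hq : a *ᵥ aff q.1 = d • aff q.1) (hcd : d.re < c.re) :
    False := by
  -- A third point is `-p`, or `i p` when `q = -p`.
  obtain ⟨x, hxp, hxq⟩ : ∃ x, x ≠ p ∧ x ≠ q := by
    by_cases h : -p = q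
    · refine ⟨⟨Complex.I • p.1, by simp [norm_smul]⟩, fun h1 => ?_, fun h1 => ?_⟩
      · have h2 : Complex.I • p.1 = (1 : ℂ) • p.1 := by
          rw [one_smul]; exact congrArg Subtype.val h1
        have := smul_left_injective ℂ (ne_zero_of_mem_unit_sphere p) h2
        simpa using congrArg Complex.re this
      · rw [← h] at h1
        have h2 : Complex.I • p.1 = (-1 : ℂ) • p.1 := by
          rw [neg_smul, one_smul]; exact congrArg Subtype.val h1
        have := smul_left_injective ℂ (ne_zero_of_mem_unit_sphere p) h2
        simpa using congrArg Complex.re this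
    · exact ⟨-p, sphere_ne_neg p, h⟩
  have hx'q : F.symm (-F x) ≠ q := by
    intro h
    have h2 := congrArg F h
    rw [Homeomorph.apply_symm_apply, hpq] at h2
    exact hxp (F.injective (neg_injective h2))
  have h1 := (F.continuous.tendsto p).comp (tendsto_suFlow ha hxq hp hq hcd)
  have h2 := (F.continuous.tendsto p).comp (tendsto_suFlow ha hx'q hp hq hcd)
  have h3 : (F ∘ fun t => suFlow ha t (F.symm (-F x))) = fun t => -(F ∘ fun t => suFlow ha t x) t := by
    ext1 t
    simp only [Function.comp]
    rw [hF, hF, Homeomorph.apply_symm_apply, spFlow_neg]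
  rw [h3] at h2
  exact sphere_ne_neg (F p) (tendsto_nhds_unique h1.neg h2)

theorem LocallyConjugate.exists_adConj_toSU (hn : 1 ≤ n)
    {a₁ : Matrix (Fin (n + 1) ⊕ Unit) (Fin (n + 1) ⊕ Unit) ℂ}
    {a₂ : Matrix (Fin (n + 1) ⊕ Fin (n + 1)) (Fin (n + 1) ⊕ Fin (n + 1)) ℝ}
    (h : LocallyConjugate a₁ a₂) (ha₁ : a₁ ∈ su n) (ha₂ : a₂ ∈ sp n) :
    ∃ A ∈ u n, AdConj (SU n) a₁ (toSU A) := by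
  have ha := ha₁.1
  obtain ⟨F, hF, -, -⟩ := h.exists_homeomorph hn ha ha₂
  obtain ⟨z, hz0, hz, c, hc⟩ := exists_nonpos_eigenvector ha
  rcases hz.lt_or_eq with hz | hz
  · exact adConj_toSU_of_negative_eigenvector ha₁ hz hc
  have hz' : hform z z = 0 := by
    rw [hform_self, Complex.ofReal_re] at hz
    rw [hform_self, hz, Complex.ofReal_zero]
  obtain ⟨h0, x, hx, hzx⟩ := exists_smul_aff hz0 hz'
  let p : sphere (0 : EuclideanSpace ℂ (Fin (n + 1))) 1 := ⟨x, hx⟩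
  have hp : a₁ *ᵥ aff p.1 = c • aff p.1 := by
    rw [hzx, Matrix.mulVec_smul, smul_comm c] at hc
    exact smul_right_injective _ h0 hc
  -- The partner of the fixed point `p` under the transported antipodal map is a second fixed point.
  have hfix : ∀ t, suFlow ha t (F.symm (-F p)) = F.symm (-F p) := by
    intro t
    apply F.injective
    rw [hF, Homeomorph.apply_symm_apply, spFlow_neg, ← hF, fixed_of_eigenvector ha hp]
  set q := F.symm (-F p) with hq
  have hFq : F q = -F p := by rw [hq, Homeomorph.apply_symm_apply]
  have hpq : p ≠ q := by
    intro h1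
    rw [← h1] at hFq
    exact sphere_ne_neg (F p) hFq.symm
  obtain ⟨d, hd⟩ := eigenvector_of_fixed ha hfix
  have hdc := eigenvalue_of_two_null_eigenvectors ha hpq hp hd
  have hdre : d.re = -c.re := by rw [hdc]; simp
  -- The eigenvalues are `c` and `-star c`: opposite real parts give hyperbolic dynamics, and a zero
  -- real part makes them equal.
  rcases lt_trichotomy c.re 0 with h1 | h1 | h1
  · exact (false_of_hyperbolic ha hF (p := q) (q := p) (by rw [hFq, neg_neg]) hd hp
      (by linarith)).elim
  · have : d = c := by
      rw [hdc]
      apply Complex.ext <;> simp [h1]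
    rw [this] at hd
    exact adConj_toSU_of_two_null_eigenvectors ha₁ hpq hp hd
  · exact (false_of_hyperbolic ha hF hFq hp hd (by linarith)).elim

end Elliptic

/-! ### Boundedness of the one-parameter group of `a₂` -/

section Bounded
open scoped Matrix.Norms.Frobenius
open Metric

variable {n : ℕ}

theorem suFlow_toSU {A : Matrix (Fin (n + 1)) (Fin (n + 1)) ℂ} (hA : A ∈ u n) (t : ℝ)
    (x : sphere (0 : EuclideanSpace ℂ (Fin (n + 1))) 1) :
    (suFlow (toSU_mem hA).1 t x).1 = WithLp.toLp 2 (NormedSpace.exp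
      (t • (A + A.trace • (1 : Matrix (Fin (n + 1)) (Fin (n + 1)) ℂ))) *ᵥ x.1) := by
  have hy : (WithLp.toLp 2 (NormedSpace.exp
      (t • (A + A.trace • (1 : Matrix (Fin (n + 1)) (Fin (n + 1)) ℂ))) *ᵥ x.1) :
      EuclideanSpace ℂ (Fin (n + 1))) ∈ sphere 0 1 := by
    rw [mem_sphere_zero_iff_norm, norm_exp_mulVec (add_trace_skew hA)]; simp
  exact congrArg Subtype.val (suFlow_eq (toSU_mem hA).1 (y := ⟨_, hy⟩) (exp_toSU_mulVec_aff A t x.1))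

theorem dist_suFlow_toSU {A : Matrix (Fin (n + 1)) (Fin (n + 1)) ℂ} (hA : A ∈ u n) (t : ℝ)
    (x y : sphere (0 : EuclideanSpace ℂ (Fin (n + 1))) 1) :
    dist (suFlow (toSU_mem hA).1 t x) (suFlow (toSU_mem hA).1 t y) = dist x y := by
  rw [Subtype.dist_eq, Subtype.dist_eq, suFlow_toSU hA, suFlow_toSU hA, dist_eq_norm, dist_eq_norm,
    ← norm_exp_mulVec (add_trace_skew hA) t (x.1 - y.1), WithLp.ofLp_sub, Matrix.mulVec_sub,
    WithLp.toLp_sub]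

theorem norm_unitVec_sub_le {E : Type*} [NormedAddCommGroup E] [NormedSpace ℝ E] {x y : E}
    (hx : x ≠ 0) (hy : y ≠ 0) : ‖x‖ * ‖‖x‖⁻¹ • x - ‖y‖⁻¹ • y‖ ≤ 2 * ‖x - y‖ := by
  have hx' : 0 < ‖x‖ := norm_pos_iff.2 hx
  have hy' : 0 < ‖y‖ := norm_pos_iff.2 hy
  have h1 : ‖x‖ • (‖x‖⁻¹ • x - ‖y‖⁻¹ • y) = (x - y) + ((‖y‖ - ‖x‖) * ‖y‖⁻¹) • y := by
    rw [smul_sub, smul_smul, smul_smul, mul_inv_cancel₀ hx'.ne', sub_mul, mul_inv_cancel₀ hy'.ne',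
      sub_smul, one_smul, one_smul]
    abel
  calc ‖x‖ * ‖‖x‖⁻¹ • x - ‖y‖⁻¹ • y‖ = ‖‖x‖ • (‖x‖⁻¹ • x - ‖y‖⁻¹ • y)‖ := by
        rw [norm_smul, norm_norm]
    _ ≤ ‖x - y‖ + ‖((‖y‖ - ‖x‖) * ‖y‖⁻¹) • y‖ := by rw [h1]; exact norm_add_le _ _
    _ = ‖x - y‖ + |‖y‖ - ‖x‖| := by
        rw [norm_smul, Real.norm_eq_abs, abs_mul, abs_of_pos (inv_pos.2 hy'), mul_assoc,
          inv_mul_cancel₀ hy'.ne', mul_one]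
    _ ≤ 2 * ‖x - y‖ := by
        have := abs_norm_sub_norm_le y x
        rw [norm_sub_rev] at this
        linarith

-- If `g = exp (t a)` stretched `v` far more than `w`, it would open the small angle between `w + ε
-- v` and `w - ε v` to an obtuse one. Unit vectors at distance less than one have positive inner
-- product, and positivity of `⟨g (w + ε v), g (w - ε v)⟩` says `ε ‖g v‖ < ‖g w‖`.
open scoped RealInnerProductSpace in
theorem exists_distortion_bound
    {a : Matrix (Fin (n + 1) ⊕ Fin (n + 1)) (Fin (n + 1) ⊕ Fin (n + 1)) ℝ} {δ : ℝ} (hδ : 0 < δ)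
    (h : ∀ t, ∀ v w : sphere (0 : EuclideanSpace ℝ (Fin (n + 1) ⊕ Fin (n + 1))) 1,
      dist v w < δ → dist (spFlow a t v) (spFlow a t w) < 1) :
    ∃ ε > 0, ∀ t : ℝ, ∀ v w : EuclideanSpace ℝ (Fin (n + 1) ⊕ Fin (n + 1)), ‖v‖ = 1 → ‖w‖ = 1 →
      ε * ‖(WithLp.toLp 2 (NormedSpace.exp (t • a) *ᵥ v) : EuclideanSpace ℝ _)‖ ≤
        ‖(WithLp.toLp 2 (NormedSpace.exp (t • a) *ᵥ w) : EuclideanSpace ℝ _)‖ := by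
  -- Both `w ± ε v` have norm at least `1/2`, so after normalisation their distance is at most `8 ε
  -- < δ`.
  set ε := min δ 1 / 16 with hε
  have hε0 : 0 < ε := by positivity
  have hεδ : 16 * ε ≤ δ := by rw [hε]; linarith [min_le_left δ 1]
  have hε1 : 16 * ε ≤ 1 := by rw [hε]; linarith [min_le_right δ 1]
  refine ⟨ε, hε0, fun t v w hv hw => ?_⟩
  set g : EuclideanSpace ℝ (Fin (n + 1) ⊕ Fin (n + 1)) → EuclideanSpace ℝ (Fin (n + 1) ⊕ Fin (n + 1))
    := fun v => WithLp.toLp 2 (NormedSpace.exp (t • a) *ᵥ v) with hg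
  have hεv : ‖ε • v‖ = ε := by rw [norm_smul, hv, mul_one, Real.norm_eq_abs, abs_of_pos hε0]
  have hp : 1 / 2 ≤ ‖w + ε • v‖ := by
    have := norm_sub_le (w + ε • v) (ε • v)
    rw [add_sub_cancel_right, hw, hεv] at this
    linarith
  have hm : 1 / 2 ≤ ‖w - ε • v‖ := by
    have := norm_add_le (w - ε • v) (ε • v)
    rw [sub_add_cancel, hw, hεv] at this
    linarith
  have hp0 : w + ε • v ≠ 0 := norm_ne_zero_iff.1 (by linarith)
  have hm0 : w - ε • v ≠ 0 := norm_ne_zero_iff.1 (by linarith)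
  have hdist : dist (unitVec _ hp0) (unitVec _ hm0) < δ := by
    rw [Subtype.dist_eq, dist_eq_norm]
    have h1 := norm_unitVec_sub_le hp0 hm0
    have h2 : ‖w + ε • v - (w - ε • v)‖ ≤ 2 * ε := by
      rw [add_sub_sub_cancel]
      refine (norm_add_le _ _).trans ?_
      rw [hεv]; linarith
    simp only [unitVec]
    nlinarith [norm_nonneg (‖w + ε • v‖⁻¹ • (w + ε • v) - ‖w - ε • v‖⁻¹ • (w - ε • v))]
  have h1 := h t _ _ hdist
  have hpos : ∀ (u : EuclideanSpace ℝ (Fin (n + 1) ⊕ Fin (n + 1))) (hu : u ≠ 0),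
      ∃ c : ℝ, 0 < c ∧ g u = c • (spFlow a t (unitVec u hu)).1 := by
    intro u hu
    obtain ⟨c, hc, h⟩ := spFlow_spec a t (unitVec u hu)
    have hu' := norm_pos_iff.2 hu
    refine ⟨‖u‖ * c, by positivity, ?_⟩
    have h2 : (u : _ → ℝ) = ‖u‖ • ((unitVec u hu).1 : _ → ℝ) := by
      simp [unitVec, smul_smul, hu]
    simp only [hg]
    rw [h2, Matrix.mulVec_smul, h, smul_smul]
    simp [unitVec]
  obtain ⟨c, hc, hgc⟩ := hpos _ hp0
  obtain ⟨d, hd, hgd⟩ := hpos _ hm0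
  have hin : 0 < ⟪(spFlow a t (unitVec _ hp0)).1, (spFlow a t (unitVec _ hm0)).1⟫ := by
    rw [Subtype.dist_eq, dist_eq_norm] at h1
    have h2 := norm_sub_sq_real (spFlow a t (unitVec _ hp0)).1 (spFlow a t (unitVec _ hm0)).1
    have h3 : ‖(spFlow a t (unitVec _ hp0)).1‖ = 1 := by simp
    have h4 : ‖(spFlow a t (unitVec _ hm0)).1‖ = 1 := by simp
    rw [h3, h4] at h2
    nlinarith [norm_nonneg ((spFlow a t (unitVec _ hp0)).1 - (spFlow a t (unitVec _ hm0)).1)]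
  have hin2 : 0 < ⟪g (w + ε • v), g (w - ε • v)⟫ := by
    rw [hgc, hgd, real_inner_smul_left, real_inner_smul_right]
    positivity
  have hadd : g (w + ε • v) = g w + ε • g v := by
    ext i; simp [hg, Matrix.mulVec_add, Matrix.mulVec_smul]
  have hsub : g (w - ε • v) = g w - ε • g v := by
    ext i; simp [hg, Matrix.mulVec_sub, Matrix.mulVec_smul]
  rw [hadd, hsub, inner_sub_right, inner_add_left, inner_add_left, real_inner_smul_left,
    real_inner_smul_right, real_inner_smul_left, real_inner_smul_right,
    real_inner_comm (g w) (g v), real_inner_self_eq_norm_sq, real_inner_self_eq_norm_sq] at hin2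
  have h5 : (ε * ‖g v‖) ^ 2 ≤ ‖g w‖ ^ 2 := by nlinarith
  exact (pow_le_pow_iff_left₀ (by positivity) (norm_nonneg _) two_ne_zero).1 h5

theorem norm_J_mulVec (v : Fin (n + 1) ⊕ Fin (n + 1) → ℝ) :
    ‖(WithLp.toLp 2 (Matrix.J (Fin (n + 1)) ℝ *ᵥ v) : EuclideanSpace ℝ _)‖
      = ‖(WithLp.toLp 2 v : EuclideanSpace ℝ _)‖ := by
  rw [EuclideanSpace.norm_eq, EuclideanSpace.norm_eq]
  congr 1
  rw [Fintype.sum_sum_type, Fintype.sum_sum_type, Matrix.J]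
  simp [Matrix.fromBlocks_mulVec, Matrix.neg_mulVec, add_comm]

theorem dotProduct_le_norm_mul_norm {ι : Type*} [Fintype ι] (v w : ι → ℝ) :
    v ⬝ᵥ w ≤ ‖(WithLp.toLp 2 v : EuclideanSpace ℝ ι)‖ * ‖(WithLp.toLp 2 w : EuclideanSpace ℝ ι)‖ := by
  have := real_inner_le_norm (WithLp.toLp 2 w : EuclideanSpace ℝ ι) (WithLp.toLp 2 v)
  rw [EuclideanSpace.inner_eq_star_dotProduct, mul_comm] at this
  simpa using this

theorem dotProduct_self_eq_norm_sq {ι : Type*} [Fintype ι] (v : ι → ℝ) :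
    v ⬝ᵥ v = ‖(WithLp.toLp 2 v : EuclideanSpace ℝ ι)‖ ^ 2 := by
  rw [EuclideanSpace.norm_sq_eq]
  exact Finset.sum_congr rfl fun i _ => by
    simp only [Real.norm_eq_abs, sq_abs]; ring

/-- The distortion bound controls only ratios of norms; the symplectic form fixes the scale. For `z
= g⁻¹ J g v`, invariance of the form gives `‖g v‖² ≤ ‖z‖`, whereas `‖g z‖ = ‖g v‖` and the
distortion bound give `‖z‖ ≤ ε⁻¹`. -/
theorem exists_bound_of_distortion_bound
    {a : Matrix (Fin (n + 1) ⊕ Fin (n + 1)) (Fin (n + 1) ⊕ Fin (n + 1)) ℝ} (ha : a ∈ sp n)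
    {ε : ℝ} (hε : 0 < ε)
    (h : ∀ t : ℝ, ∀ v w : EuclideanSpace ℝ (Fin (n + 1) ⊕ Fin (n + 1)), ‖v‖ = 1 → ‖w‖ = 1 →
      ε * ‖(WithLp.toLp 2 (NormedSpace.exp (t • a) *ᵥ v) : EuclideanSpace ℝ _)‖ ≤
        ‖(WithLp.toLp 2 (NormedSpace.exp (t • a) *ᵥ w) : EuclideanSpace ℝ _)‖) (t : ℝ)
    (v : EuclideanSpace ℝ (Fin (n + 1) ⊕ Fin (n + 1))) (hv : ‖v‖ = 1) :
    ‖(WithLp.toLp 2 (NormedSpace.exp (t • a) *ᵥ v) : EuclideanSpace ℝ _)‖ ^ 2 ≤ ε⁻¹ := by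
  have hS := exp_mem_Sp ha t
  set g := NormedSpace.exp (t • a) with hg
  have hgg : g * g⁻¹ = 1 := mul_eq_one_comm.1 (Sp_inv_mul hS)
  rw [mem_Sp_iff] at hS
  set β := ‖(WithLp.toLp 2 (g *ᵥ v) : EuclideanSpace ℝ _)‖ with hβ
  have hβ0 : 0 < β := by
    refine norm_pos_iff.2 fun h0 => ?_
    refine exp_mulVec_ne_zero a t (v := v) ?_ (congrArg WithLp.ofLp h0)
    intro h1
    have : v = 0 := by ext i; simpa using congrFun h1 i
    rw [this] at hv; simp at hv
  set z : Fin (n + 1) ⊕ Fin (n + 1) → ℝ := g⁻¹ *ᵥ (Matrix.J _ ℝ *ᵥ (g *ᵥ v)) with hz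
  have hgz : g *ᵥ z = Matrix.J _ ℝ *ᵥ (g *ᵥ v) := by
    rw [hz, Matrix.mulVec_mulVec, hgg, Matrix.one_mulVec]
  set ζ := ‖(WithLp.toLp 2 z : EuclideanSpace ℝ _)‖ with hζ
  have hζ0 : 0 < ζ := by
    refine norm_pos_iff.2 fun h0 => hβ0.ne' ?_
    have : z = 0 := congrArg WithLp.ofLp h0
    rw [hβ, ← norm_J_mulVec, ← hgz, this, Matrix.mulVec_zero]; simp
  have h1 : β ^ 2 ≤ ζ := by
    have e1 : (g *ᵥ v) ⬝ᵥ (Matrix.J _ ℝ *ᵥ (g *ᵥ z)) = -β ^ 2 := by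
      rw [hgz, Matrix.mulVec_mulVec, J_mul_J, Matrix.neg_mulVec, Matrix.one_mulVec,
        dotProduct_neg, dotProduct_self_eq_norm_sq]
    have e2 : (g *ᵥ v) ⬝ᵥ (Matrix.J _ ℝ *ᵥ (g *ᵥ z)) = v ⬝ᵥ (Matrix.J _ ℝ *ᵥ z) := by
      rw [← Matrix.vecMul_transpose, ← Matrix.dotProduct_mulVec, Matrix.mulVec_mulVec,
        Matrix.mulVec_mulVec, hS]
    have e3 := dotProduct_le_norm_mul_norm (-(v : _ → ℝ)) (Matrix.J _ ℝ *ᵥ z)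
    rw [norm_J_mulVec, neg_dotProduct, ← e2, e1, neg_neg, WithLp.toLp_neg, norm_neg] at e3
    have e4 : ‖(WithLp.toLp 2 (v : _ → ℝ) : EuclideanSpace ℝ _)‖ = 1 := hv
    rwa [e4, one_mul] at e3
  have h2 := h t v (ζ⁻¹ • WithLp.toLp 2 z) hv (by
    rw [norm_smul, norm_inv, norm_norm, inv_mul_cancel₀ hζ0.ne'])
  rw [← hg, ← hβ] at h2
  have h3 : ‖(WithLp.toLp 2 (g *ᵥ (ζ⁻¹ • WithLp.toLp 2 z : EuclideanSpace ℝ _)) :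
      EuclideanSpace ℝ (Fin (n + 1) ⊕ Fin (n + 1)))‖ = ζ⁻¹ * β := by
    rw [WithLp.ofLp_smul, Matrix.mulVec_smul, WithLp.toLp_smul, norm_smul, hgz, norm_J_mulVec,
      Real.norm_eq_abs, abs_of_pos (inv_pos.2 hζ0)]
  rw [h3] at h2
  have h4 : ε ≤ ζ⁻¹ := le_of_mul_le_mul_right h2 hβ0
  have h5 : ζ ≤ ε⁻¹ := by rw [← inv_inv ζ]; exact inv_anti₀ hε h4
  exact h1.trans h5

/-- The flow on the first sphere is isometric and `F`, `F.symm` are uniformly continuous by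
compactness, so the flow on the second sphere is equicontinuous, uniformly in `t`. -/
theorem exists_bound_exp {A : Matrix (Fin (n + 1)) (Fin (n + 1)) ℂ} (hA : A ∈ u n)
    {a : Matrix (Fin (n + 1) ⊕ Fin (n + 1)) (Fin (n + 1) ⊕ Fin (n + 1)) ℝ} (ha : a ∈ sp n)
    {F : sphere (0 : EuclideanSpace ℂ (Fin (n + 1))) 1 ≃ₜ
        sphere (0 : EuclideanSpace ℝ (Fin (n + 1) ⊕ Fin (n + 1))) 1}
    (hF : ∀ t x, F (suFlow (toSU_mem hA).1 t x) = spFlow a t (F x)) :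
    ∃ C : ℝ, ∀ (t : ℝ) (v : Fin (n + 1) ⊕ Fin (n + 1) → ℝ),
      ‖(WithLp.toLp 2 (NormedSpace.exp (t • a) *ᵥ v) : EuclideanSpace ℝ _)‖ ≤
        C * ‖(WithLp.toLp 2 v : EuclideanSpace ℝ _)‖ := by
  obtain ⟨δ₁, hδ₁, h1⟩ := Metric.uniformContinuous_iff.1
    (CompactSpace.uniformContinuous_of_continuous F.continuous) 1 one_pos
  obtain ⟨δ, hδ, h2⟩ := Metric.uniformContinuous_iff.1
    (CompactSpace.uniformContinuous_of_continuous F.symm.continuous) δ₁ hδ₁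
  obtain ⟨ε, hε, h3⟩ := exists_distortion_bound (a := a) hδ fun t v w hvw => by
    have h4 : dist (suFlow (toSU_mem hA).1 t (F.symm v)) (suFlow (toSU_mem hA).1 t (F.symm w))
        < δ₁ := by
      rw [dist_suFlow_toSU hA]; exact h2 hvw
    have := h1 h4
    rwa [hF, hF, Homeomorph.apply_symm_apply, Homeomorph.apply_symm_apply] at this
  refine ⟨Real.sqrt ε⁻¹, fun t v => ?_⟩
  by_cases hv : v = 0
  · simp [hv]
  have hv' : (WithLp.toLp 2 v : EuclideanSpace ℝ _) ≠ 0 := fun h => hv (congrArg WithLp.ofLp h)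
  have hn := norm_pos_iff.2 hv'
  have h5 := exists_bound_of_distortion_bound ha hε h3 t (unitVec _ hv').1 (by simp)
  have h6 := Real.le_sqrt_of_sq_le h5
  simp only [unitVec] at h6
  rw [WithLp.ofLp_smul, Matrix.mulVec_smul, WithLp.toLp_smul, norm_smul, norm_inv, norm_norm,
    inv_mul_le_iff₀ hn, mul_comm] at h6
  exact h6

end Bounded

/-! ### Semisimplicity of matrices with bounded exponential -/

section BoundedExp
open scoped Matrix.Norms.Frobenius
open Module

variable {ι : Type*} [Fintype ι] [DecidableEq ι] {b : Matrix ι ι ℂ}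

theorem re_eq_zero_of_bounded
    (hb : ∀ ζ : ι → ℂ, ∃ M, ∀ (t : ℝ) i, ‖(NormedSpace.exp (t • b) *ᵥ ζ) i‖ ≤ M)
    {ζ : ι → ℂ} (hζ : ζ ≠ 0) {c : ℂ} (h : b *ᵥ ζ = c • ζ) : c.re = 0 := by
  by_contra hc
  obtain ⟨i, hi⟩ := Function.ne_iff.1 hζ
  obtain ⟨M, hM⟩ := hb ζ
  have hi' : 0 < ‖ζ i‖ := norm_pos_iff.2 hi
  -- At this time, of either sign, the growth factor is `exp (M / ‖ζ i‖)`, which exceeds the allowed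
  -- `M / ‖ζ i‖`.
  have h1 := hM (M / ‖ζ i‖ / c.re) i
  rw [exp_mulVec_eigenvector h, Pi.smul_apply, smul_eq_mul, norm_mul, Complex.norm_exp,
    Complex.re_ofReal_mul, div_mul_cancel₀ _ hc, ← le_div_iff₀ hi'] at h1
  linarith [Real.add_one_le_exp (M / ‖ζ i‖)]

/-- On a Jordan chain `exp (t b) ζ = e^{tc} (ζ + t η)`, and `|e^{tc}| = 1`, so the growth is linear
unless `η = 0`. -/
theorem eq_zero_of_bounded_of_jordan
    (hb : ∀ ζ : ι → ℂ, ∃ M, ∀ (t : ℝ) i, ‖(NormedSpace.exp (t • b) *ᵥ ζ) i‖ ≤ M)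
    {ζ η : ι → ℂ} {c : ℂ} (h : b *ᵥ ζ = c • ζ + η) (h' : b *ᵥ η = c • η) : η = 0 := by
  by_contra hη
  have hc := re_eq_zero_of_bounded hb hη h'
  have hw : ∀ t : ℝ, NormedSpace.exp (t • b) *ᵥ ζ = Complex.exp (t * c) • (ζ + (t : ℂ) • η) := by
    intro t
    have h1 := exp_mulVec_eq_of_hasDerivAt b
      (w := fun t : ℝ => Complex.exp (t * c) • (ζ + (t : ℂ) • η)) (fun s => by
        have d1 : HasDerivAt (fun t : ℝ => (t : ℂ)) 1 s := Complex.ofRealCLM.hasDerivAt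
        have d2 : HasDerivAt (fun t : ℝ => Complex.exp (t * c)) (Complex.exp (s * c) * c) s := by
          simpa using (d1.mul_const c).cexp
        have d3 : HasDerivAt (fun t : ℝ => ζ + (t : ℂ) • η) η s := by
          simpa using (d1.smul_const η).const_add ζ
        refine (d2.smul d3).congr_deriv ?_
        rw [Matrix.mulVec_smul, Matrix.mulVec_add, Matrix.mulVec_smul, h, h']
        ext i
        simp
        ring) t
    simpa using h1
  obtain ⟨i, hi⟩ := Function.ne_iff.1 hη
  obtain ⟨M, hM⟩ := hb ζ
  have hi' : 0 < ‖η i‖ := norm_pos_iff.2 hi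
  have hM0 : 0 ≤ M := (norm_nonneg _).trans (hM 0 i)
  set t : ℝ := (M + ‖ζ i‖ + 1) / ‖η i‖ with ht
  have ht0 : 0 ≤ t := by positivity
  have h1 := hM t i
  rw [hw, Pi.smul_apply, smul_eq_mul, norm_mul, Complex.norm_exp, Complex.re_ofReal_mul, hc,
    mul_zero, Real.exp_zero, one_mul, Pi.add_apply, Pi.smul_apply, smul_eq_mul] at h1
  have h2 : ‖(t : ℂ) * η i‖ = M + ‖ζ i‖ + 1 := by
    rw [norm_mul, Complex.norm_real, Real.norm_of_nonneg ht0, ht, div_mul_cancel₀ _ hi'.ne']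
  have h3 := norm_sub_le (ζ i + t * η i) (ζ i)
  rw [add_sub_cancel_left, h2] at h3
  linarith

/-- Without Jordan chains of length two the generalised eigenspaces, which span, are eigenspaces. -/
theorem iSup_eigenspace_eq_top_of_bounded
    (hb : ∀ ζ : ι → ℂ, ∃ M, ∀ (t : ℝ) i, ‖(NormedSpace.exp (t • b) *ᵥ ζ) i‖ ≤ M) :
    ⨆ c, End.eigenspace (Matrix.toLin' b) c = ⊤ := by
  rw [eq_top_iff, ← End.iSup_maxGenEigenspace_eq_top (Matrix.toLin' b)]
  refine iSup_mono fun c => ?_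
  set f : End ℂ (ι → ℂ) := Matrix.toLin' b - algebraMap ℂ (End ℂ (ι → ℂ)) c with hf
  have e : ∀ w, f w = b *ᵥ w - c • w := fun w => by
    simp [hf, Module.algebraMap_end_apply]
  have h1 : LinearMap.ker (f ^ 1) = LinearMap.ker (f ^ 2) := by
    refine le_antisymm (fun v hv => ?_) fun v hv => ?_
    · rw [LinearMap.mem_ker, pow_one] at hv
      rw [LinearMap.mem_ker, sq, End.mul_apply, hv, map_zero]
    · rw [LinearMap.mem_ker, sq, End.mul_apply] at hv
      rw [LinearMap.mem_ker, pow_one]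
      refine eq_zero_of_bounded_of_jordan hb (ζ := v) (c := c) ?_ ?_
      · rw [e]; abel
      · rw [e (f v)] at hv; exact sub_eq_zero.1 hv
  intro v hv
  obtain ⟨k, hk⟩ := (End.mem_maxGenEigenspace _ _ _).1 hv
  have hk' : v ∈ LinearMap.ker (f ^ k) := hk
  have h2 : LinearMap.ker (f ^ k) ≤ LinearMap.ker (f ^ 1) := by
    rcases Nat.eq_zero_or_pos k with rfl | hk0
    · rw [pow_zero]; intro v hv; have : v = 0 := hv; rw [this]; exact zero_mem _
    · obtain ⟨m, rfl⟩ := Nat.exists_eq_add_of_le hk0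
      rw [← End.ker_pow_constant h1 m]
  have h3 := h2 hk'
  rw [pow_one, LinearMap.mem_ker, e] at h3
  rw [End.mem_eigenspace_iff, Matrix.toLin'_apply]
  exact sub_eq_zero.1 h3

end BoundedExp

/-! ### The complexified symplectic form -/

section Symplectic
open Module

variable {n : ℕ}

/-- The complexified standard symplectic form. -/
def csymp (n : ℕ) : LinearMap.BilinForm ℂ (Fin (n + 1) ⊕ Fin (n + 1) → ℂ) :=
  Matrix.toBilin' (Matrix.J (Fin (n + 1)) ℂ)

theorem csymp_apply (x y : Fin (n + 1) ⊕ Fin (n + 1) → ℂ) :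
    csymp n x y = ∑ j, (x (Sum.inr j) * y (Sum.inl j) - x (Sum.inl j) * y (Sum.inr j)) := by
  rw [csymp, Matrix.toBilin'_apply', Matrix.J, Matrix.fromBlocks_mulVec, dotProduct,
    Fintype.sum_sum_type, ← Finset.sum_add_distrib]
  refine Finset.sum_congr rfl fun j _ => ?_
  simp [Matrix.neg_mulVec]
  ring

theorem csymp_swap (x y : Fin (n + 1) ⊕ Fin (n + 1) → ℂ) : csymp n x y = -csymp n y x := by
  rw [csymp_apply, csymp_apply, ← Finset.sum_neg_distrib]
  exact Finset.sum_congr rfl fun j _ => by ring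

theorem star_csymp (x y : Fin (n + 1) ⊕ Fin (n + 1) → ℂ) :
    star (csymp n x y) = csymp n (star x) (star y) := by
  rw [csymp_apply, csymp_apply, star_sum]
  refine Finset.sum_congr rfl fun j _ => by simp

theorem csymp_ofReal (x y : Fin (n + 1) ⊕ Fin (n + 1) → ℝ) :
    csymp n (fun i => (x i : ℂ)) (fun i => (y i : ℂ)) =
      ((x ⬝ᵥ (Matrix.J (Fin (n + 1)) ℝ *ᵥ y) : ℝ) : ℂ) := by
  rw [csymp_apply, Matrix.J, Matrix.fromBlocks_mulVec, dotProduct,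
    Fintype.sum_sum_type, ← Finset.sum_add_distrib, Complex.ofReal_sum]
  refine Finset.sum_congr rfl fun j _ => ?_
  simp [Matrix.neg_mulVec]
  ring

theorem csymp_nondegenerate {y : Fin (n + 1) ⊕ Fin (n + 1) → ℂ} (h : ∀ x, csymp n x y = 0) :
    y = 0 := by
  ext (j | j)
  · have := h (Pi.single (Sum.inr j) 1)
    rw [csymp_apply] at this
    simpa [Pi.single_apply] using this
  · have := h (Pi.single (Sum.inl j) 1)
    rw [csymp_apply] at this
    simpa [Pi.single_apply] using this

variable {a : Matrix (Fin (n + 1) ⊕ Fin (n + 1)) (Fin (n + 1) ⊕ Fin (n + 1)) ℝ}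

theorem ofReal_mulVec {ι : Type*} [Fintype ι] (a : Matrix ι ι ℝ) (x : ι → ℝ) :
    a.map Complex.ofReal *ᵥ (fun i => (x i : ℂ)) = fun i => ((a *ᵥ x) i : ℂ) := by
  ext i
  simp [Matrix.mulVec, dotProduct]

theorem star_ofReal_mulVec {ι : Type*} [Fintype ι] (a : Matrix ι ι ℝ) (x : ι → ℂ) :
    star (a.map Complex.ofReal *ᵥ x) = a.map Complex.ofReal *ᵥ star x := by
  ext i
  simp [Matrix.mulVec, dotProduct]

theorem csymp_mulVec (ha : a ∈ sp n) (x y : Fin (n + 1) ⊕ Fin (n + 1) → ℂ) :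
    csymp n (a.map Complex.ofReal *ᵥ x) y = -csymp n x (a.map Complex.ofReal *ᵥ y) := by
  rw [mem_sp_iff, Matrix.conjTranspose_eq_transpose_of_trivial] at ha
  have hJ : (Matrix.J (Fin (n + 1)) ℝ).map Complex.ofReal = Matrix.J (Fin (n + 1)) ℂ := by
    ext (i | i) (j | j) <;> simp [Matrix.J, Matrix.one_apply] <;> split_ifs <;> simp
  have h := congrArg (fun M : Matrix _ _ ℝ => M.map Complex.ofRealHom) ha
  have h2 : (a.map Complex.ofReal)ᵀ * Matrix.J (Fin (n + 1)) ℂ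
      = -(Matrix.J (Fin (n + 1)) ℂ * a.map Complex.ofReal) := by
    rw [← hJ, eq_neg_iff_add_eq_zero]
    have e : ⇑Complex.ofRealHom = Complex.ofReal := rfl
    simp only [Matrix.map_add _ (map_add Complex.ofRealHom), Matrix.map_mul] at h
    rw [e] at h
    rw [← Matrix.transpose_map]
    simpa using h
  rw [csymp, Matrix.toBilin'_apply', Matrix.toBilin'_apply', ← Matrix.vecMul_transpose,
    ← Matrix.dotProduct_mulVec, Matrix.mulVec_mulVec, h2, Matrix.neg_mulVec, dotProduct_neg,
    Matrix.mulVec_mulVec]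

theorem bounded_complexification
    (hC : ∃ C : ℝ, ∀ (t : ℝ) (v : Fin (n + 1) ⊕ Fin (n + 1) → ℝ),
      ‖(WithLp.toLp 2 (NormedSpace.exp (t • a) *ᵥ v) : EuclideanSpace ℝ _)‖ ≤
        C * ‖(WithLp.toLp 2 v : EuclideanSpace ℝ _)‖) (ζ : Fin (n + 1) ⊕ Fin (n + 1) → ℂ) :
    ∃ M, ∀ (t : ℝ) i, ‖(NormedSpace.exp (t • a.map Complex.ofReal) *ᵥ ζ) i‖ ≤ M := by
  obtain ⟨C, hC⟩ := hC
  let T : (Fin (n + 1) ⊕ Fin (n + 1) → ℝ) →ₗ[ℝ] (Fin (n + 1) ⊕ Fin (n + 1) → ℂ) :=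
    { toFun := fun v i => (v i : ℂ)
      map_add' := fun x y => by ext; simp
      map_smul' := fun c x => by ext; simp }
  have hT : ∀ (t : ℝ) v, T (NormedSpace.exp (t • a) *ᵥ v)
      = NormedSpace.exp (t • a.map Complex.ofReal) *ᵥ T v :=
    exp_intertwine T fun v => (ofReal_mulVec a v).symm
  set x : Fin (n + 1) ⊕ Fin (n + 1) → ℝ := fun i => (ζ i).re with hx
  set y : Fin (n + 1) ⊕ Fin (n + 1) → ℝ := fun i => (ζ i).im with hy
  have hζ : ζ = T x + Complex.I • T y := by
    ext i
    simp [T, hx, hy, mul_comm Complex.I, Complex.re_add_im]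
  have hi : ∀ (t : ℝ) v i, ‖T (NormedSpace.exp (t • a) *ᵥ v) i‖ ≤
      C * ‖(WithLp.toLp 2 v : EuclideanSpace ℝ _)‖ := by
    intro t v i
    refine le_trans ?_ (hC t v)
    have := PiLp.norm_apply_le (WithLp.toLp 2 (NormedSpace.exp (t • a) *ᵥ v) : EuclideanSpace ℝ _) i
    simpa [T] using this
  refine ⟨C * ‖(WithLp.toLp 2 x : EuclideanSpace ℝ _)‖
    + C * ‖(WithLp.toLp 2 y : EuclideanSpace ℝ _)‖, fun t i => ?_⟩
  rw [hζ, Matrix.mulVec_add, Matrix.mulVec_smul, ← hT, ← hT, Pi.add_apply, Pi.smul_apply]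
  refine (norm_add_le _ _).trans (add_le_add (hi t x i) ?_)
  rw [norm_smul, Complex.norm_I, one_mul]
  exact hi t y i

end Symplectic

/-! ### Symplectic bases of eigenvectors -/

section NormalForm
open scoped Matrix.Norms.Frobenius
open Module

variable {n : ℕ} {a : Matrix (Fin (n + 1) ⊕ Fin (n + 1)) (Fin (n + 1) ⊕ Fin (n + 1)) ℝ}

/-- As `c` is imaginary, `star x` has eigenvalue `-c`, and skewness gives `(c - d) ω(star x, y) =
0`. -/
theorem csymp_star_eigenvectors (ha : a ∈ sp n) {x y : Fin (n + 1) ⊕ Fin (n + 1) → ℂ} {c d : ℂ}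
    (hx : a.map Complex.ofReal *ᵥ x = c • x) (hy : a.map Complex.ofReal *ᵥ y = d • y)
    (hc : c.re = 0) (hcd : c ≠ d) : csymp n (star x) y = 0 := by
  have h := csymp_mulVec ha (star x) y
  have hs : star c = -c := by apply Complex.ext <;> simp [hc]
  rw [← star_ofReal_mulVec, hx, hy, star_smul, hs] at h
  simp only [map_smul, LinearMap.smul_apply, smul_eq_mul] at h
  have h2 : (c - d) * csymp n (star x) y = 0 := by linear_combination -h
  exact (mul_eq_zero.1 h2).resolve_left (sub_ne_zero.2 hcd)

/-- A Hermitian type form vanishing on the diagonal of a subspace vanishes on it. -/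
theorem csymp_star_polarization (W : Submodule ℂ (Fin (n + 1) ⊕ Fin (n + 1) → ℂ))
    (h : ∀ w ∈ W, csymp n (star w) w = 0) {x y : Fin (n + 1) ⊕ Fin (n + 1) → ℂ} (hx : x ∈ W)
    (hy : y ∈ W) : csymp n (star x) y = 0 := by
  have h1 := h _ (W.add_mem hx hy)
  have h2 := h _ (W.add_mem hx (W.smul_mem Complex.I hy))
  simp only [star_add, star_smul, map_add, map_smul, LinearMap.add_apply, LinearMap.smul_apply,
    smul_eq_mul, h x hx, h y hy, mul_zero, add_zero, zero_add] at h1 h2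
  have hI : star Complex.I = -Complex.I := Complex.conj_I
  rw [hI] at h2
  have h3 : 2 * csymp n (star x) y = 0 := by
    linear_combination h1 - Complex.I * h2 + (csymp n (star x) y - csymp n (star y) x) *
      Complex.I_mul_I
  exact (mul_eq_zero.1 h3).resolve_left two_ne_zero

/-- An invariant `W` is the sum of its intersections with the eigenspaces, which are mutually
orthogonal for `ω(star x, y)`. If the diagonal values vanished on all eigenvectors, polarisation
would kill the form on each piece, hence on `W`. -/
theorem exists_eigenvector_mem (ha : a ∈ sp n)
    (hb : ∀ ζ : Fin (n + 1) ⊕ Fin (n + 1) → ℂ, ∃ M, ∀ (t : ℝ) i,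
      ‖(NormedSpace.exp (t • a.map Complex.ofReal) *ᵥ ζ) i‖ ≤ M)
    {W : Submodule ℂ (Fin (n + 1) ⊕ Fin (n + 1) → ℂ)}
    (hW : ∀ w ∈ W, a.map Complex.ofReal *ᵥ w ∈ W)
    {x y : Fin (n + 1) ⊕ Fin (n + 1) → ℂ} (hx : x ∈ W) (hy : y ∈ W)
    (hxy : csymp n (star x) y ≠ 0) :
    ∃ w ∈ W, ∃ c : ℂ, a.map Complex.ofReal *ᵥ w = c • w ∧ csymp n (star w) w ≠ 0 := by
  by_contra! hcon
  set f := Matrix.toLin' (a.map Complex.ofReal) with hf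
  have hsup : W = ⨆ c, W ⊓ End.eigenspace f c :=
    Submodule.eq_iSup_inf_genEigenspace 1 hW (iSup_eigenspace_eq_top_of_bounded hb)
  have key : ∀ c d, ∀ v ∈ W ⊓ End.eigenspace f c, ∀ w ∈ W ⊓ End.eigenspace f d,
      csymp n (star v) w = 0 := by
    intro c d v hv w hw
    by_cases hcd : c = d
    · subst hcd
      refine csymp_star_polarization _ (fun u hu => ?_) hv hw
      exact hcon u hu.1 c (End.mem_eigenspace_iff.1 hu.2)
    · by_cases hv0 : v = 0
      · simp [hv0]
      have hv' : a.map Complex.ofReal *ᵥ v = c • v := End.mem_eigenspace_iff.1 hv.2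
      exact csymp_star_eigenvectors ha hv' (End.mem_eigenspace_iff.1 hw.2)
        (re_eq_zero_of_bounded hb hv0 hv') hcd
  apply hxy
  rw [hsup] at hx hy
  refine Submodule.iSup_induction _ (motive := fun y => csymp n (star x) y = 0) hy
    (fun d w hw => ?_) (by simp) fun u v hu hv => by rw [map_add, hu, hv, add_zero]
  exact Submodule.iSup_induction _ (motive := fun x => csymp n (star x) w = 0) hx
    (fun c v hv => key c d v hv w hw) (by simp) fun u v hu hv => by
      rw [star_add, map_add, LinearMap.add_apply, hu, hv, add_zero]

/-- A symplectic basis adapted to `a`, in complex notation. -/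
structure AdaptedFamily (a : Matrix (Fin (n + 1) ⊕ Fin (n + 1)) (Fin (n + 1) ⊕ Fin (n + 1)) ℝ)
    {k : ℕ} (ζ : Fin k → Fin (n + 1) ⊕ Fin (n + 1) → ℂ) (μ : Fin k → ℝ) : Prop where
  eigen : ∀ j, a.map Complex.ofReal *ᵥ ζ j = (Complex.I * μ j) • ζ j
  isotropic : ∀ i j, csymp n (ζ i) (ζ j) = 0
  ortho : ∀ i j, csymp n (star (ζ i)) (ζ j) = if i = j then 2 * Complex.I else 0

/-- The symplectic complement of the `ζ j` and their conjugates is stable under `a` and conjugation,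
and `ω(star x, y)` is nondegenerate on it, so it contains an eigenvector `w` with `ω(star w, w) ≠
0`. That value is imaginary; its sign and size can be adjusted. -/
theorem AdaptedFamily.exists_next (ha : a ∈ sp n)
    (hb : ∀ ζ : Fin (n + 1) ⊕ Fin (n + 1) → ℂ, ∃ M, ∀ (t : ℝ) i,
      ‖(NormedSpace.exp (t • a.map Complex.ofReal) *ᵥ ζ) i‖ ≤ M)
    {k : ℕ} {ζ : Fin k → Fin (n + 1) ⊕ Fin (n + 1) → ℂ} {μ : Fin k → ℝ}
    (h : AdaptedFamily a ζ μ) (hk : k < n + 1) :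
    ∃ w, ∃ ν : ℝ, a.map Complex.ofReal *ᵥ w = (Complex.I * ν) • w ∧
      (∀ j, csymp n (ζ j) w = 0) ∧ (∀ j, csymp n (star (ζ j)) w = 0) ∧
      csymp n (star w) w = 2 * Complex.I := by
  set Φ := (LinearMap.pi fun j => csymp n (ζ j)).prod (LinearMap.pi fun j => csymp n (star (ζ j)))
    with hΦ
  have hmem : ∀ w, w ∈ LinearMap.ker Φ ↔
      (∀ j, csymp n (ζ j) w = 0) ∧ ∀ j, csymp n (star (ζ j)) w = 0 := by
    intro w
    rw [LinearMap.mem_ker, hΦ, LinearMap.prod_apply]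
    simp [Prod.ext_iff, funext_iff]
  have hne : LinearMap.ker Φ ≠ ⊥ := by
    -- There are `2k` conditions on a space of dimension `2(n+1)`.
    refine LinearMap.ker_ne_bot_of_finrank_lt ?_
    simp
    omega
  have hstar : ∀ w ∈ LinearMap.ker Φ, star w ∈ LinearMap.ker Φ := by
    intro w hw
    rw [hmem] at hw ⊢
    refine ⟨fun j => ?_, fun j => ?_⟩
    · have := star_csymp (star (ζ j)) w
      rw [hw.2, star_zero, star_star] at this
      exact this.symm
    · rw [← star_csymp, hw.1, star_zero]
  have hstareig : ∀ j, a.map Complex.ofReal *ᵥ star (ζ j) = star (Complex.I * μ j) • star (ζ j) :=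
    fun j => by rw [← star_ofReal_mulVec, h.eigen, star_smul]
  have hinv : ∀ w ∈ LinearMap.ker Φ, a.map Complex.ofReal *ᵥ w ∈ LinearMap.ker Φ := by
    intro w hw
    rw [hmem] at hw ⊢
    refine ⟨fun j => ?_, fun j => ?_⟩
    · rw [← neg_eq_zero, ← csymp_mulVec ha, h.eigen, map_smul, LinearMap.smul_apply, hw.1,
        smul_zero]
    · rw [← neg_eq_zero, ← csymp_mulVec ha, hstareig, map_smul, LinearMap.smul_apply, hw.2,
        smul_zero]
  have hsw : ∀ i j, csymp n (ζ i) (star (ζ j)) = if j = i then -(2 * Complex.I) else 0 := by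
    intro i j
    rw [csymp_swap, h.ortho]
    split_ifs <;> simp
  have hiso' : ∀ i j, csymp n (star (ζ i)) (star (ζ j)) = 0 := by
    intro i j
    rw [← star_csymp, h.isotropic, star_zero]
  obtain ⟨y, hy, hy0⟩ := (Submodule.ne_bot_iff _).1 hne
  obtain ⟨x, hx, hxy⟩ : ∃ x ∈ LinearMap.ker Φ, csymp n (star x) y ≠ 0 := by
    by_contra! hcon
    refine hy0 (csymp_nondegenerate fun v => ?_)
    -- Symplectic Gram-Schmidt: `v'` is the component of `v` in the complement, and the removed part
    -- pairs to zero with `y`.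
    set α : Fin k → ℂ := fun j => csymp n (star (ζ j)) v / (2 * Complex.I) with hα
    set β : Fin k → ℂ := fun j => csymp n (ζ j) v / (2 * Complex.I) with hβ
    set v' := v - ∑ j, α j • ζ j + ∑ j, β j • star (ζ j) with hv'
    have hI : (2 * Complex.I) ≠ 0 := by simp
    have hv : v' ∈ LinearMap.ker Φ := by
      rw [hmem]
      refine ⟨fun j => ?_, fun j => ?_⟩
      · simp only [hv', map_add, map_sub, map_sum, map_smul, h.isotropic, hsw, smul_eq_mul]
        simp [hβ, hI]
      · simp only [hv', map_add, map_sub, map_sum, map_smul, h.ortho, hiso', smul_eq_mul]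
        simp [hα, hI]
    have h1 := hcon _ (hstar _ hv)
    rw [star_star, hv'] at h1
    have hy' := (hmem y).1 hy
    simpa [hy'.1, hy'.2] using h1
  obtain ⟨w, hw, c, hwc, hww⟩ := exists_eigenvector_mem ha hb hinv hx hy hxy
  have hw0 : w ≠ 0 := by rintro rfl; simp at hww
  have hc := re_eq_zero_of_bounded hb hw0 hwc
  have hcI : c = Complex.I * c.im := by apply Complex.ext <;> simp [hc]
  obtain ⟨r, hr⟩ : ∃ r : ℝ, csymp n (star w) w = Complex.I * r := by
    refine ⟨(csymp n (star w) w).im, ?_⟩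
    have h1 := star_csymp (star w) w
    rw [star_star, csymp_swap w] at h1
    have h2 := congrArg Complex.re h1
    simp only [Complex.star_def, Complex.conj_re, Complex.neg_re] at h2
    apply Complex.ext
    · simp; linarith
    · simp
  have hr0 : r ≠ 0 := by rintro rfl; simp at hr; exact hww hr
  have scale : ∀ w' ∈ LinearMap.ker Φ, ∀ ν s : ℝ, 0 < s →
      a.map Complex.ofReal *ᵥ w' = (Complex.I * ν) • w' → csymp n (star w') w' = Complex.I * s →
      ∃ w, ∃ ν : ℝ, a.map Complex.ofReal *ᵥ w = (Complex.I * ν) • w ∧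
      (∀ j, csymp n (ζ j) w = 0) ∧ (∀ j, csymp n (star (ζ j)) w = 0) ∧
      csymp n (star w) w = 2 * Complex.I := by
    intro w' hw' ν s hs he hws
    have h2 := (hmem w').1 hw'
    refine ⟨(Real.sqrt (2 / s) : ℂ) • w', ν, ?_, fun j => ?_, fun j => ?_, ?_⟩
    · rw [Matrix.mulVec_smul, he, smul_comm]
    · rw [map_smul, h2.1, smul_zero]
    · rw [map_smul, h2.2, smul_zero]
    · have h3 : ((Real.sqrt (2 / s) : ℝ) : ℂ) * (Real.sqrt (2 / s) : ℝ) = 2 / s := by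
        rw [← Complex.ofReal_mul, Real.mul_self_sqrt (by positivity)]; simp
      have hs' : (s : ℂ) ≠ 0 := Complex.ofReal_ne_zero.2 hs.ne'
      rw [star_smul, map_smul, map_smul, LinearMap.smul_apply, hws, smul_eq_mul, smul_eq_mul,
        Complex.star_def, Complex.conj_ofReal, ← mul_assoc, h3]
      field_simp
  -- Replacing `w` by its conjugate reverses the sign of `r` and of the frequency, so a positive `r`
  -- can always be reached.
  rcases lt_or_gt_of_ne hr0 with hneg | hpos
  · refine scale (star w) (hstar w hw) (-c.im) (-r) (by linarith) ?_ ?_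
    · rw [← star_ofReal_mulVec, hwc, star_smul]
      congr 1
      apply Complex.ext <;> simp [hc]
    · rw [star_star, csymp_swap, hr]; simp
  · exact scale w hw c.im r hpos (by rw [hwc, ← hcI]) hr

theorem exists_adaptedFamily (ha : a ∈ sp n)
    (hb : ∀ ζ : Fin (n + 1) ⊕ Fin (n + 1) → ℂ, ∃ M, ∀ (t : ℝ) i,
      ‖(NormedSpace.exp (t • a.map Complex.ofReal) *ᵥ ζ) i‖ ≤ M) (k : ℕ) (hk : k ≤ n + 1) :
    ∃ (ζ : Fin k → Fin (n + 1) ⊕ Fin (n + 1) → ℂ) (μ : Fin k → ℝ), AdaptedFamily a ζ μ := by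
  induction k with
  | zero => exact ⟨Fin.elim0, Fin.elim0, fun j => j.elim0, fun j => j.elim0, fun j => j.elim0⟩
  | succ k ih =>
    obtain ⟨ζ, μ, h⟩ := ih (by omega)
    obtain ⟨w, ν, h1, h2, h3, h4⟩ := h.exists_next ha hb (by omega)
    have h5 : ∀ j, csymp n w (ζ j) = 0 := fun j => by rw [csymp_swap, h2, neg_zero]
    have h6 : ∀ j, csymp n (star w) (ζ j) = 0 := fun j => by
      have := star_csymp (star (ζ j)) w
      rw [h3, star_zero, star_star] at this
      rw [csymp_swap, ← this, neg_zero]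
    have h7 : csymp n w w = 0 := by
      rw [csymp_apply]; exact Finset.sum_eq_zero fun j _ => by ring
    refine ⟨Fin.cons w ζ, Fin.cons ν μ, ?_, ?_, ?_⟩
    · refine Fin.cases ?_ fun j => ?_
      · simpa using h1
      · simpa using h.eigen j
    · refine Fin.cases (Fin.cases ?_ fun j => ?_) fun i => Fin.cases ?_ fun j => ?_
      · simpa using h7
      · simpa using h5 j
      · simpa using h2 i
      · simpa using h.isotropic i j
    · refine Fin.cases (Fin.cases ?_ fun j => ?_) fun i => Fin.cases ?_ fun j => ?_
      · simpa using h4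
      · simpa [(Fin.succ_ne_zero j).symm] using h6 j
      · simpa using h3 i
      · simpa using h.ortho i j

end NormalForm

/-! ### Diagonal representatives of the adjoint orbits -/

section NormalForm
open scoped Matrix.Norms.Frobenius
open Module

variable {n : ℕ} {a : Matrix (Fin (n + 1) ⊕ Fin (n + 1)) (Fin (n + 1) ⊕ Fin (n + 1)) ℝ}

/-- The skew-Hermitian diagonal matrix with entries `i μ_j`. -/
def diagI (μ : Fin (n + 1) → ℝ) : Matrix (Fin (n + 1)) (Fin (n + 1)) ℂ :=
  Matrix.diagonal fun j => Complex.I * μ j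

theorem diagI_mem (μ : Fin (n + 1) → ℝ) : diagI μ ∈ u n := by
  change (diagI μ)ᴴ = -diagI μ
  rw [diagI, Matrix.diagonal_conjTranspose, Matrix.diagonal_neg]
  congr 1
  ext j
  simp

theorem toSp_diagI (μ : Fin (n + 1) → ℝ) :
    toSp (diagI μ) = Matrix.fromBlocks 0 (-Matrix.diagonal μ) (Matrix.diagonal μ) 0 := by
  rw [toSp, diagI]
  congr 1 <;> ext i j <;> by_cases h : i = j <;> simp [h]

/-- The normalisation `2i` makes the vectors `Re ζ j` and `-Im ζ j` the columns of a symplectic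
matrix; the eigenvalue equation says that `a` rotates each of these pairs with speed `μ j`. -/
theorem AdaptedFamily.adConj {ζ : Fin (n + 1) → Fin (n + 1) ⊕ Fin (n + 1) → ℂ}
    {μ : Fin (n + 1) → ℝ} (h : AdaptedFamily a ζ μ) : AdConj (Sp n) a (toSp (diagI μ)) := by
  set e : Fin (n + 1) ⊕ Fin (n + 1) → Fin (n + 1) ⊕ Fin (n + 1) → ℝ :=
    Sum.elim (fun j i => (ζ j i).re) (fun j i => -(ζ j i).im) with he
  set g : Matrix (Fin (n + 1) ⊕ Fin (n + 1)) (Fin (n + 1) ⊕ Fin (n + 1)) ℝ :=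
    Matrix.of fun i p => e p i with hg
  have hl : ∀ j, (fun i => (e (Sum.inl j) i : ℂ)) = (1 / 2 : ℂ) • (ζ j + star (ζ j)) := by
    intro j
    ext i
    apply Complex.ext <;> simp [he] <;> ring
  have hr : ∀ j, (fun i => (e (Sum.inr j) i : ℂ)) = (Complex.I / 2) • (ζ j - star (ζ j)) := by
    intro j
    ext i
    apply Complex.ext <;> simp [he] <;> ring
  have hsw : ∀ i j, csymp n (ζ i) (star (ζ j)) = if i = j then -(2 * Complex.I) else 0 := by
    intro i j
    rw [csymp_swap, h.ortho]
    simp only [eq_comm (a := j)]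
    split_ifs <;> simp
  have hiso' : ∀ i j, csymp n (star (ζ i)) (star (ζ j)) = 0 := by
    intro i j
    rw [← star_csymp, h.isotropic, star_zero]
  have hcol : ∀ p q, e p ⬝ᵥ (Matrix.J (Fin (n + 1)) ℝ *ᵥ e q) = Matrix.J (Fin (n + 1)) ℝ p q := by
    intro p q
    apply Complex.ofReal_injective
    rw [← csymp_ofReal]
    rcases p with i | i <;> rcases q with j | j <;> by_cases hij : i = j
    all_goals
      simp only [hl, hr, map_smul, LinearMap.smul_apply, map_add, map_sub, LinearMap.add_apply,
        LinearMap.sub_apply, h.isotropic, hiso', h.ortho, hsw, hij, Matrix.J,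
        Matrix.fromBlocks_apply₁₁, Matrix.fromBlocks_apply₁₂, Matrix.fromBlocks_apply₂₁,
        Matrix.fromBlocks_apply₂₂, if_true, if_false, smul_eq_mul]
      simp [hij]
      try first | linear_combination Complex.I_mul_I | linear_combination -Complex.I_mul_I
  have hgJ : g ∈ Sp n := by
    rw [mem_Sp_iff]
    ext p q
    rw [← hcol p q, mul_assoc]
    simp only [Matrix.mul_apply, Matrix.mulVec, dotProduct, Matrix.transpose_apply, hg,
      Matrix.of_apply]
  have hel : ∀ j, a *ᵥ e (Sum.inl j) = μ j • e (Sum.inr j) := by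
    intro j
    ext i
    have h1 := congrFun (h.eigen j) i
    have h2 := congrArg Complex.re h1
    simpa [he, Matrix.mulVec, dotProduct] using h2
  have her : ∀ j, a *ᵥ e (Sum.inr j) = -μ j • e (Sum.inl j) := by
    intro j
    ext i
    have h1 := congrFun (h.eigen j) i
    have h2 := congrArg Complex.im h1
    simp [he, Matrix.mulVec, dotProduct] at h2 ⊢
    linarith
  have hag : a * g = g * toSp (diagI μ) := by
    ext i p
    have h1 : (a * g) i p = (a *ᵥ e p) i := by
      simp [Matrix.mul_apply, Matrix.mulVec, dotProduct, hg]
    rw [h1, toSp_diagI]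
    rcases p with j | j
    · rw [hel]
      simp [Matrix.mul_apply, hg, Matrix.diagonal_apply, mul_comm]
    · rw [her]
      simp [Matrix.mul_apply, hg, Matrix.diagonal_apply, mul_comm]
  refine ⟨g⁻¹, Sp_inv hgJ, ?_⟩
  have h2 : g⁻¹ * g⁻¹⁻¹ = 1 := mul_eq_one_comm.1 (Sp_inv_mul (Sp_inv hgJ))
  have h3 : g⁻¹⁻¹ = g := by
    calc g⁻¹⁻¹ = (g * g⁻¹) * g⁻¹⁻¹ := by rw [mul_eq_one_comm.1 (Sp_inv_mul hgJ), one_mul]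
      _ = g := by rw [mul_assoc, h2, mul_one]
  rw [h3, mul_assoc, hag, ← mul_assoc, Sp_inv_mul hgJ, one_mul]

theorem exists_adConj_toSp_diagI (ha : a ∈ sp n)
    (hC : ∃ C : ℝ, ∀ (t : ℝ) (v : Fin (n + 1) ⊕ Fin (n + 1) → ℝ),
      ‖(WithLp.toLp 2 (NormedSpace.exp (t • a) *ᵥ v) : EuclideanSpace ℝ _)‖ ≤
        C * ‖(WithLp.toLp 2 v : EuclideanSpace ℝ _)‖) :
    ∃ μ : Fin (n + 1) → ℝ, AdConj (Sp n) a (toSp (diagI μ)) := by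
  obtain ⟨ζ, μ, h⟩ := exists_adaptedFamily ha (bounded_complexification hC) (n + 1) le_rfl
  exact ⟨μ, h.adConj⟩

theorem exists_unitary_diagI {A : Matrix (Fin (n + 1)) (Fin (n + 1)) ℂ} (hA : A ∈ u n) :
    ∃ (U : Matrix (Fin (n + 1)) (Fin (n + 1)) ℂ) (α : Fin (n + 1) → ℝ), Uᴴ * U = 1 ∧
      U * A * Uᴴ = diagI α := by
  have hA' : Aᴴ = -A := hA
  have hH : (Complex.I • A).IsHermitian := by
    rw [Matrix.IsHermitian, Matrix.conjTranspose_smul, hA']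
    simp
  set V : Matrix (Fin (n + 1)) (Fin (n + 1)) ℂ :=
    hH.eigenvectorUnitary.1 with hV
  have hVV : star V * V = 1 := (Matrix.mem_unitaryGroup_iff').1 hH.eigenvectorUnitary.2
  have hVV' : V * star V = 1 := mul_eq_one_comm.1 hVV
  have hs := hH.spectral_theorem
  have hs' : Complex.I • A = V * Matrix.diagonal (fun j => (hH.eigenvalues j : ℂ)) * star V := by
    simpa [Unitary.conjStarAlgAut_apply, Function.comp_def] using hs
  -- The signs come from `A = -i (i A)`, the spectral theorem being applied to the Hermitian matrix
  -- `i A`.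
  refine ⟨star V, fun j => -hH.eigenvalues j, ?_, ?_⟩
  · rw [← Matrix.star_eq_conjTranspose, star_star, hVV']
  · rw [← Matrix.star_eq_conjTranspose, star_star]
    have h1 : A = (-Complex.I) • (Complex.I • A) := by simp [smul_smul]
    calc star V * A * V = star V * ((-Complex.I) •
          (V * Matrix.diagonal (fun j => (hH.eigenvalues j : ℂ)) * star V)) * V := by
          rw [← hs', ← h1]
      _ = (-Complex.I) • ((star V * V) * Matrix.diagonal
            (fun j => (hH.eigenvalues j : ℂ)) * (star V * V)) := by
          rw [Matrix.mul_smul, Matrix.smul_mul]; simp only [mul_assoc]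
      _ = _ := by
          rw [hVV, one_mul, mul_one, diagI, ← Matrix.diagonal_smul]
          congr 1
          ext j
          simp

theorem exists_adConj_toSU_diagI {A : Matrix (Fin (n + 1)) (Fin (n + 1)) ℂ} (hA : A ∈ u n) :
    ∃ α : Fin (n + 1) → ℝ, AdConj (SU n) (toSU A) (toSU (diagI α)) := by
  obtain ⟨U, α, hU, hUA⟩ := exists_unitary_diagI hA
  have hU' : U * Uᴴ = 1 := mul_eq_one_comm.1 hU
  have htr : (diagI α).trace = A.trace := by
    rw [← hUA, Matrix.trace_mul_comm, ← mul_assoc, hU, one_mul]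
  set g : Matrix (Fin (n + 1) ⊕ Unit) (Fin (n + 1) ⊕ Unit) ℂ := Matrix.fromBlocks U 0 0 1 with hg
  have hgH : gᴴ * hermForm n * g = hermForm n := by
    rw [hg, hermForm, Matrix.fromBlocks_conjTranspose, Matrix.fromBlocks_multiply,
      Matrix.fromBlocks_multiply]
    simp [hU]
  have hgg : g * Matrix.fromBlocks Uᴴ 0 0 1 = 1 := by
    rw [hg, Matrix.fromBlocks_multiply]
    simp [hU']
  -- `diag(U, 1)` need not have determinant one; the scalar correcting this drops out of the
  -- conjugation.
  obtain ⟨c, hc, hcg⟩ := exists_smul_mem_SU hgH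
  refine ⟨α, c • g, hcg, ?_⟩
  have hinv : (c • g)⁻¹ = c⁻¹ • Matrix.fromBlocks Uᴴ 0 0 1 := by
    refine Matrix.inv_eq_right_inv ?_
    rw [Matrix.smul_mul, Matrix.mul_smul, hgg, smul_smul, mul_inv_cancel₀ hc, one_smul]
  rw [hinv, Matrix.mul_smul, Matrix.smul_mul, Matrix.smul_mul, smul_smul, inv_mul_cancel₀ hc,
    one_smul, hg, toSU, toSU, Matrix.fromBlocks_multiply, Matrix.fromBlocks_multiply, htr]
  simp [hUA]

theorem diagI_add_trace (α : Fin (n + 1) → ℝ) :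
    diagI α + (diagI α).trace • (1 : Matrix (Fin (n + 1)) (Fin (n + 1)) ℂ)
      = diagI fun j => α j + ∑ i, α i := by
  rw [← Matrix.diagonal_one, ← Matrix.diagonal_smul, diagI, diagI, Matrix.diagonal_add,
    Matrix.trace_diagonal]
  congr 1
  ext j
  simp [mul_add, Finset.mul_sum]

end NormalForm

/-! ### Recovering a family of frequencies from counts of multiples -/

section Counting

open scoped Classical in
/-- A finite family of nonnegative reals is determined, up to permutation, by the number of its
members in each of the groups `ℤ s`. -/
theorem card_fiber_eq_of_card_multiples_eq {ι : Type*} [Fintype ι] {x y : ι → ℝ}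
    (hx : ∀ i, 0 ≤ x i) (hy : ∀ i, 0 ≤ y i)
    (h : ∀ s : ℝ, 0 < s → (Finset.univ.filter fun i => ∃ k : ℤ, x i = k * s).card =
      (Finset.univ.filter fun i => ∃ k : ℤ, y i = k * s).card) (v : ℝ) :
    (Finset.univ.filter fun i => x i = v).card = (Finset.univ.filter fun i => y i = v).card := by
  classical
  set V : Finset ℝ := Finset.univ.image x ∪ Finset.univ.image y with hV
  have hxV : ∀ i, x i ∈ V := fun i => by simp [hV]
  have hyV : ∀ i, y i ∈ V := fun i => by simp [hV]
  have hV0 : ∀ w ∈ V, 0 ≤ w := by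
    intro w hw
    rw [hV, Finset.mem_union, Finset.mem_image, Finset.mem_image] at hw
    rcases hw with ⟨i, -, rfl⟩ | ⟨i, -, rfl⟩
    exacts [hx i, hy i]
  set d : ℝ → ℤ := fun v => ((Finset.univ.filter fun i => x i = v).card : ℤ)
    - (Finset.univ.filter fun i => y i = v).card with hd
  have hsum : ∀ s : ℝ, 0 < s → ∑ w ∈ V.filter (fun w => ∃ k : ℤ, w = k * s), d w = 0 := by
    intro s hs
    have e1 := Finset.card_eq_sum_card_fiberwise (f := x)
      (s := Finset.univ.filter fun i => ∃ k : ℤ, x i = k * s)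
      (t := V.filter fun w => ∃ k : ℤ, w = k * s) (fun i hi => by
        simp only [Finset.coe_filter, Set.mem_ofPred_eq, Finset.mem_univ, true_and] at hi ⊢
        exact ⟨hxV i, hi⟩)
    have e2 := Finset.card_eq_sum_card_fiberwise (f := y)
      (s := Finset.univ.filter fun i => ∃ k : ℤ, y i = k * s)
      (t := V.filter fun w => ∃ k : ℤ, w = k * s) (fun i hi => by
        simp only [Finset.coe_filter, Set.mem_ofPred_eq, Finset.mem_univ, true_and] at hi ⊢
        exact ⟨hyV i, hi⟩)
    have h1 := h s hs
    rw [e1, e2] at h1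
    rw [Finset.sum_sub_distrib, sub_eq_zero]
    have h2 := congrArg (Nat.cast : ℕ → ℤ) h1
    push_cast at h2
    have f1 : ∀ z : ι → ℝ, ∑ w ∈ V.filter (fun w => ∃ k : ℤ, w = k * s),
        (((Finset.univ.filter fun i => ∃ k : ℤ, z i = k * s).filter (fun i => z i = w)).card : ℤ)
          = ∑ w ∈ V.filter (fun w => ∃ k : ℤ, w = k * s),
            ((Finset.univ.filter fun i => z i = w).card : ℤ) := by
      refine fun z => Finset.sum_congr rfl fun w hw => ?_
      congr 2
      ext i
      simp only [Finset.mem_filter, Finset.mem_univ, true_and, and_iff_right_iff_imp]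
      rintro rfl
      exact (Finset.mem_filter.1 hw).2
    rw [← f1 x, ← f1 y]
    exact h2
  have hzero : d 0 = 0 := by
    by_cases h0 : (0 : ℝ) ∈ V
    -- This `s` exceeds every value in `V`, so `0` is the only multiple of `s` in `V`.
    · set s := 1 + ∑ w ∈ V, w with hs
      have hs0 : 0 < s := by
        have := Finset.sum_nonneg hV0
        linarith
      have h1 := hsum s hs0
      rwa [Finset.sum_eq_single_of_mem 0 (Finset.mem_filter.2 ⟨h0, 0, by simp⟩)] at h1
      intro w hw hw0
      exfalso
      obtain ⟨hw, k, hk⟩ := Finset.mem_filter.1 hw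
      have hw1 : w < s := by
        have := Finset.single_le_sum hV0 hw
        linarith
      have hw2 : 0 < w := lt_of_le_of_ne (hV0 w hw) (Ne.symm hw0)
      rw [hk] at hw1 hw2
      have k1 : (0 : ℝ) < k := pos_of_mul_pos_left hw2 hs0.le
      have k2 : (k : ℝ) < 1 := by
        by_contra hc
        nlinarith
      have k3 : 0 < k := by exact_mod_cast k1
      have k4 : k < 1 := by exact_mod_cast k2
      omega
    · have g1 : (Finset.univ.filter fun i => x i = 0) = ∅ :=
        Finset.filter_eq_empty_iff.2 fun i _ hi => h0 (hi ▸ hxV i)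
      have g2 : (Finset.univ.filter fun i => y i = 0) = ∅ :=
        Finset.filter_eq_empty_iff.2 fun i _ hi => h0 (hi ▸ hyV i)
      simp [hd, g1, g2]
  have hall : ∀ w ∈ V, d w = 0 := by
    by_contra! hcon
    obtain ⟨w₀, hw₀, hd₀⟩ := hcon
    -- Let `s` be the largest value whose multiplicities differ. Its other multiples in `V` are `0`
    -- or larger than `s`, so they contribute nothing and the count for `s` isolates `d s`.
    obtain ⟨s, hs, hmax⟩ := Finset.exists_max_image (V.filter fun w => d w ≠ 0) id
      ⟨w₀, Finset.mem_filter.2 ⟨hw₀, hd₀⟩⟩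
    obtain ⟨hsV, hds⟩ := Finset.mem_filter.1 hs
    have hs0 : 0 < s := lt_of_le_of_ne (hV0 s hsV) fun h0 => hds (h0 ▸ hzero)
    have h1 := hsum s hs0
    rw [Finset.sum_eq_single_of_mem s (Finset.mem_filter.2 ⟨hsV, 1, by simp⟩)] at h1
    · exact hds h1
    intro w hw hws
    by_contra hdw
    obtain ⟨hw, k, hk⟩ := Finset.mem_filter.1 hw
    have h2 : w ≤ s := hmax w (Finset.mem_filter.2 ⟨hw, hdw⟩)
    have h3 : w ≠ 0 := by rintro rfl; exact hdw hzero
    have h4 : 0 < w := lt_of_le_of_ne (hV0 w hw) (Ne.symm h3)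
    have h5 : w < s := lt_of_le_of_ne h2 hws
    rw [hk] at h4 h5
    have k1 : (0 : ℝ) < k := pos_of_mul_pos_left h4 hs0.le
    have k2 : (k : ℝ) < 1 := by
      by_contra hc
      nlinarith
    have k3 : 0 < k := by exact_mod_cast k1
    have k4 : k < 1 := by exact_mod_cast k2
    omega
  by_cases hv : v ∈ V
  · have := hall v hv
    simp only [hd, sub_eq_zero] at this
    exact_mod_cast this
  · have g1 : (Finset.univ.filter fun i => x i = v) = ∅ :=
      Finset.filter_eq_empty_iff.2 fun i _ hi => hv (hi ▸ hxV i)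
    have g2 : (Finset.univ.filter fun i => y i = v) = ∅ :=
      Finset.filter_eq_empty_iff.2 fun i _ hi => hv (hi ▸ hyV i)
    rw [g1, g2]

theorem exists_perm_of_card_fiber_eq {ι α : Type*} [Fintype ι] [DecidableEq α]
    {x y : ι → α} (h : ∀ v, (Finset.univ.filter fun i => x i = v).card =
      (Finset.univ.filter fun i => y i = v).card) :
    ∃ σ : ι ≃ ι, ∀ i, y (σ i) = x i := by
  have e : ∀ v, {i // x i = v} ≃ {i // y i = v} := fun v =>
    Fintype.equivOfCardEq (by rw [Fintype.card_subtype, Fintype.card_subtype, h v])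
  exact ⟨Equiv.ofFiberEquiv e, Equiv.ofFiberEquiv_map e⟩

end Counting

/-! ### Matching the frequencies of the two flows -/

section Matching
open scoped Matrix.Norms.Frobenius
open Metric Module

variable {n : ℕ}

/-- Complex conjugation of a coordinate reverses the sign of its frequency, so real linear maps see
only absolute values. -/
theorem realConj_diagI {μ ν : Fin (n + 1) → ℝ} {σ : Fin (n + 1) ≃ Fin (n + 1)}
    (h : ∀ j, |ν (σ j)| = |μ j|) : RealConj (diagI μ) (diagI ν) := by
  classical
  let T : Fin (n + 1) → ℂ ≃ₗ[ℝ] ℂ := fun j =>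
    if ν (σ j) = μ j then LinearEquiv.refl ℝ ℂ else Complex.conjAe.toLinearEquiv
  have hT : ∀ j (z : ℂ), T j (Complex.I * μ j * z) = Complex.I * ν (σ j) * T j z := by
    intro j z
    by_cases hj : ν (σ j) = μ j
    · simp [T, hj]
    · have h1 : ν (σ j) = -μ j := (abs_eq_abs.1 (h j)).resolve_left hj
      simp only [T, hj, if_false]
      rw [h1]
      simp
  refine ⟨(LinearEquiv.piCongrRight T).trans (LinearEquiv.funCongrLeft ℝ ℂ σ.symm), fun z => ?_⟩
  ext k
  obtain ⟨j, rfl⟩ := σ.surjective k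
  simp only [diagI, LinearEquiv.trans_apply, LinearEquiv.funCongrLeft_apply, LinearMap.funLeft_apply,
    Equiv.symm_apply_apply, LinearEquiv.piCongrRight_apply, Matrix.mulVec_diagonal]
  exact hT j (z j)

theorem exp_diagI_mulVec (μ : Fin (n + 1) → ℝ) (t : ℝ) (z : Fin (n + 1) → ℂ) :
    NormedSpace.exp (t • diagI μ) *ᵥ z = fun j => Complex.exp (Complex.I * (t * μ j)) * z j := by
  have h1 : t • diagI μ = Matrix.diagonal fun j => Complex.I * (t * μ j) := by
    ext i j
    by_cases h : i = j <;> simp [diagI, h] <;> ring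
  ext j
  rw [h1, Matrix.exp_diagonal, Matrix.mulVec_diagonal, Pi.coe_exp, Complex.exp_eq_exp_ℂ]

/-- The time `2π / s` detects the frequencies in `ℤ s`; the absolute value is harmless because this
group is symmetric. -/
theorem exp_I_mul_eq_one_iff (x s : ℝ) (hs : 0 < s) :
    Complex.exp (Complex.I * ((2 * Real.pi / s : ℝ) * x)) = 1 ↔ ∃ k : ℤ, |x| = k * s := by
  have hpi := Real.pi_pos
  have e : ∀ k : ℤ, Complex.I * ((2 * Real.pi / s : ℝ) * x) = k * (2 * Real.pi * Complex.I) ↔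
      x = k * s := by
    intro k
    have h1 : Complex.I * ((2 * Real.pi / s : ℝ) * x) = ((2 * Real.pi / s * x : ℝ) : ℂ) * Complex.I := by
      push_cast; ring
    have h2 : (k : ℂ) * (2 * Real.pi * Complex.I) = ((k * (2 * Real.pi) : ℝ) : ℂ) * Complex.I := by
      push_cast; ring
    rw [h1, h2, mul_left_inj' Complex.I_ne_zero, Complex.ofReal_inj]
    field_simp
  rw [Complex.exp_eq_one_iff]
  simp only [e]
  constructor
  · rintro ⟨k, rfl⟩
    rcases abs_choice ((k : ℝ) * s) with h | h
    · exact ⟨k, h⟩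
    · exact ⟨-k, by rw [h]; push_cast; ring⟩
  · rintro ⟨k, h⟩
    rcases abs_choice x with h1 | h1
    · exact ⟨k, by rw [← h1, h]⟩
    · exact ⟨-k, by push_cast; linarith⟩

/-- The real vector space of complex vectors whose coordinates vanish where `P` fails. -/
def coordSubspace (P : Fin (n + 1) → Prop) : Submodule ℝ (Fin (n + 1) → ℂ) where
  carrier := {z | ∀ j, ¬ P j → z j = 0}
  zero_mem' := fun _ _ => rfl
  add_mem' := fun hz hw j hj => by simp [hz j hj, hw j hj]
  smul_mem' := fun c z hz j hj => by simp [hz j hj]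

open Classical in
theorem finrank_coordSubspace (P : Fin (n + 1) → Prop) :
    finrank ℝ (coordSubspace P) = 2 * (Finset.univ.filter P).card := by
  have h := LinearMap.iInfKerProjEquiv ℝ (fun _ : Fin (n + 1) => ℂ) (I := {j | P j})
    (J := {j | ¬ P j}) (Set.disjoint_left.2 fun j hj hj' => hj' hj)
    (fun j _ => by by_cases hj : P j <;> simp [hj])
  have h1 : (⨅ i ∈ {j | ¬ P j}, LinearMap.ker (LinearMap.proj i :
      (Fin (n + 1) → ℂ) →ₗ[ℝ] ℂ)) = coordSubspace P := by
    ext z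
    simp [coordSubspace, Submodule.mem_iInf]
  rw [h1] at h
  rw [h.finrank_eq, finrank_pi_fintype]
  simp [Fintype.card_subtype, mul_comm]

theorem exp_diagI_mulVec_eq_self_iff (μ : Fin (n + 1) → ℝ) (t : ℝ) (z : Fin (n + 1) → ℂ) :
    NormedSpace.exp (t • diagI μ) *ᵥ z = z ↔
      z ∈ coordSubspace fun j => Complex.exp (Complex.I * (t * μ j)) = 1 := by
  rw [exp_diagI_mulVec, funext_iff]
  refine forall_congr' fun j => ?_
  constructor
  · intro h hj
    have h1 : (Complex.exp (Complex.I * (t * μ j)) - 1) * z j = 0 := by rw [sub_mul, h]; ring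
    exact (mul_eq_zero.1 h1).resolve_left (sub_ne_zero.2 hj)
  · intro h
    by_cases hj : Complex.exp (Complex.I * (t * μ j)) = 1
    · rw [hj, one_mul]
    · rw [h hj, mul_zero]

theorem norm_realify (z : Fin (n + 1) → ℂ) :
    ‖(WithLp.toLp 2 (realify n z) : EuclideanSpace ℝ _)‖
      = ‖(WithLp.toLp 2 z : EuclideanSpace ℂ (Fin (n + 1)))‖ := by
  rw [EuclideanSpace.norm_eq, EuclideanSpace.norm_eq, Fintype.sum_sum_type,
    ← Finset.sum_add_distrib]
  congr 1
  refine Finset.sum_congr rfl fun j _ => ?_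
  rw [Complex.sq_norm, Complex.normSq_apply]
  simp [realify, ← sq]

theorem exp_toSp_mulVec (B : Matrix (Fin (n + 1)) (Fin (n + 1)) ℂ) (t : ℝ) (z : Fin (n + 1) → ℂ) :
    NormedSpace.exp (t • toSp B) *ᵥ realify n z = realify n (NormedSpace.exp (t • B) *ᵥ z) :=
  (exp_intertwine (realify n).toLinearMap (fun z => (toSp_mulVec B z).symm) t z).symm

theorem spFlow_toSp {B : Matrix (Fin (n + 1)) (Fin (n + 1)) ℂ} (hB : B ∈ u n) (t : ℝ)
    (v : sphere (0 : EuclideanSpace ℝ (Fin (n + 1) ⊕ Fin (n + 1))) 1) :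
    (spFlow (toSp B) t v).1 =
      WithLp.toLp 2 (realify n (NormedSpace.exp (t • B) *ᵥ (realify n).symm v.1)) := by
  have h := exp_toSp_mulVec B t ((realify n).symm v.1)
  rw [LinearEquiv.apply_symm_apply] at h
  have hn : ‖(WithLp.toLp 2 (NormedSpace.exp (t • toSp B) *ᵥ v.1) : EuclideanSpace ℝ _)‖ = 1 := by
    rw [h, norm_realify]
    refine (norm_exp_mulVec hB t (WithLp.toLp 2 ((realify n).symm v.1))).trans ?_
    rw [← norm_realify, LinearEquiv.apply_symm_apply]
    simp
  simp only [spFlow, unitVec]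
  rw [hn, inv_one, one_smul, h]

theorem spFlow_toSp_eq_self_iff (μ : Fin (n + 1) → ℝ) (t : ℝ)
    (v : sphere (0 : EuclideanSpace ℝ (Fin (n + 1) ⊕ Fin (n + 1))) 1) :
    spFlow (toSp (diagI μ)) t v = v ↔ (realify n).symm v.1 ∈
      coordSubspace fun j => Complex.exp (Complex.I * (t * μ j)) = 1 := by
  rw [← exp_diagI_mulVec_eq_self_iff, Subtype.ext_iff, spFlow_toSp (diagI_mem μ)]
  constructor
  · intro h
    exact ((realify n).eq_symm_apply).2 (congrArg WithLp.ofLp h)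
  · intro h
    rw [h, LinearEquiv.apply_symm_apply]

-- The time `t` fixed points of each flow are the unit vectors of a subspace whose real dimension is
-- twice the number of coordinates fixed at time `t`. `F` and its inverse exchange them, giving both
-- inequalities of dimensions.
open Classical in
theorem card_fixed_eq {α μ : Fin (n + 1) → ℝ}
    {F : sphere (0 : EuclideanSpace ℂ (Fin (n + 1))) 1 ≃ₜ
        sphere (0 : EuclideanSpace ℝ (Fin (n + 1) ⊕ Fin (n + 1))) 1}
    (hF : ∀ t x, F (suFlow (toSU_mem (diagI_mem α)).1 t x) = spFlow (toSp (diagI μ)) t (F x))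
    (hd : ∀ x ≠ 0, DifferentiableAt ℝ (radialExt F) x)
    (hd' : ∀ x ≠ 0, DifferentiableAt ℝ (radialExt F.symm) x) (t : ℝ) :
    (Finset.univ.filter fun j => Complex.exp (Complex.I * (t * (α j + ∑ i, α i : ℝ))) = 1).card =
      (Finset.univ.filter fun j => Complex.exp (Complex.I * (t * μ j)) = 1).card := by
  let e₁ : (Fin (n + 1) → ℂ) ≃ₗ[ℝ] EuclideanSpace ℂ (Fin (n + 1)) :=
    (WithLp.linearEquiv 2 ℝ (Fin (n + 1) → ℂ)).symm
  let e₂ : (Fin (n + 1) → ℂ) ≃ₗ[ℝ] EuclideanSpace ℝ (Fin (n + 1) ⊕ Fin (n + 1)) :=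
    (realify n).trans (WithLp.linearEquiv 2 ℝ (Fin (n + 1) ⊕ Fin (n + 1) → ℝ)).symm
  set P₁ : Fin (n + 1) → Prop := fun j =>
    Complex.exp (Complex.I * (t * (α j + ∑ i, α i : ℝ))) = 1 with hP₁
  set P₂ : Fin (n + 1) → Prop := fun j => Complex.exp (Complex.I * (t * μ j)) = 1 with hP₂
  set K₁ := (coordSubspace P₁).map e₁.toLinearMap with hK₁
  set K₂ := (coordSubspace P₂).map e₂.toLinearMap with hK₂
  have m₁ : ∀ x : sphere (0 : EuclideanSpace ℂ (Fin (n + 1))) 1,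
      x.1 ∈ K₁ ↔ suFlow (toSU_mem (diagI_mem α)).1 t x = x := by
    intro x
    rw [hK₁, Submodule.mem_map_equiv, Subtype.ext_iff, suFlow_toSU (diagI_mem α), diagI_add_trace]
    refine (exp_diagI_mulVec_eq_self_iff (fun j => α j + ∑ i, α i) t x.1).symm.trans ?_
    exact ⟨fun h => by rw [h], fun h => congrArg WithLp.ofLp h⟩
  have m₂ : ∀ v : sphere (0 : EuclideanSpace ℝ (Fin (n + 1) ⊕ Fin (n + 1))) 1,
      v.1 ∈ K₂ ↔ spFlow (toSp (diagI μ)) t v = v := by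
    intro v
    rw [hK₂, Submodule.mem_map_equiv, spFlow_toSp_eq_self_iff]
    rfl
  have f₁ : finrank ℝ K₁ = 2 * (Finset.univ.filter P₁).card := by
    rw [hK₁, LinearEquiv.finrank_map_eq, finrank_coordSubspace]
  have f₂ : finrank ℝ K₂ = 2 * (Finset.univ.filter P₂).card := by
    rw [hK₂, LinearEquiv.finrank_map_eq, finrank_coordSubspace]
  have l₁ := finrank_le_of_radialExt F hd hd' K₁ K₂ fun x hx => by
    rw [m₂, ← hF, (m₁ x).1 hx]
  have l₂ := finrank_le_of_radialExt F.symm hd' hd K₂ K₁ fun v hv => by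
    rw [m₁]
    apply F.injective
    rw [hF, Homeomorph.apply_symm_apply, (m₂ v).1 hv]
  have l : (Finset.univ.filter P₁).card = (Finset.univ.filter P₂).card := by omega
  convert l

theorem LocallyConjugate.realConj_diagI (hn : 1 ≤ n) {α μ : Fin (n + 1) → ℝ}
    (h : LocallyConjugate (toSU (diagI α)) (toSp (diagI μ))) :
    RealConj (diagI α + (diagI α).trace • (1 : Matrix (Fin (n + 1)) (Fin (n + 1)) ℂ)) (diagI μ) := by
  classical
  obtain ⟨F, hF, hd, hd'⟩ :=
    h.exists_homeomorph hn (toSU_mem (diagI_mem α)).1 (toSp_mem (diagI_mem μ))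
  obtain ⟨σ, hσ⟩ := exists_perm_of_card_fiber_eq
    (card_fiber_eq_of_card_multiples_eq (x := fun j => |α j + ∑ i, α i|) (y := fun j => |μ j|)
      (fun _ => abs_nonneg _) (fun _ => abs_nonneg _) fun s hs => by
        have h1 := card_fixed_eq hF hd hd' (2 * Real.pi / s)
        simp only [exp_I_mul_eq_one_iff _ s hs] at h1
        convert h1)
  rw [diagI_add_trace]
  exact RootCone.realConj_diagI hσ

end Matching

/-! ### Assembly of the theorem -/

section Final

variable {n : ℕ}

theorem RealConj.refl (A : Matrix (Fin (n + 1)) (Fin (n + 1)) ℂ) : RealConj A A :=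
  ⟨LinearEquiv.refl ℝ _, fun _ => rfl⟩

/-- The trace of `A + tr A` is `(n+2) tr A`, so `A = B - tr B / (n+2)`. Thus every unitary linear
flow occurs on the first cone, as the third assertion requires. -/
theorem exists_add_trace_eq {B : Matrix (Fin (n + 1)) (Fin (n + 1)) ℂ} (hB : B ∈ u n) :
    ∃ A ∈ u n, A + A.trace • (1 : Matrix (Fin (n + 1)) (Fin (n + 1)) ℂ) = B := by
  have hB' : Bᴴ = -B := hB
  have htr : star B.trace = -B.trace := by
    rw [← Matrix.trace_conjTranspose, hB', Matrix.trace_neg]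
  have hn : (n : ℂ) + 2 ≠ 0 := by exact_mod_cast (by omega : n + 2 ≠ 0)
  refine ⟨B - (B.trace / (n + 2)) • (1 : Matrix (Fin (n + 1)) (Fin (n + 1)) ℂ), ?_, ?_⟩
  · change (B - (B.trace / (n + 2)) • (1 : Matrix (Fin (n + 1)) (Fin (n + 1)) ℂ))ᴴ = _
    have hs : star (B.trace / ((n : ℂ) + 2)) = -(B.trace / (n + 2)) := by
      rw [star_div₀, htr]
      simp [neg_div]
    rw [Matrix.conjTranspose_sub, Matrix.conjTranspose_smul, Matrix.conjTranspose_one, hB', hs,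
      neg_smul]
    abel
  · have h : (B - (B.trace / (n + 2)) • (1 : Matrix (Fin (n + 1)) (Fin (n + 1)) ℂ)).trace
        = B.trace / (n + 2) := by
      rw [Matrix.trace_sub, Matrix.trace_smul, Matrix.trace_one, Fintype.card_fin, smul_eq_mul]
      push_cast
      field_simp
      ring
    rw [h, sub_add_cancel]

/-- The order matters: `a₁` is first made diagonal, since the bound on `exp (t a₂)` comes from the
isometric flow of the diagonal representative. -/
theorem LocallyConjugate.exists_normalForm (hn : 1 ≤ n)
    {a₁ : Matrix (Fin (n + 1) ⊕ Unit) (Fin (n + 1) ⊕ Unit) ℂ}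
    {a₂ : Matrix (Fin (n + 1) ⊕ Fin (n + 1)) (Fin (n + 1) ⊕ Fin (n + 1)) ℝ}
    (h : LocallyConjugate a₁ a₂) (ha₁ : a₁ ∈ su n) (ha₂ : a₂ ∈ sp n) :
    ∃ A ∈ u n, ∃ B ∈ u n, AdConj (SU n) a₁ (toSU A) ∧ AdConj (Sp n) a₂ (toSp B) ∧
      RealConj (A + A.trace • (1 : Matrix (Fin (n + 1)) (Fin (n + 1)) ℂ)) B := by
  obtain ⟨A, hA, h₁⟩ := h.exists_adConj_toSU hn ha₁ ha₂
  obtain ⟨α, hα⟩ := exists_adConj_toSU_diagI hA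
  have hα' := h₁.trans_SU hα
  have h' := h.conj_left hα'
  obtain ⟨F, hF, -, -⟩ := h'.exists_homeomorph hn (toSU_mem (diagI_mem α)).1 ha₂
  obtain ⟨μ, hμ⟩ := exists_adConj_toSp_diagI ha₂ (exists_bound_exp (diagI_mem α) ha₂ hF)
  exact ⟨diagI α, diagI_mem α, diagI μ, diagI_mem μ, hα', hμ, (h'.conj_right hμ).realConj_diagI hn⟩

end Final

end RootCone

end

open RootCone in
theorem mainTheorem7 (n : ℕ) (hn : 1 ≤ n)
    (a₁ : Matrix (Fin (n + 1) ⊕ Unit) (Fin (n + 1) ⊕ Unit) ℂ) (ha₁ : a₁ ∈ su n)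
    (a₂ : Matrix (Fin (n + 1) ⊕ Fin (n + 1)) (Fin (n + 1) ⊕ Fin (n + 1)) ℝ) (ha₂ : a₂ ∈ sp n) :
    (LocallyConjugate a₁ a₂ ↔
      ∃ A ∈ u n, ∃ B ∈ u n, AdConj (SU n) a₁ (toSU A) ∧ AdConj (Sp n) a₂ (toSp B) ∧
        RealConj (A + A.trace • (1 : Matrix (Fin (n + 1)) (Fin (n + 1)) ℂ)) B) ∧
    ((∃ b₂ ∈ sp n, LocallyConjugate a₁ b₂) ↔ ∃ A ∈ u n, AdConj (SU n) a₁ (toSU A)) ∧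
    ((∃ b₁ ∈ su n, LocallyConjugate b₁ a₂) ↔ ∃ B ∈ u n, AdConj (Sp n) a₂ (toSp B)) := by
  refine ⟨⟨fun h => h.exists_normalForm hn ha₁ ha₂, ?_⟩, ⟨?_, ?_⟩, ⟨?_, ?_⟩⟩
  · rintro ⟨A, hA, B, hB, h₁, h₂, hAB⟩
    exact ((locallyConjugate_of_realConj hA hB hAB).conj_left h₁.symm_SU).conj_right h₂.symm_Sp
  · rintro ⟨b₂, hb₂, h⟩
    exact h.exists_adConj_toSU hn ha₁ hb₂
  · rintro ⟨A, hA, h₁⟩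
    -- The partner of `ι₁(A)` is `ι₂(A + tr A)`, with the identity as linear conjugacy.
    have hB : A + A.trace • (1 : Matrix (Fin (n + 1)) (Fin (n + 1)) ℂ) ∈ u n := add_trace_skew hA
    exact ⟨_, toSp_mem hB, (locallyConjugate_of_realConj hA hB (RealConj.refl _)).conj_left
      h₁.symm_SU⟩
  · rintro ⟨b₁, hb₁, h⟩
    obtain ⟨A, -, B, hB, -, h₂, -⟩ := h.exists_normalForm hn hb₁ ha₂
    exact ⟨B, hB, h₂⟩
  · rintro ⟨B, hB, h₂⟩
    obtain ⟨A, hA, rfl⟩ := exists_add_trace_eq hB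
    exact ⟨_, (toSU_mem hA), (locallyConjugate_of_realConj hA hB (RealConj.refl _)).conj_right
      h₂.symm_Sp⟩
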